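/- Let $\mathcal X,\mathcal U$ be finite-dimensional real inner product spaces, $\mathcal M\subset\mathcal X$ a $C^2$-smooth embedded submanifold and $\Omega\subset\mathcal U$ open. For $x\in\mathcal M$ let $\Pi(x)$ and $\Pi^\perp(x)$ be the orthogonal projections onto the tangent space $T_x\mathcal M$ and onto the normal space $N_x\mathcal M$. For $w\in N_x\mathcal M$ let $\mathfrak W_x(v,w)=-\Pi(x)\,\mathrm dW[v]$ be the Weingarten map ($W$ any local normal field on $\mathcal M$ with $W(x)=w$). For $h$ with a $C^2$ extension $\tilde h$ of $h|_{\mathcal M}$ around $x$, let $\nabla_{\mathcal M}h(x)=\Pi(x)\nabla\tilde h(x)$ and $\nabla^2_{\mathcal M}h(x)=\Pi(x)\nabla^2\tilde h(x)+\mathfrak W_x(\cdot,\Pi^\perp(x)\nabla\tilde h(x))$ be the Riemannian gradient and Hessian; operators on $T_x\mathcal M$ are extended to $\mathcal X$ by precomposition with $\Pi(x)$, and $\dagger$ is the Moore–Penrose pseudoinverse. In the operators below derivatives of $f$ and $g$ in the first argument carry the subscript $x$, in the second the subscript $u$. A proper lower semicontinuous $h$ with values in $\overline{\mathbb R}$ is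 partly smooth relative to a set $\mathcal N$ if at every $z\in\mathcal N$: $h$ is (Clarke) regular with $\partial h(z)\ne\emptyset$, $\partial$ being the limiting subdifferential; $\mathcal N$ is a $C^2$ manifold and $h|_{\mathcal N}$ is $C^2$ around $z$; $N_z\mathcal N$ is the linear subspace parallel to the affine hull of $\partial h(z)$; and $\partial h$ is continuous at $z$ relative to $\mathcal N$ (Painlevé–Kuratowski). Let $f:\mathcal X\times\mathcal U\to\mathbb R$ be $C^2$, let $g:\mathcal X\times\mathcal U\to\overline{\mathbb R}$ be partly smooth relative to $\mathcal M\times\Omega$, and suppose that for every $u\in\Omega$ the functions $f(\cdot,u)$ and $g(\cdot,u)$ are convex and $\nabla_xf(\cdot,u)$ is $L$-Lipschitz. Put $F=f+g$. Let $(x^*,u)\in\mathcal M\times\Omega$ satisfy * $\nabla^2_{\mathcal M}F(x^*,u)\succ0$ on $T_{x^*}\mathcal M$, and $\Pi(x^*)\nabla_x^2f(x^*,u)\succ0$ or $\nabla_{\mathcal M}^2g(x^*,u)\succ0$ on $T_{x^*}\mathcal M$; * $0\in\operatorname{ri}\partial_xF(x^*,u)$. Let $0<\underline\alpha\le\bar\alpha<2/L$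 (with $2/0=+\infty$). For $\alpha>0$ put $$P_\alpha(w,u)=\operatorname*{argmin}_{x\in\mathcal X}\ \alpha g(x,u)+\tfrac12\|x-w\|^2,\qquad A_\alpha(x,u)=P_\alpha(x-\alpha\nabla_xf(x,u),u),$$ and for $x\in\mathcal M$ put $\nu=\operatorname{proj}_{\partial_xg(x,u)}(-\nabla_xf(x,u))$, $w=x+\alpha\nu$, and $$\phi(x,u)=-\Big(\nabla^2_{\mathcal M}F(x,u)-\mathfrak W_x\big(\cdot,\alpha\,\Pi^\perp(x)(\nu+\nabla_xf(x,u))\big)\Big)^{\dagger}D_u\nabla_{\mathcal M}F(x,u).$$ (1) For every $x\in\mathcal M$ sufficiently close to $x^*$ and every $\alpha\in[\underline\alpha,\bar\alpha]$, the projection $\nu$ exists, $P_\alpha$ is differentiable at $(w,u)$, $\nabla_{\mathcal M}F(x,\cdot)$ is differentiable at $u$, and the equation $$X=D_xP_\alpha(w,u)\big((I-\alpha\nabla_x^2f(x,u))X-\alpha\nabla_{xu}f(x,u)\big)+D_uP_\alpha(w,u)$$ for a linear map $X:\mathcal U\to\mathcal X$, which is obtained by implicit differentiation of the fixed-point equation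 $x=A_\alpha(x,u)$, has $X=\phi(x,u)$ as its one and only solution. (2) Fixed-point automatic differentiation computes the same quantity: let $\alpha\in[\underline\alpha,\bar\alpha]$ and $\beta\in[0,1]$ be such that every eigenvalue of $D_xA_\alpha(x^*,u)$ is larger than $-1/(1+2\beta)$. Then for every $x\in\mathcal M$ sufficiently close to $x^*$ and every $\dot u\in\mathcal U$ the sequence defined by $\hat x_0=\hat x_{-1}=0$ and $$\hat y_k=(1+\beta)\hat x_k-\beta\hat x_{k-1},\quad \hat w_k=\hat y_k-\alpha\nabla_x^2f(x,u)\hat y_k-\alpha\nabla_{xu}f(x,u)\dot u,\quad \hat x_{k+1}=DP_\alpha(w,u)(\hat w_k,\dot u)$$ converges to $\phi(x,u)\dot u$. ($\beta=0$ is fixed-point automatic differentiation of proximal gradient descent.) -/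

import Mathlib

open Filter Topology Set
open scoped RealInnerProductSpace NNReal

noncomputable section

namespace FixedPointAD

/-! ### Submanifolds of a Euclidean space -/

section Manifold

variable {V : Type*} [NormedAddCommGroup V] [InnerProductSpace ℝ V] [FiniteDimensional ℝ V]

/-- `M` is a `C²`-smooth `m`-dimensional embedded submanifold of `V` for some `m`: near each of its
points it is the zero set of a `C²` map into `ℝ^(dim V - m)` whose derivative at that point is
onto. -/
def IsC2Submanifold (M : Set V) : Prop :=
  ∃ m ≤ Module.finrank ℝ V, ∀ x ∈ M,
    ∃ (X : Set V) (Φ : V → EuclideanSpace ℝ (Fin (Module.finrank ℝ V - m))),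
      IsOpen X ∧ x ∈ X ∧ ContDiffOn ℝ 2 Φ X ∧ Function.Surjective (fderiv ℝ Φ x) ∧
        X ∩ M = {y ∈ X | Φ y = 0}

/-- `v` is a tangent vector of `M` at `x`: the velocity at `0` of a `C¹` curve in `M`
through `x`. -/
def IsTangentVector (M : Set V) (x v : V) : Prop :=
  ∃ (ε : ℝ) (γ : ℝ → V), 0 < ε ∧ ContDiffOn ℝ 1 γ (Ioo (-ε) ε) ∧ (∀ t ∈ Ioo (-ε) ε, γ t ∈ M) ∧
    γ 0 = x ∧ HasDerivAt γ v 0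

/-- The tangent space. (For a submanifold the tangent vectors already form a linear subspace;
the span only serves to bundle them as a `Submodule`.) -/
def tangentSpace (M : Set V) (x : V) : Submodule ℝ V :=
  Submodule.span ℝ {v | IsTangentVector M x v}

/-- The normal space, the orthogonal complement of the tangent space. -/
def normalSpace (M : Set V) (x : V) : Submodule ℝ V := (tangentSpace M x)ᗮ

/-- The orthogonal projection `Π(x)` onto the tangent space, as an operator on `V`. -/
def tanProj (M : Set V) (x : V) : V →L[ℝ] V := (tangentSpace M x).starProjection

/-- The orthogonal projection `Π^⊥(x)` onto the normal space, as an operator on `V`. -/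
def norProj (M : Set V) (x : V) : V →L[ℝ] V := (normalSpace M x).starProjection

/-- `W` is a local `C¹` extension of `w` to a normal vector field of `M` near `x`. -/
def IsNormalField (M : Set V) (x w : V) (W : V → V) : Prop :=
  ContDiffAt ℝ 1 W x ∧ W x = w ∧ ∀ᶠ y in 𝓝[M] x, W y ∈ normalSpace M y

open Classical in
/-- The Weingarten map `v ↦ -Π(x) dW[v]` in the direction of the normal vector `w`, where `W` is any
local extension of `w` to a normal field (the map does not depend on the extension). It is an
operator on the tangent space, extended to `V` by precomposition with `Π(x)`. -/
def weingarten (M : Set V) (x w : V) : V →L[ℝ] V :=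
  if h : ∃ W : V → V, IsNormalField M x w W then
    -(tanProj M x ∘L fderiv ℝ h.choose x ∘L tanProj M x)
  else 0

/-- `e` is a `C²` extension around `x` of the restriction of `h` to `M`. -/
def IsSmoothExtension (M : Set V) (h : V → EReal) (x : V) (e : V → ℝ) : Prop :=
  ContDiffAt ℝ 2 e x ∧ ∀ᶠ y in 𝓝[M] x, h y = (e y : EReal)

end Manifold

section RiemannianDerivatives

variable {V : Type*} [NormedAddCommGroup V] [InnerProductSpace ℝ V] [FiniteDimensional ℝ V]

instance (priority := 100) instCompleteSpaceOfFiniteDimensionalReal : CompleteSpace V :=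
  FiniteDimensional.complete ℝ V

open Classical in
/-- The Riemannian gradient `Π(x) ∇e(x)` of `h` restricted to `M`, for any smooth extension `e`
(it does not depend on the extension). -/
def riemGrad (M : Set V) (h : V → EReal) (x : V) : V :=
  if H : ∃ e : V → ℝ, IsSmoothExtension M h x e then tanProj M x (gradient H.choose x) else 0

open Classical in
/-- The Riemannian Hessian `Π(x) ∇²e(x) + 𝔚(·, Π^⊥(x) ∇e(x))` of `h` restricted to `M`, for any
smooth extension `e` (it does not depend on the extension). It is an operator on the tangent space,
extended to `V` by precomposition with `Π(x)`. -/
def riemHess (M : Set V) (h : V → EReal) (x : V) : V →L[ℝ] V :=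
  if H : ∃ e : V → ℝ, IsSmoothExtension M h x e then
    tanProj M x ∘L fderiv ℝ (gradient H.choose) x ∘L tanProj M x
      + weingarten M x (norProj M x (gradient H.choose x))
  else 0

/-- The operator `A` is positive definite on the subspace `T`. -/
def PosDefOn (A : V →L[ℝ] V) (T : Submodule ℝ V) : Prop :=
  ∀ v ∈ T, v ≠ 0 → 0 < ⟪A v, v⟫

/-- The four Penrose equations. -/
def IsPseudoinverse (A B : V →L[ℝ] V) : Prop :=
  A ∘L B ∘L A = A ∧ B ∘L A ∘L B = B ∧
    (A ∘L B : V →L[ℝ] V).toLinearMap.IsSymmetric ∧ (B ∘L A : V →L[ℝ] V).toLinearMap.IsSymmetric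

open Classical in
/-- The Moore-Penrose pseudoinverse. -/
def pinv (A : V →L[ℝ] V) : V →L[ℝ] V :=
  if h : ∃ B, IsPseudoinverse A B then h.choose else 0

end RiemannianDerivatives

/-! ### Variational analysis and partial smoothness -/

section Variational

variable {E : Type*} [NormedAddCommGroup E] [InnerProductSpace ℝ E]

/-- Regular (Fréchet) normals to `C` at `x`. -/
def regularNormals (C : Set E) (x : E) : Set E :=
  {v | x ∈ C ∧ ∀ ε > 0, ∀ᶠ y in 𝓝[C] x, ⟪v, y - x⟫ ≤ ε * ‖y - x‖}

/-- General (limiting) normals to `C` at `x`. -/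
def limitingNormals (C : Set E) (x : E) : Set E :=
  {v | x ∈ C ∧ ∃ (xs vs : ℕ → E), (∀ k, vs k ∈ regularNormals C (xs k)) ∧
    Tendsto xs atTop (𝓝 x) ∧ Tendsto vs atTop (𝓝 v)}

/-- Clarke regularity of a set at one of its points. -/
def IsClarkeRegular (C : Set E) (x : E) : Prop :=
  x ∈ C ∧ (∃ r > 0, IsClosed (C ∩ Metric.closedBall x r)) ∧
    limitingNormals C x ⊆ regularNormals C x

/-- The epigraph of an extended-real-valued function, in the Euclidean space `E × ℝ`. -/
def epigraph (h : E → EReal) : Set (WithLp 2 (E × ℝ)) :=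
  {p | h p.fst ≤ (p.snd : EReal)}

/-- (Subdifferential) regularity of `h` at `x`: `h x` is finite and the epigraph is Clarke regular
at `(x, h x)`. -/
def IsRegularAt (h : E → EReal) (x : E) : Prop :=
  ∃ t : ℝ, h x = t ∧ IsClarkeRegular (epigraph h) (WithLp.toLp 2 (x, t))

/-- Regular (Fréchet) subgradients. -/
def regularSubdiff (h : E → EReal) (x : E) : Set E :=
  {v | h x ≠ ⊥ ∧ h x ≠ ⊤ ∧
    ∀ ε > 0, ∀ᶠ y in 𝓝 x, h x + ((⟪v, y - x⟫ - ε * ‖y - x‖ : ℝ) : EReal) ≤ h y}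

/-- The general (limiting) subdifferential `∂h(x)`. -/
def subdiff (h : E → EReal) (x : E) : Set E :=
  {v | h x ≠ ⊥ ∧ h x ≠ ⊤ ∧ ∃ (xs vs : ℕ → E), (∀ k, vs k ∈ regularSubdiff h (xs k)) ∧
    Tendsto xs atTop (𝓝 x) ∧ Tendsto (fun k => h (xs k)) atTop (𝓝 (h x)) ∧
    Tendsto vs atTop (𝓝 v)}

/-- The subdifferential of convex analysis, for convex functions. -/
def convexSubdiff (h : E → EReal) (x : E) : Set E :=
  {v | h x ≠ ⊤ ∧ ∀ y, h x + ((⟪v, y - x⟫ : ℝ) : EReal) ≤ h y}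

/-- Convexity of an extended-real-valued function: its epigraph is convex. -/
def IsConvexFun (h : E → EReal) : Prop :=
  Convex ℝ {p : E × ℝ | h p.1 ≤ (p.2 : EReal)}

/-- Continuity of the set-valued map `S` at `x` relative to `M` in the sense of Painlevé and
Kuratowski: outer and inner semicontinuity. -/
def ContinuousAtRel (S : E → Set E) (M : Set E) (x : E) : Prop :=
  (∀ v, (∀ ε > 0, ∃ᶠ y in 𝓝[M] x, ∃ v' ∈ S y, ‖v' - v‖ < ε) → v ∈ S x) ∧
    (∀ v ∈ S x, ∀ ε > 0, ∀ᶠ y in 𝓝[M] x, ∃ v' ∈ S y, ‖v' - v‖ < ε)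

/-- `h` is partly smooth at the point `x` of `M` relative to `M`. -/
structure PartlySmoothAt [FiniteDimensional ℝ E] (h : E → EReal) (M : Set E) (x : E) : Prop where
  regular : IsRegularAt h x
  nonempty : (subdiff h x).Nonempty
  manifold : IsC2Submanifold M
  smooth : ∃ e : E → ℝ, IsSmoothExtension M h x e
  sharp : normalSpace M x = vectorSpan ℝ (subdiff h x)
  continuous : ContinuousAtRel (subdiff h) M x

/-- `h` is proper, lower semicontinuous and partly smooth relative to `M`. -/
structure PartlySmooth [FiniteDimensional ℝ E] (h : E → EReal) (M : Set E) : Prop where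
  ne_bot : ∀ x, h x ≠ ⊥
  exists_ne_top : ∃ x, h x ≠ ⊤
  lsc : LowerSemicontinuous h
  at_point : ∀ x ∈ M, PartlySmoothAt h M x

/-- `q` is a nearest point to `p` in `C`. -/
def IsNearestPoint (C : Set E) (p q : E) : Prop := q ∈ C ∧ ∀ c ∈ C, ‖p - q‖ ≤ ‖p - c‖

open Classical in
/-- Projection of `p` onto the set `C` (used for nonempty closed convex sets). -/
def projOnto (C : Set E) (p : E) : E :=
  if h : ∃ q, IsNearestPoint C p q then h.choose else 0

end Variational

/-! ### The parametric composite problem `min_x F(x, u)`, `F = f + g` -/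

section Problem

variable {V P : Type*}
  [NormedAddCommGroup V] [InnerProductSpace ℝ V] [FiniteDimensional ℝ V]
  [NormedAddCommGroup P] [InnerProductSpace ℝ P] [FiniteDimensional ℝ P]

/-- `F(·, u) = f(·, u) + g(·, u)`. -/
def objective (f : V → P → ℝ) (g : V → P → EReal) (u : P) : V → EReal :=
  fun x => (f x u : EReal) + g x u

/-- `∇_x f(x, u)`. -/
def gradX (f : V → P → ℝ) (x : V) (u : P) : V := gradient (fun y => f y u) x

/-- `∇_x² f(x, u)`. -/
def hessX (f : V → P → ℝ) (x : V) (u : P) : V →L[ℝ] V := fderiv ℝ (fun y => gradX f y u) x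

/-- `∇_{xu} f(x, u) = D_u ∇_x f(x, u)`. -/
def gradXU (f : V → P → ℝ) (x : V) (u : P) : P →L[ℝ] V := fderiv ℝ (fun u' => gradX f x u') u

/-- Convex partly smooth objective: `f` is `C²`, `g` is partly smooth relative to `M × Ω` as a
function on the Euclidean space `V × P`, and for `u ∈ Ω` both are convex in `x` and `f(·, u)` has an
`L`-Lipschitz gradient. -/
structure ConvexPartlySmoothObjective (f : V → P → ℝ) (g : V → P → EReal) (M : Set V) (Ω : Set P)
    (L : ℝ≥0) : Prop where
  f_smooth : ContDiff ℝ 2 (fun z : V × P => f z.1 z.2)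
  g_partlySmooth : PartlySmooth (fun z : WithLp 2 (V × P) => g z.fst z.snd)
    {z : WithLp 2 (V × P) | z.fst ∈ M ∧ z.snd ∈ Ω}
  f_convex : ∀ u ∈ Ω, ConvexOn ℝ univ (fun x => f x u)
  g_convex : ∀ u ∈ Ω, IsConvexFun (fun x => g x u)
  f_lipschitz : ∀ u ∈ Ω, LipschitzWith L (fun x => gradX f x u)

/-- Restrictive positive definiteness at `(x, u)`. -/
structure RestrictivePosDef (f : V → P → ℝ) (g : V → P → EReal) (M : Set V) (x : V) (u : P) :
    Prop where
  hess_F : PosDefOn (riemHess M (objective f g u) x) (tangentSpace M x)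
  hess_f_or_g : PosDefOn (tanProj M x ∘L hessX f x u) (tangentSpace M x) ∨
    PosDefOn (riemHess M (fun y => g y u) x) (tangentSpace M x)

/-- Non-degeneracy at `(x, u)`: `0 ∈ ri ∂_x F(x, u)`. -/
def NonDegenerate (f : V → P → ℝ) (g : V → P → EReal) (x : V) (u : P) : Prop :=
  (0 : V) ∈ intrinsicInterior ℝ (convexSubdiff (objective f g u) x)

/-- `x` minimizes `α g(·, u) + ‖· - w‖² / 2`. -/
def IsProxPoint (α : ℝ) (g : V → P → EReal) (w : V) (u : P) (x : V) : Prop :=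
  ∀ y, (α : EReal) * g x u + ((‖x - w‖ ^ 2 / 2 : ℝ) : EReal) ≤
    (α : EReal) * g y u + ((‖y - w‖ ^ 2 / 2 : ℝ) : EReal)

open Classical in
/-- The proximal map `P_α(w, u) = argmin_x α g(x, u) + ‖x - w‖² / 2`. -/
def prox (α : ℝ) (g : V → P → EReal) (w : V) (u : P) : V :=
  if h : ∃ x, IsProxPoint α g w u x then h.choose else 0

/-- The proximal gradient step `A_α(x, u) = P_α(x - α ∇_x f(x, u), u)`. -/
def pgdStep (α : ℝ) (f : V → P → ℝ) (g : V → P → EReal) (x : V) (u : P) : V :=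
  prox α g (x - α • gradX f x u) u

/-- `D_x P_α(w, u)`, the derivative in the first argument. -/
def proxDX (α : ℝ) (g : V → P → EReal) (w : V) (u : P) : V →L[ℝ] V :=
  fderiv ℝ (fun w' => prox α g w' u) w

/-- `D_u P_α(w, u)`, the derivative in the second argument. -/
def proxDU (α : ℝ) (g : V → P → EReal) (w : V) (u : P) : P →L[ℝ] V :=
  fderiv ℝ (fun u' => prox α g w u') u

/-- `ν = proj_{∂_x g(x, u)} (-∇_x f(x, u))`. -/
def nu (f : V → P → ℝ) (g : V → P → EReal) (x : V) (u : P) : V :=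
  projOnto (convexSubdiff (fun y => g y u) x) (-gradX f x u)

/-- `w = x + α ν`. -/
def wPoint (α : ℝ) (f : V → P → ℝ) (g : V → P → EReal) (x : V) (u : P) : V :=
  x + α • nu f g x u

/-- `φ(x, u) = -(∇_M² F(x, u) - 𝔚(·, α Π^⊥(x) (ν + ∇_x f(x, u))))^† D_u ∇_M F(x, u)`. -/
def phi (α : ℝ) (f : V → P → ℝ) (g : V → P → EReal) (M : Set V) (x : V) (u : P) : P →L[ℝ] V :=
  -(pinv (riemHess M (objective f g u) x
        - weingarten M x (α • norProj M x (nu f g x u + gradX f x u)))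
      ∘L fderiv ℝ (fun u' => riemGrad M (objective f g u') x) u)

/-- The linear system for `X` given by implicit differentiation of `x = A_α(x, u)`, with `x`
replaced by an approximate fixed point and the prox differentiated at `(w, u)`, `w = x + α ν`. -/
def SolvesImplicitDiff (α : ℝ) (f : V → P → ℝ) (g : V → P → EReal) (x : V) (u : P)
    (X : P →L[ℝ] V) : Prop :=
  X = proxDX α g (wPoint α f g x u) u ∘L
        ((ContinuousLinearMap.id ℝ V - α • hessX f x u) ∘L X - α • gradXU f x u)
      + proxDU α g (wPoint α f g x u) u

/-- Forward-mode fixed-point automatic differentiation of the accelerated proximal gradient method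
with inertia `β` (of proximal gradient descent if `β = 0`) at the approximate fixed point `x`, in the
direction `ud`: the pair `(x̂_k, x̂_{k-1})`, started from `x̂_0 = x̂_{-1} = 0`. -/
def fpad (α β : ℝ) (f : V → P → ℝ) (g : V → P → EReal) (x : V) (u ud : P) : ℕ → V × V
  | 0 => (0, 0)
  | k + 1 =>
    let z := fpad α β f g x u ud k
    let y := (1 + β) • z.1 - β • z.2
    let wd := y - α • hessX f x u y - α • gradXU f x u ud
    (fderiv ℝ (fun q : V × P => prox α g q.1 q.2) (wPoint α f g x u, u) (wd, ud), z.1)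

end Problem

end FixedPointAD

end

open FixedPointAD

set_option linter.unusedSectionVars false

/-! Near `(x*, u)` the proximal map is a smooth solution map on `M`, and its derivative is governed
by one symmetric form on the tangent space. Let `e` be a joint `C²` extension of `g` from `M × Ω`.
At `x ∈ M` let `ν` have the tangential part of `∇_x e` and the normal part of `-∇_x f`. All partial
subgradients of `g` at `x` have the same tangential part, so once `ν` is a subgradient it is the
projection of `-∇_x f`. Then `ν + ∇_x f` is tangent, the curvature correction in `φ` vanishes, and
`φ` solves a linear system with operator `∇²_M F`.

The variational difficulty is that partial smoothness is a joint property in `(x, u)`, while the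
prox sees only `∂_x g`. Regularity and convexity in `x` turn joint subgradients into partial ones.
Conversely, a penalty argument lifts partial subgradients to joint ones; unbounded parameter
components would produce a singular normal `(0, σ, 0)`, which sharpness forbids because `(0, σ)` is
tangent to `M × Ω`. Hence `∂_x g` is inner semicontinuous along `M × Ω` and its affine hull contains
all normal directions. Relative interiority at `x*` then gives, by separation, that every vector
near `-∇_x f(x*, u)` with the correct tangential part is a subgradient at nearby points
(`eventually_mem_convexSubdiff`).

So near `(x + αν, u)` the prox point is found by solving its stationarity condition on `M` alone,
through a flattening chart and the implicit function theorem (`exists_hasFDerivAt_prox`). The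
linearization is invertible since it is the identity plus `α` times `R = ∇²_M F - ∇²_x f`, and `R`
is nonnegative on the tangent space by the second order necessary condition for `g - ⟨ν, ·⟩` on `M`.
In the implicit differentiation equation the identity and `α ∇²_x f` cancel, and `α ∇²_M F` remains;
its positivity gives the unique solution `φ` (`eq_phi_iff`).

For the iteration, let `B` be the linearized step on the tangent space. It is self-adjoint for `q(v,
w) = ⟨v + αRv, w⟩`, and `q(v, v) - q(Bv, v) = α⟨∇²_M F v, v⟩ > 0`, so its eigenvalues are below `1`.
The lower bound `-1/(1+2β)`, assumed at `x*`, is equivalent to positivity of a form which persists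
along `M`. In an eigenbasis the error obeys scalar two-term recursions, stable for eigenvalues in
exactly this range. -/

namespace FixedPointAD

/-! ### Charts flattening a submanifold -/

section Chart

variable {V : Type*} [NormedAddCommGroup V] [InnerProductSpace ℝ V] [FiniteDimensional ℝ V]

/-- A `C²` diffeomorphism between open sets that maps `M` into the linear subspace `T`. -/
structure FlatChart (M : Set V) (c : OpenPartialHomeomorph V V) (T : Submodule ℝ V) : Prop where
  smooth : ∀ y ∈ c.source, ContDiffAt ℝ 2 c y
  smooth_symm : ∀ a ∈ c.target, ContDiffAt ℝ 2 c.symm a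
  mem_iff : ∀ y ∈ c.source, y ∈ M ↔ c y ∈ T

/-- With `A = DΦ(x)`, `T = ker A` and a right inverse `C` of `A` with values in `Tᗮ`, the map `Ψ(y)
= Π_T(y - x) + C Φ(y)` has derivative `Π_T + CA = 1` at `x`, and lies in `T` exactly where `Φ = 0`.
The identity derivative makes `T` the tangent space itself at the base point. -/
theorem exists_flatChart {M : Set V} (hM : IsC2Submanifold M) {x : V} (hxM : x ∈ M) :
    ∃ (c : OpenPartialHomeomorph V V) (T : Submodule ℝ V), FlatChart M c T ∧ x ∈ c.source ∧
      c x = 0 ∧ fderiv ℝ c.symm 0 = ContinuousLinearMap.id ℝ V := by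
  obtain ⟨m, -, hm⟩ := hM
  obtain ⟨X, Φ, hX, hxX, hΦ, hsurj, hXM⟩ := hm x hxM
  set A := fderiv ℝ Φ x with hA
  let T : Submodule ℝ V := A.toLinearMap.ker
  obtain ⟨C₀, hC₀⟩ := A.toLinearMap.exists_rightInverse_of_surjective
    (LinearMap.range_eq_top.2 hsurj)
  have hAC₀ : ∀ z, A (C₀ z) = z := fun z => LinearMap.congr_fun hC₀ z
  let Q : V →L[ℝ] V := Tᗮ.starProjection
  have hAT : ∀ z ∈ T, A z = 0 := fun z hz => hz
  have hQ : ∀ z, Q z = z - T.starProjection z := fun z => by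
    simp [Q, Submodule.starProjection_orthogonal']
  have hAQ : ∀ z, A (Q z) = A z := fun z => by
    rw [hQ, map_sub, hAT _ (Submodule.starProjection_apply_mem T z), sub_zero]
  let C : EuclideanSpace ℝ (Fin (Module.finrank ℝ V - m)) →L[ℝ] V :=
    Q ∘L LinearMap.toContinuousLinearMap C₀
  have hC : ∀ z, C z = Q (C₀ z) := fun z => rfl
  have hAC : ∀ z, A (C z) = z := fun z => by rw [hC, hAQ, hAC₀]
  have hCA : ∀ v, C (A v) = v - T.starProjection v := fun v => by
    have : C₀ (A v) - v ∈ T := by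
      change A (C₀ (A v) - v) = 0
      rw [map_sub, hAC₀, sub_self]
    have h2 : Q (C₀ (A v) - v) = 0 := by
      rw [hQ, Submodule.starProjection_eq_self_iff.2 this, sub_self]
    rw [hC, ← hQ, ← sub_eq_zero, ← map_sub, h2]
  have hCmem : ∀ z, C z ∈ Tᗮ := fun z => Submodule.starProjection_apply_mem _ _
  let Ψ : V → V := fun y => T.starProjection (y - x) + C (Φ y)
  have hΨsm : ∀ y ∈ X, ContDiffAt ℝ 2 Ψ y := fun y hy => by
    have h1 : ContDiffAt ℝ 2 Φ y := hΦ.contDiffAt (hX.mem_nhds hy)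
    exact (T.starProjection.contDiff.contDiffAt.comp y (contDiffAt_id.sub contDiffAt_const)).add
      (C.contDiff.contDiffAt.comp y h1)
  have hΨ' : HasFDerivAt Ψ (ContinuousLinearMap.id ℝ V) x := by
    have h1 : HasFDerivAt Φ A x :=
      ((hΦ.contDiffAt (hX.mem_nhds hxX)).differentiableAt (by norm_num)).hasFDerivAt
    have h2 : HasFDerivAt Ψ (T.starProjection ∘L ContinuousLinearMap.id ℝ V + C ∘L A) x :=
      (T.starProjection.hasFDerivAt.comp x ((hasFDerivAt_id x).sub_const x)).add
        (C.hasFDerivAt.comp x h1)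
    convert h2 using 1
    ext v
    simp [hCA]
  have hΨ'' : HasFDerivAt Ψ ((ContinuousLinearEquiv.refl ℝ V : V ≃L[ℝ] V) : V →L[ℝ] V) x := hΨ'
  have hmemT : ∀ y ∈ X, (y ∈ M ↔ Ψ y ∈ T) := fun y hy => by
    have h1 : y ∈ M ↔ Φ y = 0 := by
      have := Set.ext_iff.1 hXM y
      simpa [hy] using this
    rw [h1]
    have h2 : Ψ y ∈ T ↔ C (Φ y) ∈ T :=
      Submodule.add_mem_iff_right _ (Submodule.starProjection_apply_mem T _)
    rw [h2]
    refine ⟨fun h => by simp [h], fun h => ?_⟩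
    have h3 : C (Φ y) = 0 := by
      have := Submodule.inner_right_of_mem_orthogonal h (hCmem (Φ y))
      exact inner_self_eq_zero.1 this
    rw [← hAC (Φ y), h3, map_zero]
  let c₀ := (hΨsm x hxX).toOpenPartialHomeomorph Ψ hΨ'' (by norm_num)
  have hc₀ : x ∈ c₀.source :=
    ContDiffAt.mem_toOpenPartialHomeomorph_source (hΨsm x hxX) hΨ'' (by norm_num)
  -- The source is shrunk to where `DΨ` stays invertible, so that the inverse chart is `C²` at every
  -- point of the target and not only at the image of `x`.
  have hev : ∀ᶠ y in 𝓝 x, y ∈ X ∧ fderiv ℝ Ψ y ∈ range ((↑) : (V ≃L[ℝ] V) → V →L[ℝ] V) := by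
    refine Filter.Eventually.and (hX.mem_nhds hxX) ?_
    have h1 : ContinuousAt (fderiv ℝ Ψ) x :=
      ((hΨsm x hxX).fderiv_right (m := 1) (by norm_num)).continuousAt
    refine h1.eventually ?_
    rw [hΨ''.fderiv]
    exact ContinuousLinearEquiv.nhds _
  obtain ⟨U, hU, hUo, hxU⟩ := mem_nhds_iff.1 hev
  let c := c₀.restrOpen U hUo
  have hcΨ : ∀ y, c y = Ψ y := fun y => rfl
  have hsrc : ∀ y, y ∈ c.source ↔ y ∈ c₀.source ∧ y ∈ U := fun y => by
    simp [c]
  have hx : x ∈ c.source := (hsrc x).2 ⟨hc₀, hxU⟩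
  have hcx : c x = 0 := by
    have h0 : Φ x = 0 := by
      have := Set.ext_iff.1 hXM x
      simpa [hxX, hxM] using this
    rw [hcΨ]
    simp [Ψ, h0]
  have hsymm : ∀ a ∈ c.target, ContDiffAt ℝ 2 c.symm a := fun a ha => by
    have hy : c.symm a ∈ c.source := c.map_target ha
    obtain ⟨h1, e, he⟩ := hU ((hsrc _).1 hy).2
    refine c.contDiffAt_symm (f₀' := e) ha ?_ (hΨsm _ h1)
    rw [he]
    exact ((hΨsm _ h1).differentiableAt (by norm_num)).hasFDerivAt
  refine ⟨c, T, ⟨fun y hy => hΨsm y (hU ((hsrc y).1 hy).2).1, hsymm,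
    fun y hy => hmemT y (hU ((hsrc y).1 hy).2).1⟩, hx, hcx, ?_⟩
  have h0 : (0 : V) ∈ c.target := hcx ▸ c.map_source hx
  have hs0 : c.symm 0 = x := by rw [← hcx, c.left_inv hx]
  have h2 : HasFDerivAt c.symm ((ContinuousLinearEquiv.refl ℝ V).symm : V →L[ℝ] V) 0 := by
    refine c.hasFDerivAt_symm h0 ?_
    rw [hs0]
    exact hΨ''
  exact h2.fderiv

namespace FlatChart

variable {M : Set V} {c : OpenPartialHomeomorph V V} {T : Submodule ℝ V}

theorem symm_mem (h : FlatChart M c T) {a : V} (ha : a ∈ c.target) (haT : a ∈ T) :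
    c.symm a ∈ M :=
  (h.mem_iff _ (c.map_target ha)).2 (by rwa [c.right_inv ha])

theorem fderiv_symm_comp (h : FlatChart M c T) {a : V} (ha : a ∈ c.target) (v : V) :
    fderiv ℝ c.symm a (fderiv ℝ c (c.symm a) v) = v := by
  have hy := c.map_target ha
  have h1 := ((h.smooth _ hy).differentiableAt (by norm_num)).hasFDerivAt
  have h2 : HasFDerivAt c.symm (fderiv ℝ c.symm a) (c (c.symm a)) := by
    rw [c.right_inv ha]
    exact ((h.smooth_symm a ha).differentiableAt (by norm_num)).hasFDerivAt
  have h3 := h2.comp _ h1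
  have h4 : (c.symm ∘ c) =ᶠ[𝓝 (c.symm a)] id := c.eventually_left_inverse hy
  have h5 := h3.unique ((hasFDerivAt_id _).congr_of_eventuallyEq h4)
  exact DFunLike.congr_fun h5 v

theorem fderiv_comp_symm (h : FlatChart M c T) {a : V} (ha : a ∈ c.target) (v : V) :
    fderiv ℝ c (c.symm a) (fderiv ℝ c.symm a v) = v := by
  have hy := c.map_target ha
  have h1 := ((h.smooth _ hy).differentiableAt (by norm_num)).hasFDerivAt
  have h2 := ((h.smooth_symm a ha).differentiableAt (by norm_num)).hasFDerivAt
  have h3 := h1.comp a h2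
  have h4 : (c ∘ c.symm) =ᶠ[𝓝 a] id := c.eventually_right_inverse ha
  have h5 := h3.unique ((hasFDerivAt_id _).congr_of_eventuallyEq h4)
  exact DFunLike.congr_fun h5 v

theorem isTangentVector_symm (h : FlatChart M c T) {a : V} (ha : a ∈ c.target) (haT : a ∈ T)
    {v : V} (hv : v ∈ T) : IsTangentVector M (c.symm a) (fderiv ℝ c.symm a v) := by
  have hl : Continuous (fun t : ℝ => a + t • v) := by fun_prop
  have hev : ∀ᶠ t in 𝓝 (0 : ℝ), a + t • v ∈ c.target := by
    refine hl.continuousAt.eventually ?_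
    simpa using c.open_target.mem_nhds ha
  obtain ⟨ε, hε, hball⟩ := Metric.eventually_nhds_iff.1 hev
  have hmem : ∀ t ∈ Ioo (-ε) ε, a + t • v ∈ c.target := fun t ht =>
    hball (by rw [Real.dist_eq, sub_zero]; exact abs_lt.2 ht)
  refine ⟨ε, fun t => c.symm (a + t • v), hε, fun t ht => ?_, fun t ht => ?_, by simp, ?_⟩
  · have h1 : ContDiffAt ℝ 1 c.symm (a + t • v) := (h.smooth_symm _ (hmem t ht)).of_le (by norm_num)
    have h2 : ContDiffAt ℝ 1 (fun t : ℝ => a + t • v) t := by fun_prop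
    exact (h1.comp t h2).contDiffWithinAt
  · exact h.symm_mem (hmem t ht) (T.add_mem haT (T.smul_mem _ hv))
  · have h1 := ((h.smooth_symm a ha).differentiableAt (by norm_num)).hasFDerivAt
    have h2 : HasDerivAt (fun t : ℝ => a + t • v) v 0 := by
      simpa using ((hasDerivAt_id (0 : ℝ)).smul_const v).const_add a
    have h3 : HasFDerivAt c.symm (fderiv ℝ c.symm a) (a + (0 : ℝ) • v) := by simpa using h1
    exact h3.comp_hasDerivAt 0 h2

/-- A curve in `M` read in the chart stays in `T`, so its velocity is annihilated by the projection
onto `Tᗮ`. Conversely, lines in `T` map to curves in `M`. -/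
theorem tangentSpace_eq (h : FlatChart M c T) {a : V} (ha : a ∈ c.target) (haT : a ∈ T) :
    tangentSpace M (c.symm a) = T.map (fderiv ℝ c.symm a).toLinearMap := by
  apply le_antisymm
  · refine Submodule.span_le.2 ?_
    rintro v ⟨ε, γ, hε, -, hγM, hγ0, hγ'⟩
    have hy := c.map_target ha
    refine ⟨fderiv ℝ c (c.symm a) v, ?_, h.fderiv_symm_comp ha v⟩
    have h1 := ((h.smooth _ hy).differentiableAt (by norm_num)).hasFDerivAt
    rw [← hγ0] at h1
    have h2 := h1.comp_hasDerivAt 0 hγ'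
    rw [hγ0] at h2
    have hev : ∀ᶠ t in 𝓝 (0 : ℝ), (c ∘ γ) t ∈ T := by
      have h3 : ∀ᶠ t in 𝓝 (0 : ℝ), γ t ∈ c.source :=
        hγ'.continuousAt.eventually (by rw [hγ0]; exact c.open_source.mem_nhds hy)
      filter_upwards [h3, Ioo_mem_nhds (neg_lt_zero.2 hε) hε] with t ht1 ht2
      exact (h.mem_iff _ ht1).1 (hγM t ht2)
    have h4 : HasDerivAt (fun t => Tᗮ.starProjection ((c ∘ γ) t))
        (Tᗮ.starProjection (fderiv ℝ c (c.symm a) v)) 0 :=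
      (Tᗮ.starProjection.hasFDerivAt).comp_hasDerivAt 0 h2
    have h5 : (fun t => Tᗮ.starProjection ((c ∘ γ) t)) =ᶠ[𝓝 0] fun _ => (0 : V) := by
      filter_upwards [hev] with t ht
      rw [Submodule.starProjection_orthogonal']
      simpa [sub_eq_zero] using (Submodule.starProjection_eq_self_iff.2 ht).symm
    have h6 := h4.unique ((hasDerivAt_const (0 : ℝ) (0 : V)).congr_of_eventuallyEq h5)
    rw [Submodule.starProjection_orthogonal'] at h6
    have h7 : fderiv ℝ c (c.symm a) v = T.starProjection (fderiv ℝ c (c.symm a) v) := by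
      simpa [sub_eq_zero] using h6
    change _ ∈ T
    rw [h7]
    exact Submodule.starProjection_apply_mem _ _
  · rintro _ ⟨v, hv, rfl⟩
    exact Submodule.subset_span (h.isTangentVector_symm ha haT hv)

/-- Points of `M` near a point of the chart domain come from points of `T`. -/
theorem tendsto_symm (h : FlatChart M c T) {a : V} (ha : a ∈ c.target) :
    Tendsto c.symm (𝓝[T] a) (𝓝[M] (c.symm a)) := by
  refine tendsto_nhdsWithin_iff.2
    ⟨((h.smooth_symm a ha).continuousAt).mono_left nhdsWithin_le_nhds, ?_⟩
  filter_upwards [self_mem_nhdsWithin, mem_nhdsWithin_of_mem_nhds (c.open_target.mem_nhds ha)]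
    with b hb hbc
  exact h.symm_mem hbc hb

end FlatChart

end Chart

/-! ### Gradients and Hessians through the Riesz isomorphism -/

section Calculus

variable {V : Type*} [NormedAddCommGroup V] [InnerProductSpace ℝ V] [FiniteDimensional ℝ V]

/-- The Riesz isomorphism as a continuous linear map. -/
noncomputable def riesz (V : Type*) [NormedAddCommGroup V] [InnerProductSpace ℝ V] [FiniteDimensional ℝ V] :
    (V →L[ℝ] ℝ) →L[ℝ] V :=
  LinearMap.toContinuousLinearMap
    { toFun := (InnerProductSpace.toDual ℝ V).symm
      map_add' := map_add _
      map_smul' := fun r l => by simp }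

theorem inner_riesz (l : V →L[ℝ] ℝ) (v : V) : ⟪riesz V l, v⟫ = l v :=
  InnerProductSpace.toDual_symm_apply

theorem gradient_eq_riesz (h : V → ℝ) (x : V) : gradient h x = riesz V (fderiv ℝ h x) := rfl

theorem inner_gradient (h : V → ℝ) (x v : V) : ⟪gradient h x, v⟫ = fderiv ℝ h x v :=
  inner_riesz _ _

theorem inner_fderiv_gradient {h : V → ℝ} {x : V} (hh : ContDiffAt ℝ 2 h x) (v w : V) :
    ⟪fderiv ℝ (gradient h) x v, w⟫ = fderiv ℝ (fderiv ℝ h) x v w := by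
  have h1 : DifferentiableAt ℝ (fderiv ℝ h) x :=
    (hh.fderiv_right (m := 1) (by norm_num)).differentiableAt (by norm_num)
  have h2 : HasFDerivAt (gradient h) (riesz V ∘L fderiv ℝ (fderiv ℝ h) x) x :=
    (riesz V).hasFDerivAt.comp x h1.hasFDerivAt
  rw [h2.fderiv]
  exact inner_riesz _ _

theorem inner_fderiv_gradient_comm {h : V → ℝ} {x : V} (hh : ContDiffAt ℝ 2 h x) (v w : V) :
    ⟪fderiv ℝ (gradient h) x v, w⟫ = ⟪fderiv ℝ (gradient h) x w, v⟫ := by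
  rw [inner_fderiv_gradient hh, inner_fderiv_gradient hh]
  exact (hh.isSymmSndFDerivAt (by simp)).eq v w

end Calculus

/-! ### Riemannian gradient, Weingarten map and Hessian -/

section Riemannian

variable {V : Type*} [NormedAddCommGroup V] [InnerProductSpace ℝ V] [FiniteDimensional ℝ V]
  {M : Set V}

theorem tanProj_mem (M : Set V) (x v : V) : tanProj M x v ∈ tangentSpace M x :=
  Submodule.starProjection_apply_mem _ _

theorem norProj_mem (M : Set V) (x v : V) : norProj M x v ∈ normalSpace M x :=
  Submodule.starProjection_apply_mem _ _

theorem tanProj_eq_self {x v : V} (hv : v ∈ tangentSpace M x) : tanProj M x v = v :=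
  Submodule.starProjection_eq_self_iff.2 hv

theorem norProj_eq_self {x v : V} (hv : v ∈ normalSpace M x) : norProj M x v = v :=
  Submodule.starProjection_eq_self_iff.2 hv

theorem norProj_apply (M : Set V) (x v : V) : norProj M x v = v - tanProj M x v := by
  simp [norProj, normalSpace, tanProj, Submodule.starProjection_orthogonal']

theorem inner_tanProj_left (M : Set V) (x v w : V) :
    ⟪tanProj M x v, w⟫ = ⟪v, tanProj M x w⟫ :=
  Submodule.inner_starProjection_left_eq_right _ _ _

theorem inner_tanProj_of_mem {x w : V} (v : V) (hw : w ∈ tangentSpace M x) :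
    ⟪tanProj M x v, w⟫ = ⟪v, w⟫ := by
  rw [inner_tanProj_left, tanProj_eq_self hw]

theorem inner_eq_zero_of_mem_normalSpace {x n v : V} (hn : n ∈ normalSpace M x)
    (hv : v ∈ tangentSpace M x) : ⟪n, v⟫ = 0 :=
  Submodule.inner_left_of_mem_orthogonal hv hn

theorem mem_normalSpace_iff {x n : V} :
    n ∈ normalSpace M x ↔ ∀ v ∈ tangentSpace M x, ⟪n, v⟫ = 0 :=
  Submodule.mem_orthogonal' _ _

theorem mem_normalSpace_iff_tanProj {x n : V} : n ∈ normalSpace M x ↔ tanProj M x n = 0 := by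
  constructor
  · intro h
    have := norProj_apply M x n
    rw [norProj_eq_self h] at this
    exact sub_eq_self.1 this.symm
  · intro h
    have := norProj_mem M x n
    rwa [norProj_apply, h, sub_zero] at this

theorem mem_normalSpace_of_isTangentVector {x n : V} (h : ∀ v, IsTangentVector M x v → ⟪n, v⟫ = 0) :
    n ∈ normalSpace M x := by
  refine mem_normalSpace_iff.2 fun v hv => ?_
  induction hv using Submodule.span_induction with
  | mem v hv => exact h v hv
  | zero => simp
  | add v w _ _ hv hw => rw [inner_add_right, hv, hw, add_zero]
  | smul r v _ hv => rw [inner_smul_right, hv, mul_zero]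

/-- Fermat's rule along every curve in `M`. It also serves for functions constant on `M` and for `e
- ⟨v, ·⟩` with a subgradient `v`. -/
theorem gradient_mem_normalSpace {d : V → ℝ} {x : V} (hd : DifferentiableAt ℝ d x)
    (hmin : ∀ᶠ y in 𝓝[M] x, d x ≤ d y) : gradient d x ∈ normalSpace M x := by
  refine mem_normalSpace_of_isTangentVector ?_
  rintro v ⟨ε, γ, hε, -, hγM, rfl, hγ'⟩
  rw [inner_gradient]
  have h1 : HasDerivAt (d ∘ γ) (fderiv ℝ d (γ 0) v) 0 := hd.hasFDerivAt.comp_hasDerivAt 0 hγ'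
  refine IsLocalMin.hasDerivAt_eq_zero ?_ h1
  have h2 : Tendsto γ (𝓝 0) (𝓝[M] (γ 0)) := by
    refine tendsto_nhdsWithin_iff.2 ⟨hγ'.continuousAt, ?_⟩
    filter_upwards [Ioo_mem_nhds (neg_lt_zero.2 hε) hε] with t ht using hγM t ht
  exact h2.eventually hmin

theorem gradient_sub_eq {e₁ e₂ : V → ℝ} {x : V} (h₁ : DifferentiableAt ℝ e₁ x)
    (h₂ : DifferentiableAt ℝ e₂ x) :
    gradient (fun y => e₁ y - e₂ y) x = gradient e₁ x - gradient e₂ x := by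
  rw [gradient_eq_riesz, fderiv_fun_sub h₁ h₂, map_sub]
  rfl

/-- Two extensions differ by a function vanishing on `M` near `x`, whose gradient is therefore
normal. -/
theorem riemGrad_eq {h : V → EReal} {x : V} (hx : x ∈ M) {e : V → ℝ}
    (he : IsSmoothExtension M h x e) : riemGrad M h x = tanProj M x (gradient e x) := by
  have H : ∃ e : V → ℝ, IsSmoothExtension M h x e := ⟨e, he⟩
  rw [riemGrad, dif_pos H, ← sub_eq_zero, ← map_sub,
    ← gradient_sub_eq (H.choose_spec.1.differentiableAt (by norm_num))
      (he.1.differentiableAt (by norm_num))]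
  refine mem_normalSpace_iff_tanProj.1 (gradient_mem_normalSpace
    ((H.choose_spec.1.differentiableAt (by norm_num)).sub
      (he.1.differentiableAt (by norm_num))) ?_)
  have hev : ∀ᶠ y in 𝓝[M] x, H.choose y - e y = 0 := by
    filter_upwards [H.choose_spec.2, he.2] with y h1 h2
    rw [sub_eq_zero]
    exact EReal.coe_eq_coe_iff.1 (h1.symm.trans h2)
  have h0 := hev.self_of_nhdsWithin hx
  filter_upwards [hev] with y hy
  rw [hy, h0]

namespace FlatChart

variable {c : OpenPartialHomeomorph V V} {T : Submodule ℝ V}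

theorem hasFDerivAt_symm (h : FlatChart M c T) {a : V} (ha : a ∈ c.target) :
    HasFDerivAt c.symm (fderiv ℝ c.symm a) a :=
  ((h.smooth_symm a ha).differentiableAt (by norm_num)).hasFDerivAt

theorem contDiffAt_fderiv_symm (h : FlatChart M c T) {a : V} (ha : a ∈ c.target) :
    ContDiffAt ℝ 1 (fderiv ℝ c.symm) a :=
  (h.smooth_symm a ha).fderiv_right (m := 1) (by norm_num)

theorem hasFDerivAt_fderiv_symm (h : FlatChart M c T) {a : V} (ha : a ∈ c.target) :
    HasFDerivAt (fderiv ℝ c.symm) (fderiv ℝ (fderiv ℝ c.symm) a) a :=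
  ((h.contDiffAt_fderiv_symm ha).differentiableAt (by norm_num)).hasFDerivAt

theorem fderiv_fderiv_symm_comm (h : FlatChart M c T) {a : V} (ha : a ∈ c.target) (v w : V) :
    fderiv ℝ (fderiv ℝ c.symm) a v w = fderiv ℝ (fderiv ℝ c.symm) a w v :=
  ((h.smooth_symm a ha).isSymmSndFDerivAt (by simp)).eq v w

theorem mem_tangentSpace (h : FlatChart M c T) {a : V} (ha : a ∈ c.target) (haT : a ∈ T)
    {v : V} (hv : v ∈ T) : fderiv ℝ c.symm a v ∈ tangentSpace M (c.symm a) := by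
  rw [h.tangentSpace_eq ha haT]
  exact Submodule.mem_map_of_mem hv

theorem exists_of_mem_tangentSpace (h : FlatChart M c T) {a : V} (ha : a ∈ c.target)
    (haT : a ∈ T) {w : V} (hw : w ∈ tangentSpace M (c.symm a)) :
    ∃ v ∈ T, fderiv ℝ c.symm a v = w := by
  rw [h.tangentSpace_eq ha haT] at hw
  exact hw

/-- Derivative of `t ↦ ω (ψ (a + t v)) (Dψ (a + t v) w)` for a one-form `ω`, `ψ` the chart
inverse. -/
theorem hasDerivAt_form (h : FlatChart M c T) {a : V} (ha : a ∈ c.target)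
    {ω : V → V →L[ℝ] ℝ} (hω : DifferentiableAt ℝ ω (c.symm a)) (v w : V) :
    HasDerivAt (fun t : ℝ => ω (c.symm (a + t • v)) (fderiv ℝ c.symm (a + t • v) w))
      (fderiv ℝ ω (c.symm a) (fderiv ℝ c.symm a v) (fderiv ℝ c.symm a w)
        + ω (c.symm a) (fderiv ℝ (fderiv ℝ c.symm) a v w)) 0 := by
  have h1 : HasFDerivAt (ω ∘ c.symm) (fderiv ℝ ω (c.symm a) ∘L fderiv ℝ c.symm a) a :=
    hω.hasFDerivAt.comp a (h.hasFDerivAt_symm ha)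
  have h2 : HasFDerivAt (fun b => fderiv ℝ c.symm b w)
      ((fderiv ℝ (fderiv ℝ c.symm) a).flip w) a := by
    have := (h.hasFDerivAt_fderiv_symm ha).clm_apply (hasFDerivAt_const w a)
    convert this using 1
    ext; simp
  have h3 := h1.clm_apply h2
  have hl : HasDerivAt (fun t : ℝ => a + t • v) v 0 := by
    simpa using ((hasDerivAt_id (0 : ℝ)).smul_const v).const_add a
  rw [show a = a + (0 : ℝ) • v by simp] at h3
  have h5 := h3.comp_hasDerivAt (0 : ℝ) hl
  rw [zero_smul, add_zero] at h5
  refine HasDerivAt.congr_deriv h5 ?_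
  simp only [add_apply, ContinuousLinearMap.comp_apply,
    ContinuousLinearMap.flip_apply, Function.comp_apply]
  rw [add_comm]

/-- Differentiating the identity `ω y v = 0` for tangent vectors `v` along `M`. -/
theorem fderiv_form (h : FlatChart M c T) {a : V} (ha : a ∈ c.target) (haT : a ∈ T)
    {ω : V → V →L[ℝ] ℝ} (hω : DifferentiableAt ℝ ω (c.symm a))
    (hker : ∀ᶠ y in 𝓝[M] (c.symm a), ∀ v ∈ tangentSpace M y, ω y v = 0)
    {v w : V} (hv : v ∈ T) (hw : w ∈ T) :
    fderiv ℝ ω (c.symm a) (fderiv ℝ c.symm a v) (fderiv ℝ c.symm a w)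
      + ω (c.symm a) (fderiv ℝ (fderiv ℝ c.symm) a v w) = 0 := by
  have h5 := h.hasDerivAt_form ha hω v w
  have h6 : Tendsto (fun t : ℝ => a + t • v) (𝓝 0) (𝓝[T] a) := by
    have hl : Continuous (fun t : ℝ => a + t • v) := by fun_prop
    refine tendsto_nhdsWithin_iff.2 ⟨by simpa using hl.tendsto 0, ?_⟩
    exact Eventually.of_forall fun t => T.add_mem haT (T.smul_mem _ hv)
  have h7 : ∀ᶠ b in 𝓝[T] a, ω (c.symm b) (fderiv ℝ c.symm b w) = 0 := by
    filter_upwards [(h.tendsto_symm ha).eventually hker, self_mem_nhdsWithin,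
      mem_nhdsWithin_of_mem_nhds (c.open_target.mem_nhds ha)] with b hb hbT hbt
    exact hb _ (h.mem_tangentSpace hbt hbT hw)
  exact h5.unique ((hasDerivAt_const (0 : ℝ) (0 : ℝ)).congr_of_eventuallyEq (h6.eventually h7))

/-- The covector `⟨n, ·⟩` is carried along in the chart: `m = Dψ(a)* n` is orthogonal to `T`, and
`W(y) = Dc(y)* m` is normal because `Dc(y)` maps tangent vectors of `M` into `T`. -/
theorem exists_isNormalField (h : FlatChart M c T) {a : V} (ha : a ∈ c.target) (haT : a ∈ T)
    {n : V} (hn : n ∈ normalSpace M (c.symm a)) : ∃ W : V → V, IsNormalField M (c.symm a) n W := by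
  have hy := c.map_target ha
  let m : V := riesz V (innerSL ℝ n ∘L fderiv ℝ c.symm a)
  have hm : ∀ v, ⟪m, v⟫ = ⟪n, fderiv ℝ c.symm a v⟫ := fun v => inner_riesz _ _
  let W : V → V := fun y => riesz V (innerSL ℝ m ∘L fderiv ℝ c y)
  have hW : ∀ y v, ⟪W y, v⟫ = ⟪m, fderiv ℝ c y v⟫ := fun y v => inner_riesz _ _
  refine ⟨W, ?_, ?_, ?_⟩
  · have h1 : ContDiffAt ℝ 1 (fderiv ℝ c) (c.symm a) :=
      (h.smooth _ hy).fderiv_right (m := 1) (by norm_num)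
    exact (riesz V).contDiff.contDiffAt.comp _ (contDiffAt_const.clm_comp h1)
  · refine ext_inner_right ℝ fun v => ?_
    rw [hW, hm, h.fderiv_symm_comp ha]
  · filter_upwards [self_mem_nhdsWithin, mem_nhdsWithin_of_mem_nhds (c.open_source.mem_nhds hy)]
      with y hyM hyc
    refine mem_normalSpace_iff.2 fun v hv => ?_
    have hb := c.map_source hyc
    have hbT := (h.mem_iff y hyc).1 hyM
    rw [← c.left_inv hyc] at hv
    obtain ⟨t, ht, rfl⟩ := h.exists_of_mem_tangentSpace hb hbT hv
    have h2 := h.fderiv_comp_symm hb t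
    rw [c.left_inv hyc] at h2
    rw [hW, h2, hm]
    exact inner_eq_zero_of_mem_normalSpace hn (h.mem_tangentSpace ha haT ht)

/-- The Weingarten map in coordinates. -/
theorem inner_weingarten (h : FlatChart M c T) {a : V} (ha : a ∈ c.target) (haT : a ∈ T)
    {n : V} (hn : n ∈ normalSpace M (c.symm a)) {v w : V} (hv : v ∈ T) (hw : w ∈ T) :
    ⟪weingarten M (c.symm a) n (fderiv ℝ c.symm a v), fderiv ℝ c.symm a w⟫ =
      ⟪n, fderiv ℝ (fderiv ℝ c.symm) a v w⟫ := by
  have H := h.exists_isNormalField ha haT hn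
  obtain ⟨hW1, hW2, hW3⟩ := H.choose_spec
  rw [weingarten, dif_pos H]
  set W := H.choose
  have hWd : DifferentiableAt ℝ W (c.symm a) := hW1.differentiableAt (by norm_num)
  -- The one-form `⟨W(y), ·⟩` annihilates tangent vectors along `M`. Differentiating this identity
  -- leaves only the value `n` of `W` at the point, so the result does not depend on the chosen
  -- field.
  have hω : HasFDerivAt (fun y => innerSL ℝ (W y)) (innerSL ℝ ∘L fderiv ℝ W (c.symm a))
      (c.symm a) := (innerSL ℝ : V →L[ℝ] V →L[ℝ] ℝ).hasFDerivAt.comp _ hWd.hasFDerivAt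
  have h1 := h.fderiv_form ha haT hω.differentiableAt (by
    filter_upwards [hW3] with y hy v hv
    exact inner_eq_zero_of_mem_normalSpace hy hv) hv hw
  rw [hω.fderiv] at h1
  simp only [ContinuousLinearMap.comp_apply, innerSL_apply_apply, hW2] at h1
  simp only [neg_apply, ContinuousLinearMap.comp_apply, inner_neg_left]
  rw [inner_tanProj_of_mem _ (h.mem_tangentSpace ha haT hw),
    tanProj_eq_self (h.mem_tangentSpace ha haT hv)]
  change ⟪_, _⟫ + _ = 0 at h1
  linarith

end FlatChart

theorem weingarten_mem (M : Set V) (x n v : V) : weingarten M x n v ∈ tangentSpace M x := by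
  rw [weingarten]
  split_ifs
  · exact Submodule.neg_mem _ (tanProj_mem _ _ _)
  · exact Submodule.zero_mem _

theorem tanProj_tanProj (M : Set V) (x v : V) : tanProj M x (tanProj M x v) = tanProj M x v :=
  tanProj_eq_self (tanProj_mem M x v)

theorem weingarten_tanProj (M : Set V) (x n v : V) :
    weingarten M x n (tanProj M x v) = weingarten M x n v := by
  rw [weingarten]
  split_ifs
  · simp [tanProj_tanProj]
  · rfl

theorem riemHess_mem (M : Set V) (h : V → EReal) (x v : V) :
    riemHess M h x v ∈ tangentSpace M x := by
  rw [riemHess]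
  split_ifs
  · exact Submodule.add_mem _ (tanProj_mem _ _ _) (weingarten_mem _ _ _ _)
  · exact Submodule.zero_mem _

theorem riemHess_tanProj (M : Set V) (h : V → EReal) (x v : V) :
    riemHess M h x (tanProj M x v) = riemHess M h x v := by
  rw [riemHess]
  split_ifs
  · simp [tanProj_tanProj, weingarten_tanProj]
  · rfl

theorem eq_of_inner_tangent {x v w : V} (hv : v ∈ tangentSpace M x) (hw : w ∈ tangentSpace M x)
    (h : ∀ t ∈ tangentSpace M x, ⟪v, t⟫ = ⟪w, t⟫) : v = w := by
  rw [← sub_eq_zero, ← inner_self_eq_zero (𝕜 := ℝ), inner_sub_left, sub_eq_zero]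
  exact h _ (Submodule.sub_mem _ hv hw)

/-- A chart around a given point, with the point expressed through the chart. -/
theorem exists_flatChart_at (hM : IsC2Submanifold M) {x : V} (hx : x ∈ M) :
    ∃ (c : OpenPartialHomeomorph V V) (T : Submodule ℝ V), FlatChart M c T ∧ 0 ∈ c.target ∧
      c.symm 0 = x ∧ tangentSpace M x = T ∧ fderiv ℝ c.symm 0 = ContinuousLinearMap.id ℝ V := by
  obtain ⟨c, T, h, hxc, hcx, hid⟩ := exists_flatChart hM hx
  have h0 : (0 : V) ∈ c.target := hcx ▸ c.map_source hxc
  have hs : c.symm 0 = x := by rw [← hcx, c.left_inv hxc]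
  refine ⟨c, T, h, h0, hs, ?_, hid⟩
  rw [← hs, h.tangentSpace_eq h0 T.zero_mem, hid]
  exact Submodule.map_id T

/-- Not immediate from the definition: the chosen normal field vanishes at `x` but possibly not
nearby. The coordinate formula involves only its value. -/
theorem weingarten_zero (hM : IsC2Submanifold M) {x : V} (hx : x ∈ M) : weingarten M x 0 = 0 := by
  obtain ⟨c, T, h, h0, rfl, hT, hid⟩ := exists_flatChart_at hM hx
  ext v
  refine eq_of_inner_tangent (weingarten_mem _ _ _ _) (Submodule.zero_mem _) fun t ht => ?_
  have h1 := h.inner_weingarten h0 T.zero_mem (n := 0) (Submodule.zero_mem _)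
    (v := tanProj M (c.symm 0) v) (w := t) (hT ▸ tanProj_mem _ _ _) (hT ▸ ht)
  rw [hid] at h1
  simpa [weingarten_tanProj] using h1

/-- This is the symmetry of the second derivative of the inverse chart. -/
theorem inner_weingarten_comm (hM : IsC2Submanifold M) {x : V} (hx : x ∈ M) {n : V}
    (hn : n ∈ normalSpace M x) {v w : V} (hv : v ∈ tangentSpace M x) (hw : w ∈ tangentSpace M x) :
    ⟪weingarten M x n v, w⟫ = ⟪weingarten M x n w, v⟫ := by
  obtain ⟨c, T, h, h0, rfl, hT, hid⟩ := exists_flatChart_at hM hx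
  rw [hT] at hv hw
  have h1 := h.inner_weingarten h0 T.zero_mem hn hv hw
  have h2 := h.inner_weingarten h0 T.zero_mem hn hw hv
  rw [h.fderiv_fderiv_symm_comm h0, ← h2, hid] at h1
  exact h1

theorem inner_weingarten_smul (hM : IsC2Submanifold M) {x : V} (hx : x ∈ M) {n : V}
    (hn : n ∈ normalSpace M x) (r : ℝ) {v w : V} (hv : v ∈ tangentSpace M x)
    (hw : w ∈ tangentSpace M x) :
    ⟪weingarten M x (r • n) v, w⟫ = r * ⟪weingarten M x n v, w⟫ := by
  obtain ⟨c, T, h, h0, rfl, hT, hid⟩ := exists_flatChart_at hM hx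
  rw [hT] at hv hw
  have h1 := h.inner_weingarten h0 T.zero_mem hn hv hw
  have h2 := h.inner_weingarten h0 T.zero_mem (Submodule.smul_mem _ r hn) hv hw
  rw [hid] at h1 h2
  simp only [ContinuousLinearMap.id_apply] at h1 h2
  rw [h1, h2, inner_smul_left]
  rfl

/-- The Riemannian Hessian does not depend on the smooth extension. -/
theorem inner_riemHess (hM : IsC2Submanifold M) {h : V → EReal} {x : V} (hx : x ∈ M) {e : V → ℝ}
    (he : IsSmoothExtension M h x e) {v w : V} (hv : v ∈ tangentSpace M x)
    (hw : w ∈ tangentSpace M x) :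
    ⟪riemHess M h x v, w⟫ = ⟪fderiv ℝ (gradient e) x v, w⟫
      + ⟪weingarten M x (norProj M x (gradient e x)) v, w⟫ := by
  have H : ∃ e : V → ℝ, IsSmoothExtension M h x e := ⟨e, he⟩
  rw [riemHess, dif_pos H]
  have hes := H.choose_spec
  set e' := H.choose
  simp only [add_apply, ContinuousLinearMap.comp_apply, inner_add_left]
  rw [inner_tanProj_of_mem _ hw, tanProj_eq_self hv]
  have hd1 : DifferentiableAt ℝ e' x := hes.1.differentiableAt (by norm_num)
  have hd2 : DifferentiableAt ℝ e x := he.1.differentiableAt (by norm_num)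
  let d : V → ℝ := fun y => e' y - e y
  have hd : ContDiffAt ℝ 2 d x := hes.1.sub he.1
  have hdM : ∀ᶠ y in 𝓝[M] x, d y = 0 := by
    filter_upwards [hes.2, he.2] with y h1 h2
    exact sub_eq_zero.2 (EReal.coe_eq_coe_iff.1 (h1.symm.trans h2))
  -- The difference `d` of two extensions is zero on `M`, so its differential kills tangent vectors
  -- along `M`. Differentiating once more gives `D²d(v, w) + ⟨∇d, D²ψ(v, w)⟩ = 0`, which is the
  -- equality of the two Hessian formulas.
  have hnor : ∀ᶠ y in 𝓝[M] x, gradient d y ∈ normalSpace M y := by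
    filter_upwards [eventually_eventually_nhdsWithin.2 hdM, hdM,
      mem_nhdsWithin_of_mem_nhds (hd.eventually (by norm_num))] with y h1 h2 h3
    refine gradient_mem_normalSpace (h3.differentiableAt (by norm_num)) ?_
    filter_upwards [h1] with z hz
    rw [h2, hz]
  have hnx : gradient d x ∈ normalSpace M x := hnor.self_of_nhdsWithin hx
  have hgd : gradient d x = gradient e' x - gradient e x := gradient_sub_eq hd1 hd2
  have hD : fderiv ℝ (fderiv ℝ d) x = fderiv ℝ (fderiv ℝ e') x - fderiv ℝ (fderiv ℝ e) x := by
    have h1 : fderiv ℝ d =ᶠ[𝓝 x] fun y => fderiv ℝ e' y - fderiv ℝ e y := by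
      filter_upwards [hes.1.eventually (by norm_num), he.1.eventually (by norm_num)] with y h1 h2
      exact fderiv_fun_sub (h1.differentiableAt (by norm_num)) (h2.differentiableAt (by norm_num))
    rw [h1.fderiv_eq]
    exact fderiv_fun_sub
      ((hes.1.fderiv_right (m := 1) (by norm_num)).differentiableAt (by norm_num))
      ((he.1.fderiv_right (m := 1) (by norm_num)).differentiableAt (by norm_num))
  obtain ⟨c, T, hc, h0, rfl, hT, hid⟩ := exists_flatChart_at hM hx
  rw [hT] at hv hw
  have key := hc.fderiv_form h0 T.zero_mem (ω := fderiv ℝ d)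
    ((hd.fderiv_right (m := 1) (by norm_num)).differentiableAt (by norm_num)) (by
      filter_upwards [hnor] with y hy v hv
      rw [← inner_gradient]
      exact inner_eq_zero_of_mem_normalSpace hy hv) hv hw
  have hw1 := hc.inner_weingarten h0 T.zero_mem
    (norProj_mem M (c.symm 0) (gradient e' (c.symm 0))) hv hw
  have hw2 := hc.inner_weingarten h0 T.zero_mem
    (norProj_mem M (c.symm 0) (gradient e (c.symm 0))) hv hw
  rw [hid] at key hw1 hw2
  simp only [ContinuousLinearMap.id_apply] at key hw1 hw2
  rw [hw1, hw2, inner_fderiv_gradient hes.1, inner_fderiv_gradient he.1]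
  rw [hD, ← inner_gradient, ← norProj_eq_self hnx, hgd, map_sub, inner_sub_left] at key
  simp only [sub_apply] at key
  linarith

end Riemannian

/-! ### Continuity along the manifold -/

section Continuity

variable {V : Type*} [NormedAddCommGroup V] [InnerProductSpace ℝ V] [FiniteDimensional ℝ V]
  {M : Set V}

theorem tendsto_clm_apply {ι E F : Type*} [NormedAddCommGroup E] [NormedSpace ℝ E]
    [NormedAddCommGroup F] [NormedSpace ℝ F] {l : Filter ι} {A : ι → E →L[ℝ] F} {A₀ : E →L[ℝ] F}
    {v : ι → E} {v₀ : E} (hA : Tendsto A l (𝓝 A₀)) (hv : Tendsto v l (𝓝 v₀)) :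
    Tendsto (fun i => A i (v i)) l (𝓝 (A₀ v₀)) :=
  (isBoundedBilinearMap_apply.continuous.tendsto (A₀, v₀)).comp (hA.prodMk_nhds hv)

/-- The orthogonal projection onto the range of an injective operator. -/
theorem starProjection_range_eq {T : Submodule ℝ V} {J : T →L[ℝ] V} (hJ : Function.Injective J) :
    IsUnit (J.adjoint ∘L J : T →L[ℝ] T) ∧ J.toLinearMap.range.starProjection =
      J ∘L Ring.inverse (J.adjoint ∘L J : T →L[ℝ] T) ∘L J.adjoint := by
  have hu : IsUnit (J.adjoint ∘L J : T →L[ℝ] T) := by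
    rw [ContinuousLinearMap.isUnit_iff_bijective]
    have hinj : Function.Injective (J.adjoint ∘L J : T →L[ℝ] T) := by
      refine (injective_iff_map_eq_zero _).2 fun t ht => ?_
      have h1 : ⟪J t, J t⟫ = 0 := by
        rw [← ContinuousLinearMap.adjoint_inner_left]
        change ⟪(J.adjoint ∘L J : T →L[ℝ] T) t, t⟫ = 0
        rw [ht, inner_zero_left]
      exact hJ (by rw [inner_self_eq_zero.1 h1, map_zero])
    exact ⟨hinj, LinearMap.surjective_of_injective
      (f := (J.adjoint ∘L J : T →L[ℝ] T).toLinearMap) hinj⟩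
  refine ⟨hu, ?_⟩
  ext v
  refine Submodule.eq_starProjection_of_mem_orthogonal (K := J.toLinearMap.range)
    (LinearMap.mem_range_self J.toLinearMap _) ?_
  rw [Submodule.mem_orthogonal]
  rintro _ ⟨t, rfl⟩
  change ⟪J t, _⟫ = 0
  rw [← ContinuousLinearMap.adjoint_inner_right, map_sub]
  have h2 : (J.adjoint ∘L J : T →L[ℝ] T) * Ring.inverse (J.adjoint ∘L J : T →L[ℝ] T) = 1 :=
    Ring.mul_inverse_cancel _ hu
  have h3 := DFunLike.congr_fun h2 (J.adjoint v)
  change J.adjoint (J (Ring.inverse (J.adjoint ∘L J : T →L[ℝ] T) (J.adjoint v))) = J.adjoint v at h3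
  simp [h3]

/-- In a chart the tangent space is the range of an injective operator `J(y)` on the fixed space
`T`, and `J (J*J)⁻¹ J*` depends continuously on `J`. -/
theorem tendsto_tanProj (hM : IsC2Submanifold M) {x : V} (hx : x ∈ M) :
    Tendsto (tanProj M) (𝓝[M] x) (𝓝 (tanProj M x)) := by
  obtain ⟨c, T, h, hxc, -, -⟩ := exists_flatChart hM hx
  let J : V → T →L[ℝ] V := fun y => fderiv ℝ c.symm (c y) ∘L T.subtypeL
  have hJinj : ∀ y ∈ c.source, Function.Injective (J y) := fun y hy s t hst => by
    have h1 := congrArg (fderiv ℝ c (c.symm (c y))) hst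
    have h2 := h.fderiv_comp_symm (c.map_source hy)
    simp only [J, ContinuousLinearMap.comp_apply, h2] at h1
    exact Subtype.ext h1
  have heq : ∀ y ∈ c.source, y ∈ M → tanProj M y =
      J y ∘L Ring.inverse ((J y).adjoint ∘L J y : T →L[ℝ] T) ∘L (J y).adjoint := fun y hy hyM => by
    rw [← (starProjection_range_eq (hJinj y hy)).2]
    have h1 := h.tangentSpace_eq (c.map_source hy) ((h.mem_iff y hy).1 hyM)
    rw [c.left_inv hy] at h1
    rw [tanProj]
    congr 1
    rw [h1]
    ext v
    constructor
    · rintro ⟨t, ht, rfl⟩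
      exact ⟨⟨t, ht⟩, rfl⟩
    · rintro ⟨t, rfl⟩
      exact ⟨t, t.2, rfl⟩
  have hJc : ContinuousAt J x := by
    have h1 : ContinuousAt (fun y => fderiv ℝ c.symm (c y)) x :=
      ContinuousAt.comp (f := c) (h.contDiffAt_fderiv_symm (c.map_source hxc)).continuousAt
        (h.smooth x hxc).continuousAt
    exact h1.clm_comp continuousAt_const
  have hJa : ContinuousAt (fun y => (J y).adjoint) x :=
    (ContinuousLinearMap.adjoint (𝕜 := ℝ)).continuous.continuousAt.comp hJc
  have hG : ContinuousAt (fun y => ((J y).adjoint ∘L J y : T →L[ℝ] T)) x := hJa.clm_comp hJc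
  obtain ⟨U, hU⟩ := (starProjection_range_eq (hJinj x hxc)).1
  have hI : ContinuousAt (fun y => Ring.inverse ((J y).adjoint ∘L J y : T →L[ℝ] T)) x := by
    refine ContinuousAt.comp (g := Ring.inverse) ?_ hG
    rw [← hU]
    exact NormedRing.inverse_continuousAt (R := T →L[ℝ] T) U
  have hfin := hJc.clm_comp (hI.clm_comp hJa)
  rw [heq x hxc hx]
  refine (hfin.tendsto.mono_left nhdsWithin_le_nhds).congr' ?_
  filter_upwards [self_mem_nhdsWithin, mem_nhdsWithin_of_mem_nhds (c.open_source.mem_nhds hxc)]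
    with y hyM hy
  exact (heq y hy hyM).symm

theorem tendsto_norProj (hM : IsC2Submanifold M) {x : V} (hx : x ∈ M) :
    Tendsto (norProj M) (𝓝[M] x) (𝓝 (norProj M x)) := by
  have h : ∀ y, norProj M y = ContinuousLinearMap.id ℝ V - tanProj M y := fun y => by
    ext v
    rw [norProj_apply]
    rfl
  rw [funext h]
  exact tendsto_const_nhds.sub (tendsto_tanProj hM hx)

/-- Positive definiteness on the tangent space of an operator with a curvature term persists
along `M`. -/
theorem eventually_pos_of_pos (hM : IsC2Submanifold M) {x : V} (hx : x ∈ M)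
    {C : V → V →L[ℝ] V} {ξ : V → V} (hC : Tendsto C (𝓝[M] x) (𝓝 (C x)))
    (hξ : Tendsto ξ (𝓝[M] x) (𝓝 (ξ x))) (hξn : ∀ y ∈ M, ξ y ∈ normalSpace M y)
    (hpos : ∀ v ∈ tangentSpace M x, v ≠ 0 → 0 < ⟪C x v, v⟫ + ⟪weingarten M x (ξ x) v, v⟫) :
    ∀ᶠ y in 𝓝[M] x, ∀ v ∈ tangentSpace M y, v ≠ 0 →
      0 < ⟪C y v, v⟫ + ⟪weingarten M y (ξ y) v, v⟫ := by
  obtain ⟨c, T, h, hxc, -, -⟩ := exists_flatChart hM hx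
  -- The form pulled back to the fixed space `T`. The Weingarten term becomes `⟨ξ, D²ψ(v, v)⟩`,
  -- which is jointly continuous, so compactness of the unit sphere of `T` applies.
  let q : V → V → ℝ := fun v y =>
    ⟪C y (fderiv ℝ c.symm (c y) v), fderiv ℝ c.symm (c y) v⟫
      + ⟪ξ y, fderiv ℝ (fderiv ℝ c.symm) (c y) v v⟫
  have hq : ∀ y ∈ c.source, y ∈ M → ∀ v ∈ T, q v y =
      ⟪C y (fderiv ℝ c.symm (c y) v), fderiv ℝ c.symm (c y) v⟫
      + ⟪weingarten M y (ξ y) (fderiv ℝ c.symm (c y) v), fderiv ℝ c.symm (c y) v⟫ := by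
    intro y hy hyM v hv
    have h1 := h.inner_weingarten (c.map_source hy) ((h.mem_iff y hy).1 hyM) (n := ξ y)
      (by rw [c.left_inv hy]; exact hξn y hyM) hv hv
    rw [c.left_inv hy] at h1
    rw [h1]
  have hcc : Tendsto c (𝓝[M] x) (𝓝 (c x)) :=
    (h.smooth x hxc).continuousAt.tendsto.mono_left nhdsWithin_le_nhds
  have hJ : Tendsto (fun y => fderiv ℝ c.symm (c y)) (𝓝[M] x) (𝓝 (fderiv ℝ c.symm (c x))) :=
    (h.contDiffAt_fderiv_symm (c.map_source hxc)).continuousAt.tendsto.comp hcc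
  have hJJ : Tendsto (fun y => fderiv ℝ (fderiv ℝ c.symm) (c y)) (𝓝[M] x)
      (𝓝 (fderiv ℝ (fderiv ℝ c.symm) (c x))) :=
    ((h.contDiffAt_fderiv_symm (c.map_source hxc)).fderiv_right
      (m := 0) (by norm_num)).continuousAt.tendsto.comp hcc
  have hsph : IsCompact (Metric.sphere (0 : V) 1 ∩ (T : Set V)) :=
    (isCompact_sphere _ _).inter_right T.closed_of_finiteDimensional
  have hev : ∀ᶠ y in 𝓝[M] x, ∀ v ∈ Metric.sphere (0 : V) 1 ∩ (T : Set V), 0 < q v y := by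
    suffices hloc : ∀ v ∈ Metric.sphere (0 : V) 1 ∩ (T : Set V),
        ∀ᶠ p : V × V in 𝓝[M] x ×ˢ 𝓝 v, 0 < q p.2 p.1 by
      simp only [← eventually_iSup, ← hsph.prod_nhdsSet_eq_biSup] at hloc
      exact hloc.curry.mono fun _ h => h.self_of_nhdsSet
    rintro v ⟨hv1, hvT⟩
    have hv : Tendsto (fun p : V × V => p.2) (𝓝[M] x ×ˢ 𝓝 v) (𝓝 v) := tendsto_snd
    have hs : Tendsto (fun p : V × V => p.1) (𝓝[M] x ×ˢ 𝓝 v) (𝓝[M] x) := tendsto_fst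
    have hlim : Tendsto (fun p : V × V => q p.2 p.1) (𝓝[M] x ×ˢ 𝓝 v) (𝓝 (q v x)) := by
      have hJv := tendsto_clm_apply (hJ.comp hs) hv
      exact ((tendsto_clm_apply (hC.comp hs) hJv).inner hJv).add
        ((hξ.comp hs).inner (tendsto_clm_apply (tendsto_clm_apply (hJJ.comp hs) hv) hv))
    refine hlim.eventually (lt_mem_nhds ?_)
    rw [hq x hxc hx v hvT]
    have hcx := c.map_source hxc
    have hTx := (h.mem_iff x hxc).1 hx
    refine hpos _ ?_ fun h0 => ?_
    · have := h.mem_tangentSpace hcx hTx hvT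
      rwa [c.left_inv hxc] at this
    · have := h.fderiv_comp_symm hcx v
      rw [h0, map_zero] at this
      rw [← this] at hv1
      simp at hv1
  filter_upwards [hev, self_mem_nhdsWithin,
    mem_nhdsWithin_of_mem_nhds (c.open_source.mem_nhds hxc)] with y hy hyM hyc w hw hw0
  have hw' : w ∈ tangentSpace M (c.symm (c y)) := by rwa [c.left_inv hyc]
  obtain ⟨v, hv, rfl⟩ := h.exists_of_mem_tangentSpace (c.map_source hyc)
    ((h.mem_iff y hyc).1 hyM) hw'
  rw [← hq y hyc hyM v hv]
  have hv0 : v ≠ 0 := fun h0 => hw0 (by rw [h0, map_zero])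
  have hn : 0 < ‖v‖ := norm_pos_iff.2 hv0
  have h1 := hy (‖v‖⁻¹ • v) ⟨by simp [norm_smul, hn.ne'], T.smul_mem _ hv⟩
  have h2 : q (‖v‖⁻¹ • v) y = ‖v‖⁻¹ ^ 2 * q v y := by
    simp only [q, map_smul, smul_apply, inner_smul_left, inner_smul_right,
      conj_trivial]
    ring
  rw [h2] at h1
  exact (mul_pos_iff_of_pos_left (by positivity)).1 h1

end Continuity

/-! ### Subgradients as normals to the epigraph -/

section NormalCones

variable {E : Type*} [NormedAddCommGroup E] [InnerProductSpace ℝ E]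

theorem norm_prodL2_le {A B : Type*} [SeminormedAddCommGroup A] [SeminormedAddCommGroup B]
    (q : WithLp 2 (A × B)) : ‖q‖ ≤ ‖q.fst‖ + ‖q.snd‖ := by
  have h := WithLp.prod_norm_sq_eq_of_L2 q
  nlinarith [norm_nonneg q, norm_nonneg q.fst, norm_nonneg q.snd,
    mul_nonneg (norm_nonneg q.fst) (norm_nonneg q.snd)]

theorem regularNormals_smul {C : Set E} {x v : E} (hv : v ∈ regularNormals C x) {r : ℝ}
    (hr : 0 ≤ r) : r • v ∈ regularNormals C x := by
  refine ⟨hv.1, fun ε hε => ?_⟩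
  rcases hr.eq_or_lt with rfl | hr
  · exact Eventually.of_forall fun y => by simp; positivity
  · filter_upwards [hv.2 (ε / r) (by positivity)] with y hy
    rw [inner_smul_left, conj_trivial]
    calc r * ⟪v, y - x⟫ ≤ r * (ε / r * ‖y - x‖) := by gcongr
      _ = ε * ‖y - x‖ := by field_simp

theorem regularNormals_add {C : Set E} {x v w : E} (hv : v ∈ regularNormals C x)
    (hw : w ∈ regularNormals C x) : v + w ∈ regularNormals C x := by
  refine ⟨hv.1, fun ε hε => ?_⟩
  filter_upwards [hv.2 (ε / 2) (by positivity), hw.2 (ε / 2) (by positivity)] with y h1 h2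
  rw [inner_add_left]
  linarith

theorem mem_regularNormals_of_mem_regularSubdiff {h : E → EReal} {z v : E} {t : ℝ} (ht : h z = t)
    (hv : v ∈ regularSubdiff h z) :
    WithLp.toLp 2 (v, (-1 : ℝ)) ∈ regularNormals (epigraph h) (WithLp.toLp 2 (z, t)) := by
  refine ⟨ht.le, fun ε hε => ?_⟩
  have h1 := hv.2.2 ε hε
  have h2 : Tendsto (fun q : WithLp 2 (E × ℝ) => q.fst)
      (𝓝[epigraph h] (WithLp.toLp 2 (z, t))) (𝓝 z) :=
    ((WithLp.continuous_fst 2 E ℝ).tendsto (WithLp.toLp 2 (z, t))).mono_left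
      nhdsWithin_le_nhds
  filter_upwards [h2.eventually h1, self_mem_nhdsWithin] with q hq hqe
  have h3 := hq.trans hqe
  rw [ht, ← EReal.coe_add, EReal.coe_le_coe_iff] at h3
  have h4 : ‖q.fst - z‖ ≤ ‖q - WithLp.toLp 2 (z, t)‖ :=
    WithLp.norm_fst_le _ (q - WithLp.toLp 2 (z, t))
  have h5 : ⟪WithLp.toLp 2 (v, (-1 : ℝ)), q - WithLp.toLp 2 (z, t)⟫ =
      ⟪v, q.fst - z⟫ - (q.snd - t) := by
    rw [WithLp.prod_inner_apply]
    simp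
    ring
  rw [h5]
  nlinarith

theorem mem_regularSubdiff_of_mem_regularNormals {h : E → EReal} {z v : E} {t : ℝ} (ht : h z = t)
    (hv : WithLp.toLp 2 (v, (-1 : ℝ)) ∈ regularNormals (epigraph h) (WithLp.toLp 2 (z, t))) :
    v ∈ regularSubdiff h z := by
  refine ⟨by simp [ht], by simp [ht], fun ε hε => ?_⟩
  -- If the subgradient inequality fails at `y`, then `(y, t + r)` with `r = ⟨v, y - z⟩ - ε‖y - z‖`
  -- is in the epigraph, at distance at most `K‖y - z‖` from `(z, t)`, and its displacement pairs
  -- with `(v, -1)` to exactly `ε‖y - z‖`. The tolerance `ε / (2K)` contradicts this by a factor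
  -- two.
  set K : ℝ := 1 + ‖v‖ + ε with hK
  have hKpos : 0 < K := by positivity
  obtain ⟨δ, hδ, hball⟩ := Metric.mem_nhdsWithin_iff.1 (hv.2 (ε / (2 * K)) (by positivity))
  filter_upwards [Metric.ball_mem_nhds z (show 0 < δ / K by positivity)] with y hy
  by_contra! hlt
  set r : ℝ := ⟪v, y - z⟫ - ε * ‖y - z‖ with hr
  rw [ht, ← EReal.coe_add] at hlt
  have hd : WithLp.toLp 2 (y, t + r) - WithLp.toLp 2 (z, t) = WithLp.toLp 2 (y - z, r) := by
    rw [← WithLp.toLp_sub]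
    simp
  have hrabs : |r| ≤ (‖v‖ + ε) * ‖y - z‖ := by
    have := abs_real_inner_le_norm v (y - z)
    rw [abs_le] at this ⊢
    constructor <;> nlinarith [norm_nonneg (y - z)]
  have hnorm : ‖WithLp.toLp 2 (y, t + r) - WithLp.toLp 2 (z, t)‖ ≤ K * ‖y - z‖ := by
    rw [hd]
    refine (norm_prodL2_le _).trans ?_
    simp only [WithLp.toLp_fst, WithLp.toLp_snd, Real.norm_eq_abs]
    rw [hK]
    linarith
  have hyz : ‖y - z‖ < δ / K := by rwa [Metric.mem_ball, dist_eq_norm] at hy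
  have hmem := hball (show WithLp.toLp 2 (y, t + r) ∈ _ from
    ⟨by
      rw [Metric.mem_ball, dist_eq_norm]
      refine hnorm.trans_lt ?_
      rw [lt_div_iff₀ hKpos] at hyz
      linarith, hlt.le⟩)
  have h6 : ⟪WithLp.toLp 2 (v, (-1 : ℝ)), WithLp.toLp 2 (y, t + r) - WithLp.toLp 2 (z, t)⟫ =
      ε * ‖y - z‖ := by
    rw [hd, WithLp.prod_inner_apply]
    simp [hr]
  have hmem' : ⟪WithLp.toLp 2 (v, (-1 : ℝ)), WithLp.toLp 2 (y, t + r) - WithLp.toLp 2 (z, t)⟫ ≤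
    ε / (2 * K) * ‖WithLp.toLp 2 (y, t + r) - WithLp.toLp 2 (z, t)‖ := hmem
  rw [h6] at hmem'
  have h7 : ε * ‖y - z‖ ≤ ε / 2 * ‖y - z‖ :=
    calc ε * ‖y - z‖ ≤ ε / (2 * K) * (K * ‖y - z‖) := hmem'.trans (by gcongr)
      _ = ε / 2 * ‖y - z‖ := by field_simp
  have h8 : y = z := by
    rw [← sub_eq_zero, ← norm_le_zero_iff]
    nlinarith
  subst h8
  have : r = 0 := by simp [hr]
  rw [ht, this, add_zero] at hlt
  exact lt_irrefl _ hlt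

theorem regularSubdiff_subset_subdiff (h : E → EReal) (z : E) :
    regularSubdiff h z ⊆ subdiff h z := fun v hv =>
  ⟨hv.1, hv.2.1, fun _ => z, fun _ => v, fun _ => hv, tendsto_const_nhds, tendsto_const_nhds,
    tendsto_const_nhds⟩

/-- Here Clarke regularity enters: a limiting subgradient is a limit of regular normals `(v_k, -1)`,
and regularity makes that limit a regular normal. -/
theorem mem_regularNormals_of_mem_subdiff {h : E → EReal} {z v : E} {t : ℝ} (ht : h z = t)
    (hreg : IsClarkeRegular (epigraph h) (WithLp.toLp 2 (z, t))) (hv : v ∈ subdiff h z) :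
    WithLp.toLp 2 (v, (-1 : ℝ)) ∈ regularNormals (epigraph h) (WithLp.toLp 2 (z, t)) := by
  obtain ⟨-, -, xs, vs, hvs, hx, hhx, hvv⟩ := hv
  refine hreg.2.2 ⟨hreg.1, fun k => WithLp.toLp 2 (xs k, (h (xs k)).toReal),
    fun k => WithLp.toLp 2 (vs k, (-1 : ℝ)), fun k => ?_, ?_, ?_⟩
  · exact mem_regularNormals_of_mem_regularSubdiff
      (EReal.coe_toReal (hvs k).2.1 (hvs k).1).symm (hvs k)
  · refine ((WithLp.prod_continuous_toLp 2 E ℝ).tendsto (z, t)).comp (hx.prodMk_nhds ?_)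
    have := (EReal.tendsto_toReal (a := h z) (by simp [ht]) (by simp [ht])).comp hhx
    simpa [ht, Function.comp_def] using this
  · exact ((WithLp.prod_continuous_toLp 2 E ℝ).tendsto (v, -1)).comp
      (hvv.prodMk_nhds tendsto_const_nhds)

theorem isClosed_convexSubdiff {h : E → EReal} {x : E} (h1 : h x ≠ ⊤) (h2 : h x ≠ ⊥) :
    IsClosed (convexSubdiff h x) := by
  have : convexSubdiff h x = ⋂ y, {v | h x + ((⟪v, y - x⟫ : ℝ) : EReal) ≤ h y} := by
    ext v
    simp [convexSubdiff, h1]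
  rw [this]
  refine isClosed_iInter fun y => ?_
  rw [← EReal.coe_toReal h1 h2]
  simp_rw [← EReal.coe_add]
  exact isClosed_le (continuous_coe_real_ereal.comp (by fun_prop)) continuous_const

theorem convex_convexSubdiff {h : E → EReal} {x : E} (h1 : h x ≠ ⊤) (h2 : h x ≠ ⊥) :
    Convex ℝ (convexSubdiff h x) := by
  rintro v hv w hw a b ha hb hab
  refine ⟨h1, fun y => ?_⟩
  have hv := hv.2 y
  have hw := hw.2 y
  rw [← EReal.coe_toReal h1 h2, ← EReal.coe_add] at hv hw ⊢
  set t := (h x).toReal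
  -- Bounding the convex combination by the larger of its two terms avoids averaging `h y`, which
  -- may be infinite.
  have : t + ⟪a • v + b • w, y - x⟫ ≤ max (t + ⟪v, y - x⟫) (t + ⟪w, y - x⟫) := by
    rw [inner_add_left, inner_smul_left, inner_smul_left]
    simp only [conj_trivial]
    calc t + (a * ⟪v, y - x⟫ + b * ⟪w, y - x⟫)
        = a * (t + ⟪v, y - x⟫) + b * (t + ⟪w, y - x⟫) := by linear_combination (-t) * hab
      _ ≤ a * max (t + ⟪v, y - x⟫) (t + ⟪w, y - x⟫)
          + b * max (t + ⟪v, y - x⟫) (t + ⟪w, y - x⟫) := by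
        gcongr
        · exact le_max_left _ _
        · exact le_max_right _ _
      _ = _ := by rw [← add_mul, hab, one_mul]
  refine (EReal.coe_le_coe_iff.2 this).trans ?_
  rcases max_choice (t + ⟪v, y - x⟫) (t + ⟪w, y - x⟫) with h | h <;> rw [h] <;> assumption

end NormalCones

/-! ### Joint normals and partial subgradients -/

section Partial

variable {V P : Type*}
  [NormedAddCommGroup V] [InnerProductSpace ℝ V] [FiniteDimensional ℝ V]
  [NormedAddCommGroup P] [InnerProductSpace ℝ P] [FiniteDimensional ℝ P]

/-- `g` as a function on the Euclidean space `V × P`. -/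
abbrev joint (g : V → P → EReal) : WithLp 2 (V × P) → EReal := fun z => g z.fst z.snd

/-- `M × Ω` as a subset of the Euclidean space `V × P`. -/
abbrev prodSet (M : Set V) (Ω : Set P) : Set (WithLp 2 (V × P)) := {z | z.fst ∈ M ∧ z.snd ∈ Ω}

/-- By convexity in `x` the segment from `(x, u, t)` to `(y, u, g(y, u))` lies in the epigraph. It
does not move in `u`, so `s` drops out. Dividing by the step length and letting the tolerance vanish
makes the local inequality global. -/
theorem mem_convexSubdiff_of_mem_regularNormals {g : V → P → EReal} (hbot : ∀ x u, g x u ≠ ⊥)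
    {x : V} {u : P} {t : ℝ} (ht : g x u = t) (hconv : IsConvexFun (fun y => g y u)) {v : V} {s : P}
    (hv : WithLp.toLp 2 (WithLp.toLp 2 (v, s), (-1 : ℝ)) ∈
      regularNormals (epigraph (joint g)) (WithLp.toLp 2 (WithLp.toLp 2 (x, u), t))) :
    v ∈ convexSubdiff (fun y => g y u) x := by
  refine ⟨by simp [ht], fun y => ?_⟩
  by_cases htop : g y u = ⊤
  · simp [htop]
  obtain ⟨b, hb⟩ : ∃ b : ℝ, g y u = b := ⟨_, (EReal.coe_toReal htop (hbot y u)).symm⟩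
  simp only [ht, hb]
  rw [← EReal.coe_add, EReal.coe_le_coe_iff]
  set p : WithLp 2 (WithLp 2 (V × P) × ℝ) := WithLp.toLp 2 (WithLp.toLp 2 (x, u), t) with hp
  set d : WithLp 2 (WithLp 2 (V × P) × ℝ) :=
    WithLp.toLp 2 (WithLp.toLp 2 (y - x, (0 : P)), b - t) with hd
  have hline : Tendsto (fun τ : ℝ => p + τ • d) (𝓝[>] 0) (𝓝[epigraph (joint g)] p) := by
    refine tendsto_nhdsWithin_iff.2 ⟨?_, ?_⟩
    · have : Continuous (fun τ : ℝ => p + τ • d) := by fun_prop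
      simpa using (this.tendsto 0).mono_left (nhdsWithin_le_nhds (s := Ioi 0))
    · filter_upwards [Ioo_mem_nhdsGT (show (0 : ℝ) < 1 by norm_num)] with τ hτ
      have h1 : (x, t) ∈ {p : V × ℝ | g p.1 u ≤ (p.2 : EReal)} := ht.le
      have h2 : (y, b) ∈ {p : V × ℝ | g p.1 u ≤ (p.2 : EReal)} := hb.le
      have h3 := hconv h1 h2 (a := 1 - τ) (b := τ) (by linarith [hτ.2]) hτ.1.le (by ring)
      have e1 : (p + τ • d).fst.fst = (1 - τ) • x + τ • y := by
        simp [hp, hd]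
        module
      have e2 : (p + τ • d).fst.snd = u := by simp [hp, hd]
      have e3 : (p + τ • d).snd = (1 - τ) * t + τ * b := by
        simp [hp, hd]
        ring
      change g (p + τ • d).fst.fst (p + τ • d).fst.snd ≤ ((p + τ • d).snd : EReal)
      rw [e1, e2, e3]
      simpa using h3
  have hin : ⟪WithLp.toLp 2 (WithLp.toLp 2 (v, s), (-1 : ℝ)), d⟫ = ⟪v, y - x⟫ - (b - t) := by
    rw [hd, WithLp.prod_inner_apply, WithLp.prod_inner_apply]
    simp
    ring
  have key : ∀ ε > 0, ⟪v, y - x⟫ - (b - t) ≤ ε * ‖d‖ := fun ε hε => by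
    obtain ⟨τ, hτ, hτ0⟩ := ((hline.eventually (hv.2 ε hε)).and self_mem_nhdsWithin).exists
    have hτ0 : 0 < τ := hτ0
    rw [add_sub_cancel_left, inner_smul_right, hin, norm_smul, Real.norm_of_nonneg hτ0.le] at hτ
    have : τ * (⟪v, y - x⟫ - (b - t)) ≤ τ * (ε * ‖d‖) := by linarith
    exact le_of_mul_le_mul_left this hτ0
  have : ⟪v, y - x⟫ - (b - t) ≤ 0 := by
    refine le_of_forall_pos_le_add fun ε hε => ?_
    have h1 := key (ε / (‖d‖ + 1)) (by positivity)
    have h2 : ε / (‖d‖ + 1) * ‖d‖ ≤ ε := by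
      rw [div_mul_eq_mul_div, div_le_iff₀ (by positivity)]
      nlinarith [norm_nonneg d]
    linarith
  linarith

theorem isTangentVector_prodSet {M : Set V} {Ω : Set P} (hΩ : IsOpen Ω) {x : V} {u : P}
    (hx : x ∈ M) (hu : u ∈ Ω) (s : P) :
    IsTangentVector (prodSet M Ω) (WithLp.toLp 2 (x, u)) (WithLp.toLp 2 ((0 : V), s)) := by
  have hl : Continuous (fun t : ℝ => u + t • s) := by fun_prop
  have hev : ∀ᶠ t in 𝓝 (0 : ℝ), u + t • s ∈ Ω := by
    refine hl.continuousAt.eventually ?_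
    simpa using hΩ.mem_nhds hu
  obtain ⟨ε, hε, hball⟩ := Metric.eventually_nhds_iff.1 hev
  refine ⟨ε, fun t => WithLp.toLp 2 (x, u) + t • WithLp.toLp 2 ((0 : V), s), hε, ?_, ?_, by simp, ?_⟩
  · fun_prop
  · intro t ht
    refine ⟨by simpa using hx, ?_⟩
    have := hball (y := t) (by rw [Real.dist_eq, sub_zero]; exact abs_lt.2 ht)
    simpa using this
  · simpa using ((hasDerivAt_id (0 : ℝ)).smul_const (WithLp.toLp 2 ((0 : V), s))).const_add
      (WithLp.toLp 2 (x, u))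

theorem toLp_mem_normalSpace_prodSet {M : Set V} {Ω : Set P} {x : V} {u : P} {n : V}
    (hn : n ∈ normalSpace M x) :
    WithLp.toLp 2 (n, (0 : P)) ∈ normalSpace (prodSet M Ω) (WithLp.toLp 2 (x, u)) := by
  refine mem_normalSpace_of_isTangentVector fun v hv => ?_
  rw [WithLp.prod_inner_apply]
  simp only [inner_zero_left, add_zero]
  refine inner_eq_zero_of_mem_normalSpace hn (Submodule.subset_span ?_)
  obtain ⟨ε, γ, hε, hγ, hγM, hγ0, hγ'⟩ := hv
  let F := WithLp.fstL 2 ℝ V P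
  refine ⟨ε, fun t => F (γ t), hε, F.contDiff.comp_contDiffOn hγ, fun t ht => (hγM t ht).1, ?_,
    F.hasFDerivAt.comp_hasDerivAt 0 hγ'⟩
  simp [F, hγ0]

end Partial

/-! ### Approximating partial subgradients by joint ones -/

section Partial

variable {V P : Type*}
  [NormedAddCommGroup V] [InnerProductSpace ℝ V] [FiniteDimensional ℝ V]
  [NormedAddCommGroup P] [InnerProductSpace ℝ P] [FiniteDimensional ℝ P]

theorem exists_real_of_partlySmooth {g : V → P → EReal} {M : Set V} {Ω : Set P}
    (hg : PartlySmooth (joint g) (prodSet M Ω)) {x : V} {u : P} (hx : x ∈ M) (hu : u ∈ Ω) :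
    ∃ t : ℝ, g x u = t ∧
      IsClarkeRegular (epigraph (joint g)) (WithLp.toLp 2 (WithLp.toLp 2 (x, u), t)) :=
  (hg.at_point (WithLp.toLp 2 (x, u)) ⟨hx, hu⟩).regular

/-- A minimizer of `G + ψ`, `ψ` a quadratic penalty, has a regular subgradient `-∇ψ`. -/
theorem mem_regularSubdiff_of_penalty {G : WithLp 2 (V × P) → EReal} {z : WithLp 2 (V × P)} {t : ℝ}
    (hz : G z = t) (x₀ v : V) (u₀ : P) {k : ℝ} (hk : 0 ≤ k)
    (hmin : ∀ᶠ y in 𝓝 z, G z + ((-⟪v, z.fst - x₀⟫ + ‖z.fst - x₀‖ ^ 2 / 2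
      + k / 2 * ‖z.snd - u₀‖ ^ 2 : ℝ) : EReal) ≤ G y + ((-⟪v, y.fst - x₀⟫
      + ‖y.fst - x₀‖ ^ 2 / 2 + k / 2 * ‖y.snd - u₀‖ ^ 2 : ℝ) : EReal)) :
    WithLp.toLp 2 (v - (z.fst - x₀), -k • (z.snd - u₀)) ∈ regularSubdiff G z := by
  refine ⟨by simp [hz], by simp [hz], fun ε hε => ?_⟩
  filter_upwards [hmin, Metric.ball_mem_nhds z (show 0 < ε / (1 + k) by positivity)] with y hy hyz
  rw [Metric.mem_ball, dist_eq_norm, lt_div_iff₀ (by positivity)] at hyz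
  by_cases htop : G y = ⊤
  · simp [htop]
  by_cases hbot : G y = ⊥
  · rw [hz, hbot, ← EReal.coe_add, EReal.bot_add, le_bot_iff] at hy
    exact absurd hy (EReal.coe_ne_bot _)
  obtain ⟨b, hb⟩ : ∃ b : ℝ, G y = b := ⟨_, (EReal.coe_toReal htop hbot).symm⟩
  rw [hz, hb, ← EReal.coe_add, ← EReal.coe_add, EReal.coe_le_coe_iff] at hy
  rw [hz, hb, ← EReal.coe_add, EReal.coe_le_coe_iff]
  have hsq := WithLp.prod_norm_sq_eq_of_L2 (y - z)
  have e1 : ‖y.fst - x₀‖ ^ 2 = ‖z.fst - x₀‖ ^ 2 + 2 * ⟪z.fst - x₀, y.fst - z.fst⟫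
      + ‖y.fst - z.fst‖ ^ 2 := by
    rw [← norm_add_sq_real]
    congr 2
    abel
  have e2 : ‖y.snd - u₀‖ ^ 2 = ‖z.snd - u₀‖ ^ 2 + 2 * ⟪z.snd - u₀, y.snd - z.snd⟫
      + ‖y.snd - z.snd‖ ^ 2 := by
    rw [← norm_add_sq_real]
    congr 2
    abel
  have e3 : ⟪v, y.fst - x₀⟫ = ⟪v, z.fst - x₀⟫ + ⟪v, y.fst - z.fst⟫ := by
    rw [← inner_add_right]
    congr 1
    abel
  have e4 : ⟪WithLp.toLp 2 (v - (z.fst - x₀), -k • (z.snd - u₀)), y - z⟫ =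
      ⟪v, y.fst - z.fst⟫ - ⟪z.fst - x₀, y.fst - z.fst⟫ - k * ⟪z.snd - u₀, y.snd - z.snd⟫ := by
    rw [WithLp.prod_inner_apply]
    simp [inner_sub_left, inner_smul_left]
    ring
  rw [e1, e2, e3] at hy
  rw [e4]
  have hsq' : ‖y - z‖ ^ 2 = ‖y.fst - z.fst‖ ^ 2 + ‖y.snd - z.snd‖ ^ 2 := hsq
  -- The quadratic remainder of the penalty, absorbed by `ε‖y - z‖` in the ball of radius `ε / (1 +
  -- k)`.
  have h5 : ‖y.fst - z.fst‖ ^ 2 / 2 + k / 2 * ‖y.snd - z.snd‖ ^ 2 ≤ (1 + k) * ‖y - z‖ ^ 2 := by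
    rw [hsq']
    nlinarith [sq_nonneg ‖y.fst - z.fst‖, sq_nonneg ‖y.snd - z.snd‖,
      mul_nonneg hk (sq_nonneg ‖y.fst - z.fst‖), mul_nonneg hk (sq_nonneg ‖y.snd - z.snd‖)]
  have h6 : (1 + k) * ‖y - z‖ ^ 2 ≤ ε * ‖y - z‖ := by
    nlinarith [norm_nonneg (y - z)]
  linarith

/-- Partial convex subgradients are limits of first components of joint regular subgradients. -/
theorem exists_regularSubdiff_near {g : V → P → EReal} (hbot : ∀ x u, g x u ≠ ⊥)
    (hlsc : LowerSemicontinuous (joint g)) {x : V} {u : P} {t : ℝ} (ht : g x u = t) {v : V}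
    (hv : v ∈ convexSubdiff (fun y => g y u) x) {ε : ℝ} (hε : 0 < ε) :
    ∃ (z : WithLp 2 (V × P)) (w : V) (s : P), dist z (WithLp.toLp 2 (x, u)) < ε ∧ ‖w - v‖ < ε ∧
      |(joint g z).toReal - t| < ε ∧ WithLp.toLp 2 (w, s) ∈ regularSubdiff (joint g) z := by
  set z₀ : WithLp 2 (V × P) := WithLp.toLp 2 (x, u) with hz₀
  have hgz₀ : joint g z₀ = t := ht
  -- Since `v` is a subgradient of `g(·, u)`, the point `x` is the strict minimizer of `g(·, u) -
  -- ⟨v, · - x⟩ + ‖· - x‖²/2`. The last term of `ψ` enforces the parameter value `u` as `k → ∞`, so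
  -- minimizers of `g + ψ k` cluster at `z₀`. Their subgradients have first component near `v`; the
  -- parameter component `-k(z.snd - u)` is left uncontrolled.
  let ψ : ℕ → WithLp 2 (V × P) → ℝ := fun k z =>
    -⟪v, z.fst - x⟫ + ‖z.fst - x‖ ^ 2 / 2 + (k : ℝ) / 2 * ‖z.snd - u‖ ^ 2
  have hψc : ∀ k, Continuous (ψ k) := fun k => by
    have h1 := WithLp.continuous_fst 2 V P
    have h2 := WithLp.continuous_snd 2 V P
    fun_prop
  have hψ₀ : ∀ k, ψ k z₀ = 0 := fun k => by simp [ψ, hz₀]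
  have hcomp : IsCompact (Metric.closedBall z₀ 1) := isCompact_closedBall _ _
  have hne : (Metric.closedBall z₀ 1).Nonempty := ⟨z₀, Metric.mem_closedBall_self (by norm_num)⟩
  have hz₀mem : z₀ ∈ Metric.closedBall z₀ 1 := Metric.mem_closedBall_self (by norm_num)
  have hexmin : ∀ k, ∃ z ∈ Metric.closedBall z₀ 1, ∀ y ∈ Metric.closedBall z₀ 1,
      joint g z + (ψ k z : EReal) ≤ joint g y + (ψ k y : EReal) := fun k => by
    have hl : LowerSemicontinuous (fun z => joint g z + (ψ k z : EReal)) := by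
      refine hlsc.add' (continuous_coe_real_ereal.comp (hψc k)).lowerSemicontinuous fun z => ?_
      exact EReal.continuousAt_add (Or.inr (EReal.coe_ne_bot _)) (Or.inr (EReal.coe_ne_top _))
    exact (hl.lowerSemicontinuousOn _).exists_isMinOn hne hcomp
  choose z hzmem hzmin using hexmin
  have hz_le : ∀ k, joint g (z k) + (ψ k (z k) : EReal) ≤ t := fun k => by
    have := hzmin k z₀ hz₀mem
    rwa [hψ₀, hgz₀, EReal.coe_zero, add_zero] at this
  have hreal : ∀ k, ∃ b : ℝ, joint g (z k) = b := fun k => by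
    refine ⟨_, (EReal.coe_toReal (fun htop : joint g (z k) = ⊤ => ?_) (hbot _ _)).symm⟩
    have := hz_le k
    rw [htop, EReal.top_add_coe, top_le_iff] at this
    exact EReal.coe_ne_top _ this
  choose b hb using hreal
  have hbψ : ∀ k, b k + ψ k (z k) ≤ t := fun k => by
    have := hz_le k
    rwa [hb, ← EReal.coe_add, EReal.coe_le_coe_iff] at this
  obtain ⟨m, hm⟩ : ∃ m : ℝ, ∀ k, m ≤ b k := by
    obtain ⟨y, hy, hymin⟩ := (hlsc.lowerSemicontinuousOn _).exists_isMinOn hne hcomp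
    have h1 : joint g y ≤ joint g z₀ := hymin hz₀mem
    rw [hgz₀] at h1
    refine ⟨(joint g y).toReal, fun k => ?_⟩
    have h2 : joint g y ≤ joint g (z k) := hymin (hzmem k)
    rw [hb, ← EReal.coe_toReal (x := joint g y) (fun h => by simp [h] at h1) (hbot _ _),
      EReal.coe_le_coe_iff] at h2
    exact h2
  have hlin : ∀ k, ⟪v, (z k).fst - x⟫ ≤ ‖v‖ := fun k => by
    have h1 : ‖(z k).fst - x‖ ≤ 1 := by
      refine (WithLp.norm_fst_le V (z k - z₀)).trans ?_
      simpa [dist_eq_norm] using hzmem k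
    exact (real_inner_le_norm _ _).trans (by nlinarith [norm_nonneg v])
  obtain ⟨zl, -, φ, hφ, hlim⟩ := hcomp.tendsto_subseq hzmem
  have hfst : Tendsto (fun k => (z (φ k)).fst) atTop (𝓝 zl.fst) :=
    ((WithLp.continuous_fst 2 V P).tendsto zl).comp hlim
  have hsnd : Tendsto (fun k => (z (φ k)).snd) atTop (𝓝 zl.snd) :=
    ((WithLp.continuous_snd 2 V P).tendsto zl).comp hlim
  have hu : zl.snd = u := by
    have h1 : ∀ k : ℕ, (k : ℝ) * ‖(z k).snd - u‖ ^ 2 ≤ 2 * (t - m + ‖v‖) := fun k => by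
      have h1 := hbψ k
      simp only [ψ] at h1
      nlinarith [hm k, hlin k, sq_nonneg ‖(z k).fst - x‖]
    have h2 : Tendsto (fun k => ‖(z (φ k)).snd - u‖ ^ 2) atTop (𝓝 0) := by
      have h3 : Tendsto (fun k => 2 * (t - m + ‖v‖) / (φ k : ℝ)) atTop (𝓝 0) :=
        tendsto_const_nhds.div_atTop (tendsto_natCast_atTop_atTop.comp hφ.tendsto_atTop)
      refine tendsto_of_tendsto_of_tendsto_of_le_of_le' tendsto_const_nhds h3
        (Eventually.of_forall fun k => sq_nonneg _) ?_
      filter_upwards [hφ.tendsto_atTop.eventually (eventually_gt_atTop 0)] with k hk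
      rw [le_div_iff₀ (by exact_mod_cast hk)]
      linarith [h1 (φ k)]
    have h4 := tendsto_nhds_unique h2 (((hsnd.sub_const u).norm).pow 2)
    have h5 : ‖zl.snd - u‖ = 0 := by
      have := h4.symm
      exact pow_eq_zero_iff (two_ne_zero) |>.1 this
    exact sub_eq_zero.1 (norm_eq_zero.1 h5)
  have hbup : ∀ k, b k ≤ t + ⟪v, (z k).fst - x⟫ - ‖(z k).fst - x‖ ^ 2 / 2 := fun k => by
    have h1 := hbψ k
    have h2 : 0 ≤ (k : ℝ) / 2 * ‖(z k).snd - u‖ ^ 2 := by positivity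
    simp only [ψ] at h1
    linarith
  have hblim : Tendsto (fun k => t + ⟪v, (z (φ k)).fst - x⟫ - ‖(z (φ k)).fst - x‖ ^ 2 / 2) atTop
      (𝓝 (t + ⟪v, zl.fst - x⟫ - ‖zl.fst - x‖ ^ 2 / 2)) :=
    (((tendsto_const_nhds.inner (hfst.sub_const x)).const_add t).sub
      (((hfst.sub_const x).norm.pow 2).div_const 2))
  have hgzl : joint g zl ≤ ((t + ⟪v, zl.fst - x⟫ - ‖zl.fst - x‖ ^ 2 / 2 : ℝ) : EReal) := by
    by_contra! hlt
    obtain ⟨r, hr1, hr2⟩ := EReal.lt_iff_exists_real_btwn.1 hlt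
    refine absurd (ge_of_tendsto hblim (b := r) ?_) (not_le.2 (EReal.coe_lt_coe_iff.1 hr1))
    filter_upwards [hlim.eventually (hlsc zl r hr2)] with k hk
    simp only [Function.comp_apply, hb, EReal.coe_lt_coe_iff] at hk
    exact hk.le.trans (hbup _)
  -- Lower semicontinuity bounds `g` at the limit from above by `t + ⟨v, · - x⟩` minus the square,
  -- and the subgradient inequality bounds it from below without the square. The square must vanish.
  have hx : zl.fst = x := by
    have h1 := hv.2 zl.fst
    have h2 : g zl.fst zl.snd = g zl.fst u := by rw [hu]
    change g zl.fst zl.snd ≤ _ at hgzl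
    rw [h2] at hgzl
    have h3 := h1.trans hgzl
    simp only [ht] at h3
    rw [← EReal.coe_add, EReal.coe_le_coe_iff] at h3
    have h4 : ‖zl.fst - x‖ ^ 2 ≤ 0 := by linarith
    have h5 : ‖zl.fst - x‖ = 0 := by nlinarith [norm_nonneg (zl.fst - x)]
    exact sub_eq_zero.1 (norm_eq_zero.1 h5)
  have hzl : zl = z₀ := by
    rw [hz₀, ← hx, ← hu]
    rfl
  rw [hzl] at hlim
  rw [hx] at hfst hblim
  have hev1 : ∀ᶠ k in atTop, dist (z (φ k)) z₀ < min ε 1 :=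
    hlim.eventually (Metric.ball_mem_nhds z₀ (by positivity))
  have hev2 : ∀ᶠ k in atTop, ‖(z (φ k)).fst - x‖ < ε := by
    have := (hfst.sub_const x).norm
    rw [sub_self, norm_zero] at this
    exact this.eventually (gt_mem_nhds hε)
  have hev3 : ∀ᶠ k in atTop, b (φ k) < t + ε := by
    have h1 := hblim.eventually_lt_const (show _ < t + ε by simpa using hε)
    filter_upwards [h1] with k hk
    exact (hbup _).trans_lt hk
  have hev4 : ∀ᶠ k in atTop, t - ε < b (φ k) := by
    have h1 : ((t - ε : ℝ) : EReal) < joint g z₀ := by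
      rw [hgz₀, EReal.coe_lt_coe_iff]
      linarith
    filter_upwards [hlim.eventually (hlsc z₀ _ h1)] with k hk
    simp only [Function.comp_apply, hb, EReal.coe_lt_coe_iff] at hk
    exact hk
  obtain ⟨k, h1, h2, h3, h4⟩ := (hev1.and (hev2.and (hev3.and hev4))).exists
  refine ⟨z (φ k), v - ((z (φ k)).fst - x), -(φ k : ℝ) • ((z (φ k)).snd - u),
    h1.trans_le (min_le_left _ _), ?_, ?_, ?_⟩
  · rw [sub_sub_cancel_left, norm_neg]
    exact h2
  · rw [hb, EReal.toReal_coe, abs_lt]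
    constructor <;> linarith
  · refine mem_regularSubdiff_of_penalty (hb _) x v u (Nat.cast_nonneg _) ?_
    filter_upwards [Metric.isOpen_ball.mem_nhds
      (show z (φ k) ∈ Metric.ball z₀ 1 from h1.trans_le (min_le_right _ _))] with y hy
    exact hzmin (φ k) y (Metric.ball_subset_closedBall hy)

end Partial

/-! ### Lifting, inner semicontinuity and stability of partial subgradients -/

section Partial

variable {V P : Type*}
  [NormedAddCommGroup V] [InnerProductSpace ℝ V] [FiniteDimensional ℝ V]
  [NormedAddCommGroup P] [InnerProductSpace ℝ P] [FiniteDimensional ℝ P]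
  {g : V → P → EReal} {M : Set V} {Ω : Set P}

/-- Partial smoothness relative to `M × Ω` rules out singular normals in the parameter
direction. -/
theorem eq_zero_of_mem_regularNormals (hΩ : IsOpen Ω)
    (hg : PartlySmooth (joint g) (prodSet M Ω)) {x : V} {u : P} (hx : x ∈ M) (hu : u ∈ Ω) {t : ℝ}
    (ht : g x u = t)
    (hreg : IsClarkeRegular (epigraph (joint g)) (WithLp.toLp 2 (WithLp.toLp 2 (x, u), t))) {s : P}
    (hs : WithLp.toLp 2 (WithLp.toLp 2 ((0 : V), s), (0 : ℝ)) ∈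
      regularNormals (epigraph (joint g)) (WithLp.toLp 2 (WithLp.toLp 2 (x, u), t))) : s = 0 := by
  set z₀ : WithLp 2 (V × P) := WithLp.toLp 2 (x, u)
  have hp := hg.at_point z₀ ⟨hx, hu⟩
  obtain ⟨v, hv⟩ := hp.nonempty
  have hgz : joint g z₀ = t := ht
  -- Adding the singular normal to a subgradient normal gives another subgradient, so `(0, s)` is a
  -- difference of subgradients and by sharpness normal to `M × Ω`. It is also tangent, since `Ω` is
  -- open.
  have h1 := regularNormals_add (mem_regularNormals_of_mem_subdiff hgz hreg hv) hs
  rw [← WithLp.toLp_add, Prod.mk_add_mk, add_zero] at h1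
  have h2 := regularSubdiff_subset_subdiff _ _ (mem_regularSubdiff_of_mem_regularNormals hgz h1)
  have h3 : WithLp.toLp 2 ((0 : V), s) ∈ vectorSpan ℝ (subdiff (joint g) z₀) := by
    have := vsub_mem_vectorSpan ℝ h2 hv
    simpa using this
  rw [← hp.sharp] at h3
  have h4 := inner_eq_zero_of_mem_normalSpace h3
    (Submodule.subset_span (isTangentVector_prodSet hΩ hx hu s))
  rw [WithLp.prod_inner_apply] at h4
  simpa using h4

/-- Partial convex subgradients lift to joint subgradients. -/
theorem exists_mem_subdiff_of_mem_convexSubdiff (hΩ : IsOpen Ω)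
    (hg : PartlySmooth (joint g) (prodSet M Ω)) {x : V} {u : P} (hx : x ∈ M) (hu : u ∈ Ω) {v : V}
    (hv : v ∈ convexSubdiff (fun y => g y u) x) :
    ∃ s, WithLp.toLp 2 (v, s) ∈ subdiff (joint g) (WithLp.toLp 2 (x, u)) := by
  obtain ⟨t, ht, hreg⟩ := exists_real_of_partlySmooth hg hx hu
  set z₀ : WithLp 2 (V × P) := WithLp.toLp 2 (x, u)
  have hgz : joint g z₀ = t := ht
  have hbot : ∀ x u, g x u ≠ ⊥ := fun x u => hg.ne_bot (WithLp.toLp 2 (x, u))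
  have hseq := fun n : ℕ => exists_regularSubdiff_near hbot hg.lsc ht hv
    (show (0 : ℝ) < 1 / ((n : ℝ) + 1) by positivity)
  choose z w s hz hw hb hsub using hseq
  have hδ : Tendsto (fun n : ℕ => 1 / ((n : ℝ) + 1)) atTop (𝓝 0) :=
    tendsto_one_div_add_atTop_nhds_zero_nat
  have hzl : Tendsto z atTop (𝓝 z₀) :=
    tendsto_iff_dist_tendsto_zero.2 (squeeze_zero (fun _ => dist_nonneg) (fun n => (hz n).le) hδ)
  have hwl : Tendsto w atTop (𝓝 v) :=
    tendsto_iff_norm_sub_tendsto_zero.2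
      (squeeze_zero (fun _ => norm_nonneg _) (fun n => (hw n).le) hδ)
  have hbl : Tendsto (fun n => (joint g (z n)).toReal) atTop (𝓝 t) :=
    tendsto_iff_norm_sub_tendsto_zero.2
      (squeeze_zero (fun _ => norm_nonneg _) (fun n => (hb n).le) hδ)
  -- The normals `(w, s, -1)` are scaled by `1 / max(1, ‖s‖)`, so that a subsequence converges even
  -- if the parameter components blow up.
  let r : ℕ → ℝ := fun n => (max 1 ‖s n‖)⁻¹
  have hmax : ∀ n, 0 < max 1 ‖s n‖ := fun n => lt_max_of_lt_left one_pos
  have hr0 : ∀ n, 0 < r n := fun n => inv_pos.2 (hmax n)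
  have hr1 : ∀ n, r n ≤ 1 := fun n => inv_le_one_of_one_le₀ (le_max_left _ _)
  have hrs : ∀ n, ‖r n • s n‖ ≤ 1 := fun n => by
    rw [norm_smul, Real.norm_of_nonneg (hr0 n).le, inv_mul_le_one₀ (hmax n)]
    exact le_max_right _ _
  have hcomp : IsCompact (Icc (0 : ℝ) 1 ×ˢ Metric.closedBall (0 : P) 1) :=
    isCompact_Icc.prod (isCompact_closedBall _ _)
  obtain ⟨⟨ρ, σ⟩, hρσ, φ, hφ, hlim⟩ := hcomp.tendsto_subseq (x := fun n => (r n, r n • s n))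
    fun n => ⟨⟨(hr0 n).le, hr1 n⟩, by simpa using hrs n⟩
  have hρ : Tendsto (fun n => r (φ n)) atTop (𝓝 ρ) := (continuous_fst.tendsto (ρ, σ)).comp hlim
  have hσ : Tendsto (fun n => r (φ n) • s (φ n)) atTop (𝓝 σ) :=
    (continuous_snd.tendsto (ρ, σ)).comp hlim
  have hφt := hφ.tendsto_atTop
  have hN : WithLp.toLp 2 (WithLp.toLp 2 (ρ • v, σ), -ρ) ∈
      regularNormals (epigraph (joint g)) (WithLp.toLp 2 (z₀, t)) := by
    refine hreg.2.2 ⟨hreg.1, fun n => WithLp.toLp 2 (z (φ n), (joint g (z (φ n))).toReal),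
      fun n => r (φ n) • WithLp.toLp 2 (WithLp.toLp 2 (w (φ n), s (φ n)), (-1 : ℝ)),
      fun n => ?_, ?_, ?_⟩
    · refine regularNormals_smul ?_ (hr0 _).le
      exact mem_regularNormals_of_mem_regularSubdiff
        (EReal.coe_toReal (hsub _).2.1 (hsub _).1).symm (hsub _)
    · exact ((WithLp.prod_continuous_toLp 2 _ ℝ).tendsto (z₀, t)).comp
        ((hzl.comp hφt).prodMk_nhds (hbl.comp hφt))
    · have h1 : Tendsto (fun n => WithLp.toLp 2 (r (φ n) • w (φ n), r (φ n) • s (φ n))) atTop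
          (𝓝 (WithLp.toLp 2 (ρ • v, σ))) :=
        ((WithLp.prod_continuous_toLp 2 V P).tendsto (ρ • v, σ)).comp
          ((hρ.smul (hwl.comp hφt)).prodMk_nhds hσ)
      have h2 := ((WithLp.prod_continuous_toLp 2 (WithLp 2 (V × P)) ℝ).tendsto
        (WithLp.toLp 2 (ρ • v, σ), -ρ)).comp (h1.prodMk_nhds hρ.neg)
      refine h2.congr fun n => ?_
      simp only [Function.comp_apply, ← WithLp.toLp_smul, Prod.smul_mk, smul_eq_mul, mul_neg,
        mul_one]
  -- If `ρ = 0`, the scaled parameter components eventually have norm one, so the limit is a nonzero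
  -- singular normal `(0, σ, 0)`: impossible. If `ρ > 0`, division by `ρ` yields the lifted
  -- subgradient.
  rcases hρσ.1.1.eq_or_lt with h0 | h0
  · exfalso
    have h0 : ρ = 0 := h0.symm
    subst h0
    rw [zero_smul, neg_zero] at hN
    have hσ0 := eq_zero_of_mem_regularNormals hΩ hg hx hu ht hreg hN
    have h1 : ∀ᶠ n in atTop, ‖r (φ n) • s (φ n)‖ = 1 := by
      filter_upwards [hρ.eventually_lt_const one_pos] with n hn
      have h2 : 1 < ‖s (φ n)‖ := by
        by_contra! hle
        simp [r, max_eq_left hle] at hn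
      rw [norm_smul, Real.norm_of_nonneg (hr0 _).le]
      simp only [r, max_eq_right h2.le]
      exact inv_mul_cancel₀ (by positivity)
    have h3 := tendsto_nhds_unique (hσ.norm.congr' h1) tendsto_const_nhds
    rw [hσ0, norm_zero] at h3
    exact one_ne_zero h3.symm
  · refine ⟨ρ⁻¹ • σ, regularSubdiff_subset_subdiff _ _
      (mem_regularSubdiff_of_mem_regularNormals hgz ?_)⟩
    have h1 := regularNormals_smul hN (inv_nonneg.2 h0.le)
    rw [← WithLp.toLp_smul, Prod.smul_mk, ← WithLp.toLp_smul, Prod.smul_mk, smul_smul,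
      inv_mul_cancel₀ h0.ne', one_smul, smul_neg, smul_eq_mul, inv_mul_cancel₀ h0.ne'] at h1
    exact h1

/-- First components of joint subgradients are partial convex subgradients. -/
theorem mem_convexSubdiff_of_mem_subdiff (hg : PartlySmooth (joint g) (prodSet M Ω)) {x : V} {u : P}
    (hx : x ∈ M) (hu : u ∈ Ω) (hconv : IsConvexFun (fun y => g y u)) {z : WithLp 2 (V × P)}
    (hz : z ∈ subdiff (joint g) (WithLp.toLp 2 (x, u))) :
    z.fst ∈ convexSubdiff (fun y => g y u) x := by
  obtain ⟨t, ht, hreg⟩ := exists_real_of_partlySmooth hg hx hu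
  exact mem_convexSubdiff_of_mem_regularNormals
    (fun x u => hg.ne_bot (WithLp.toLp 2 (x, u))) ht hconv (s := z.snd)
    (mem_regularNormals_of_mem_subdiff (h := joint g) ht hreg hz)

/-- For normal `n`, the vector `(n, 0)` is normal to `M × Ω`, hence in the span given by sharpness.
The projection to `V` maps joint subgradients to partial ones. -/
theorem normalSpace_le_vectorSpan (hg : PartlySmooth (joint g) (prodSet M Ω)) {x : V} {u : P}
    (hx : x ∈ M) (hu : u ∈ Ω) (hconv : IsConvexFun (fun y => g y u)) :
    normalSpace M x ≤ vectorSpan ℝ (convexSubdiff (fun y => g y u) x) := by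
  intro n hn
  have h1 := toLp_mem_normalSpace_prodSet (Ω := Ω) (u := u) hn
  rw [(hg.at_point (WithLp.toLp 2 (x, u)) ⟨hx, hu⟩).sharp] at h1
  let F : WithLp 2 (V × P) →ₗ[ℝ] V := (WithLp.fstL 2 ℝ V P).toLinearMap
  have h2 : (vectorSpan ℝ (subdiff (joint g) (WithLp.toLp 2 (x, u)))).map F ≤
      vectorSpan ℝ (convexSubdiff (fun y => g y u) x) := by
    have := AffineMap.map_vectorSpan (F.toAffineMap) (s := subdiff (joint g) (WithLp.toLp 2 (x, u)))
    rw [LinearMap.toAffineMap_linear] at this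
    rw [this]
    refine vectorSpan_mono ℝ ?_
    rintro _ ⟨z, hz, rfl⟩
    exact mem_convexSubdiff_of_mem_subdiff hg hx hu hconv hz
  exact h2 ⟨_, h1, rfl⟩

/-- Inner semicontinuity of the partial subdifferential along `M × Ω`. -/
theorem eventually_exists_convexSubdiff_near (hΩ : IsOpen Ω)
    (hg : PartlySmooth (joint g) (prodSet M Ω)) (hconv : ∀ u ∈ Ω, IsConvexFun (fun y => g y u))
    {x : V} {u : P} (hx : x ∈ M) (hu : u ∈ Ω) {v : V}
    (hv : v ∈ convexSubdiff (fun y => g y u) x) {ε : ℝ} (hε : 0 < ε) :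
    ∀ᶠ z in 𝓝[M ×ˢ Ω] (x, u), ∃ w ∈ convexSubdiff (fun y => g y z.2) z.1, ‖w - v‖ < ε := by
  obtain ⟨s, hs⟩ := exists_mem_subdiff_of_mem_convexSubdiff hΩ hg hx hu hv
  have h1 := (hg.at_point (WithLp.toLp 2 (x, u)) ⟨hx, hu⟩).continuous.2 _ hs ε hε
  have h2 : Tendsto (fun z : V × P => WithLp.toLp 2 z) (𝓝[M ×ˢ Ω] (x, u))
      (𝓝[prodSet M Ω] (WithLp.toLp 2 (x, u))) := by
    refine tendsto_nhdsWithin_iff.2 ⟨?_, ?_⟩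
    · exact ((WithLp.prod_continuous_toLp 2 V P).tendsto (x, u)).mono_left nhdsWithin_le_nhds
    · filter_upwards [self_mem_nhdsWithin] with z hz using hz
  filter_upwards [h2.eventually h1, self_mem_nhdsWithin] with z hz hzM
  obtain ⟨w, hw, hwv⟩ := hz
  refine ⟨w.fst, mem_convexSubdiff_of_mem_subdiff hg hzM.1 hzM.2 (hconv _ hzM.2) hw, ?_⟩
  exact (WithLp.norm_fst_le V (w - WithLp.toLp 2 (v, s))).trans_lt hwv

theorem exists_ball_subset_of_mem_intrinsicInterior {S : Set V} {p : V}
    (hp : p ∈ intrinsicInterior ℝ S) :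
    ∃ r > 0, ∀ n ∈ vectorSpan ℝ S, ‖n‖ < r → p + n ∈ S := by
  obtain ⟨y, hy, rfl⟩ := mem_intrinsicInterior.1 hp
  obtain ⟨r, hr, hball⟩ := Metric.mem_nhds_iff.1 (mem_interior_iff_mem_nhds.1 hy)
  refine ⟨r, hr, fun n hn hnr => ?_⟩
  have hmem : (y : V) + n ∈ affineSpan ℝ S := by
    rw [add_comm]
    refine AffineSubspace.vadd_mem_of_mem_direction ?_ y.2
    rwa [direction_affineSpan]
  exact hball (show (⟨(y : V) + n, hmem⟩ : affineSpan ℝ S) ∈ Metric.ball y r by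
    rw [Metric.mem_ball, Subtype.dist_eq, dist_eq_norm]
    simpa using hnr)

/-- Nondegenerate subgradients persist: near a point of `M × Ω` with `ν` in the relative interior
of the partial subdifferential, all vectors near `ν` with the right tangential part are partial
subgradients. -/
theorem eventually_mem_convexSubdiff (hM : IsC2Submanifold M) (hΩ : IsOpen Ω)
    (hg : PartlySmooth (joint g) (prodSet M Ω)) (hconv : ∀ u ∈ Ω, IsConvexFun (fun y => g y u))
    {x : V} {u : P} (hx : x ∈ M) (hu : u ∈ Ω) {ν : V}
    (hν : ∃ r > 0, ∀ n ∈ normalSpace M x, ‖n‖ < r → ν + n ∈ convexSubdiff (fun y => g y u) x) {G : V → P → V}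
    (hG : ∀ᶠ z in 𝓝[M ×ˢ Ω] (x, u), ∀ v ∈ convexSubdiff (fun y => g y z.2) z.1,
      v - G z.1 z.2 ∈ normalSpace M z.1) :
    ∃ ε > 0, ∀ᶠ z in 𝓝[M ×ˢ Ω] (x, u), ∀ v, ‖v - ν‖ < ε → v - G z.1 z.2 ∈ normalSpace M z.1 →
      v ∈ convexSubdiff (fun y => g y z.2) z.1 := by
  obtain ⟨r₀, hr₀, hball⟩ := hν
  obtain ⟨r, hr, hrr⟩ : ∃ r > 0, r < r₀ := ⟨r₀ / 2, by positivity, by linarith⟩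
  have hK : IsCompact (Metric.closedBall (0 : V) r ∩ (normalSpace M x : Set V)) :=
    (isCompact_closedBall _ _).inter_right (Submodule.closed_of_finiteDimensional _)
  -- A finite net of the normal ball at `x`: inner semicontinuity holds pointwise, and is made
  -- uniform by using it only at the finitely many subgradients `ν + n`.
  obtain ⟨t, htK, htf, hcov⟩ := hK.finite_cover_balls (show 0 < r / 8 by positivity)
  have hnet : ∀ᶠ z in 𝓝[M ×ˢ Ω] (x, u), ∀ n ∈ t,
      ∃ w ∈ convexSubdiff (fun y => g y z.2) z.1, ‖w - (ν + n)‖ < r / 8 := by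
    refine (htf.eventually_all).2 fun n hn => ?_
    refine eventually_exists_convexSubdiff_near hΩ hg hconv hx hu ?_ (by positivity)
    refine hball n (htK hn).2 ?_
    exact (mem_closedBall_zero_iff.1 (htK hn).1).trans_lt hrr
  have hfst : Tendsto (fun z : V × P => z.1) (𝓝[M ×ˢ Ω] (x, u)) (𝓝[M] x) := by
    refine tendsto_nhdsWithin_iff.2
      ⟨(continuous_fst.tendsto (x, u)).mono_left nhdsWithin_le_nhds, ?_⟩
    filter_upwards [self_mem_nhdsWithin] with z hz using hz.1
  have hproj : ∀ᶠ z in 𝓝[M ×ˢ Ω] (x, u), ‖norProj M z.1 - norProj M x‖ < 1 / 4 := by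
    have h1 := (((tendsto_norProj hM hx).sub_const (norProj M x)).norm).comp hfst
    rw [sub_self, norm_zero] at h1
    exact h1.eventually_lt_const (by norm_num)
  refine ⟨r / 8, by positivity, ?_⟩
  filter_upwards [hnet, hproj, hG, self_mem_nhdsWithin] with z hznet hzproj hzG hzM v hvν hvn
  by_contra hvS
  obtain ⟨τ, hτ, -⟩ := exists_real_of_partlySmooth hg hzM.1 hzM.2
  have htop : (fun y => g y z.2) z.1 ≠ ⊤ := by simp [hτ]
  have hbot : (fun y => g y z.2) z.1 ≠ ⊥ := by simp [hτ]
  set S := convexSubdiff (fun y => g y z.2) z.1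
  have hSne : S.Nonempty := by
    obtain ⟨n, hn, -⟩ := mem_iUnion₂.1 (hcov (show (0 : V) ∈ _ from
      ⟨Metric.mem_closedBall_self hr.le, Submodule.zero_mem _⟩))
    obtain ⟨w, hw, -⟩ := hznet n hn
    exact ⟨w, hw⟩
  have hSconv : Convex ℝ S :=
    convex_convexSubdiff (h := fun y => g y z.2) htop hbot
  -- If `v` is not a subgradient, its projection `q` onto the closed convex set `S` gives a
  -- separating direction. As `v` and `q` have the same tangential part, that direction is normal to
  -- `M` at `z.1`.
  obtain ⟨q, hq, hqmin⟩ := exists_norm_eq_iInf_of_complete_convex hSne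
    (isClosed_convexSubdiff (h := fun y => g y z.2) htop hbot).isComplete hSconv v
  have hsep := (norm_eq_iInf_iff_real_inner_le_zero hSconv hq).1 hqmin
  have hd0 : v - q ≠ 0 := fun h => hvS (by rwa [sub_eq_zero.1 h])
  have hdpos : 0 < ‖v - q‖ := norm_pos_iff.2 hd0
  have hdn : v - q ∈ normalSpace M z.1 := by
    have := Submodule.sub_mem _ hvn (hzG q hq)
    rwa [sub_sub_sub_cancel_right] at this
  set n : V := ‖v - q‖⁻¹ • (v - q) with hn
  have hn1 : ‖n‖ = 1 := by
    rw [hn, norm_smul, norm_inv, norm_norm, inv_mul_cancel₀ hdpos.ne']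
  have hnN : n ∈ normalSpace M z.1 := Submodule.smul_mem _ _ hdn
  have hnsep : ∀ w ∈ S, ⟪n, w⟫ ≤ ⟪n, v⟫ := fun w hw => by
    have h1 := hsep w hw
    have h2 : ⟪v - q, w - v⟫ ≤ 0 := by
      have : w - v = (w - q) - (v - q) := by abel
      rw [this, inner_sub_right]
      have := real_inner_self_nonneg (x := v - q)
      linarith
    have h3 : ⟪n, w - v⟫ ≤ 0 := by
      rw [hn, inner_smul_left]
      exact mul_nonpos_of_nonneg_of_nonpos (by simp) h2
    rw [inner_sub_right] at h3
    linarith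
  have hbound : ∀ w : V, -‖w‖ ≤ ⟪n, w⟫ ∧ ⟪n, w⟫ ≤ ‖w‖ := fun w => by
    have := abs_real_inner_le_norm n w
    rw [hn1, one_mul, abs_le] at this
    exact this
  -- The separating direction `n` is normal at `z.1`, whereas the net lives in the normal space at
  -- `x`; it is projected there, losing at most `1/4` by continuity of the normal projections.
  obtain ⟨k, hk, hkd⟩ := mem_iUnion₂.1 (hcov (show r • norProj M x n ∈ _ from
    ⟨by
      rw [mem_closedBall_zero_iff, norm_smul, Real.norm_of_nonneg hr.le]
      have : ‖norProj M x n‖ ≤ ‖n‖ := Submodule.norm_starProjection_apply_le _ _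
      rw [hn1] at this
      nlinarith, Submodule.smul_mem _ _ (norProj_mem M x n)⟩))
  rw [Metric.mem_ball, dist_eq_norm] at hkd
  obtain ⟨w, hw, hwk⟩ := hznet k hk
  have h1 := hnsep w hw
  have h2 := (hbound (w - (ν + k))).1
  have h3 := (hbound (r • norProj M x n - k)).2
  have h4 := (hbound (v - ν)).2
  have h5 : 3 / 4 ≤ ⟪n, norProj M x n⟫ := by
    have e1 : norProj M x n = n - (norProj M z.1 - norProj M x) n := by
      rw [sub_apply, norProj_eq_self hnN]
      abel
    have e2 : ‖(norProj M z.1 - norProj M x) n‖ ≤ 1 / 4 := by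
      refine (ContinuousLinearMap.le_opNorm _ _).trans ?_
      rw [hn1, mul_one]
      exact hzproj.le
    have e3 := (hbound ((norProj M z.1 - norProj M x) n)).2
    rw [e1, inner_sub_right, real_inner_self_eq_norm_sq, hn1]
    linarith
  have h6 : ⟪n, r • norProj M x n⟫ = r * ⟪n, norProj M x n⟫ := inner_smul_right _ _ _
  simp only [inner_sub_right, inner_add_right] at h2 h3 h4
  rw [h6] at h3
  -- Going a length `r` along `n` gains at least `3r/4`, while the net, the nearby subgradient and
  -- `v - ν` each cost at most `r/8`.
  nlinarith

end Partial

/-! ### First and second order necessary conditions along the manifold -/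

section SecondOrder

variable {V : Type*} [NormedAddCommGroup V] [InnerProductSpace ℝ V] [FiniteDimensional ℝ V]
  {M : Set V}

theorem contDiffAt_sub_inner {e : V → ℝ} {x : V} (he : ContDiffAt ℝ 2 e x) (v : V) :
    ContDiffAt ℝ 2 (fun y => e y - ⟪v, y⟫) x :=
  he.sub (innerSL ℝ v).contDiff.contDiffAt

theorem gradient_sub_inner {e : V → ℝ} {x : V} (he : DifferentiableAt ℝ e x) (v : V) :
    gradient (fun y => e y - ⟪v, y⟫) x = gradient e x - v := by
  have h1 : HasFDerivAt (fun y : V => ⟪v, y⟫) (innerSL ℝ v) x := (innerSL ℝ v).hasFDerivAt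
  refine ext_inner_right ℝ fun w => ?_
  rw [inner_gradient, inner_sub_left, inner_gradient, (he.hasFDerivAt.fun_sub h1).fderiv]
  rfl

theorem eventually_le_of_mem_convexSubdiff {h : V → EReal} {x v : V} (hx : x ∈ M) {e : V → ℝ}
    (he : IsSmoothExtension M h x e) (hv : v ∈ convexSubdiff h x) :
    ∀ᶠ y in 𝓝[M] x, e x - ⟪v, x⟫ ≤ e y - ⟪v, y⟫ := by
  have h0 := he.2.self_of_nhdsWithin hx
  filter_upwards [he.2] with y hy
  have h1 := hv.2 y
  rw [h0, hy, ← EReal.coe_add, EReal.coe_le_coe_iff, inner_sub_right] at h1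
  linarith

/-- The tangential part of a subgradient is the Riemannian gradient. -/
theorem sub_gradient_mem_normalSpace {h : V → EReal} {x v : V} (hx : x ∈ M) {e : V → ℝ}
    (he : IsSmoothExtension M h x e) (hv : v ∈ convexSubdiff h x) :
    v - gradient e x ∈ normalSpace M x := by
  have h1 := gradient_mem_normalSpace
    ((contDiffAt_sub_inner he.1 v).differentiableAt (by norm_num))
    (eventually_le_of_mem_convexSubdiff hx he hv)
  rw [gradient_sub_inner (he.1.differentiableAt (by norm_num))] at h1
  rw [← neg_sub]
  exact Submodule.neg_mem _ h1

/-- A negative second derivative would make the point a local maximum too, so `r` would be locally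
constant. -/
theorem deriv_deriv_nonneg_of_isLocalMin {r : ℝ → ℝ} {x : ℝ} (hr : IsLocalMin r x)
    (hc : ContinuousAt r x) : 0 ≤ deriv (deriv r) x := by
  by_contra! hlt
  have hmax := isLocalMax_of_deriv_deriv_neg hlt hr.deriv_eq_zero hc
  have hconst : r =ᶠ[𝓝 x] fun _ => r x := by
    filter_upwards [hr, hmax] with y h1 h2 using le_antisymm h2 h1
  have h1 : deriv r =ᶠ[𝓝 x] fun _ => 0 := by
    filter_upwards [hconst.eventuallyEq_nhds] with y hy
    rw [hy.deriv_eq, deriv_const]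
  rw [h1.deriv_eq, deriv_const] at hlt
  exact lt_irrefl _ hlt

/-- Second order necessary condition along `M` for a subgradient. -/
theorem hess_add_weingarten_nonneg (hM : IsC2Submanifold M) {h : V → EReal} {x v : V} (hx : x ∈ M)
    {e : V → ℝ} (he : IsSmoothExtension M h x e) (hv : v ∈ convexSubdiff h x) {w : V}
    (hw : w ∈ tangentSpace M x) :
    0 ≤ ⟪fderiv ℝ (gradient e) x w, w⟫ + ⟪weingarten M x (gradient e x - v) w, w⟫ := by
  have hn : gradient e x - v ∈ normalSpace M x := by
    rw [← neg_sub]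
    exact Submodule.neg_mem _ (sub_gradient_mem_normalSpace hx he hv)
  have hmin := eventually_le_of_mem_convexSubdiff hx he hv
  have hgrad := gradient_sub_inner (he.1.differentiableAt (by norm_num)) v
  have hd := contDiffAt_sub_inner he.1 v
  have hD : fderiv ℝ (gradient fun y => e y - ⟪v, y⟫) x = fderiv ℝ (gradient e) x := by
    have h1 : (gradient fun y => e y - ⟪v, y⟫) =ᶠ[𝓝 x] fun y => gradient e y - v := by
      filter_upwards [he.1.eventually (by norm_num)] with y hy
      exact gradient_sub_inner (hy.differentiableAt (by norm_num)) v
    rw [h1.fderiv_eq, fderiv_sub_const]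
  set d : V → ℝ := fun y => e y - ⟪v, y⟫
  obtain ⟨c, T, hc, h0, rfl, hT, hid⟩ := exists_flatChart_at hM hx
  rw [hT] at hw
  have hwg := hc.inner_weingarten h0 T.zero_mem hn hw hw
  rw [hid] at hwg
  -- The second derivative at `0` of `t ↦ d(ψ(tw))` with `d = e - ⟨v, ·⟩`. The curvature of `ψ`
  -- pairs with the normal vector `∇e - v`, which gives the Weingarten term.
  have hsecond := hc.hasDerivAt_form h0 (ω := fderiv ℝ d)
    ((hd.fderiv_right (m := 1) (by norm_num)).differentiableAt (by norm_num)) w w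
  rw [hid] at hsecond
  simp only [ContinuousLinearMap.id_apply, zero_add] at hwg hsecond
  rw [← inner_fderiv_gradient hd, hD, ← inner_gradient, hgrad, ← hwg] at hsecond
  have hline : Tendsto (fun t : ℝ => t • w) (𝓝 0) (𝓝 0) := by
    have : Continuous (fun t : ℝ => t • w) := by fun_prop
    simpa using this.tendsto 0
  have hlineT : Tendsto (fun t : ℝ => t • w) (𝓝 0) (𝓝[T] 0) :=
    tendsto_nhdsWithin_iff.2 ⟨hline, Eventually.of_forall fun t => T.smul_mem _ hw⟩
  let r : ℝ → ℝ := fun t => d (c.symm (t • w))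
  have hfirst : ∀ᶠ t in 𝓝 (0 : ℝ), HasDerivAt r
      (fderiv ℝ d (c.symm (t • w)) (fderiv ℝ c.symm (t • w) w)) t := by
    have h1 : ∀ᶠ b in 𝓝 (0 : V), b ∈ c.target ∧ DifferentiableAt ℝ d (c.symm b) := by
      refine Filter.Eventually.and (c.open_target.mem_nhds h0) ?_
      filter_upwards [(hc.smooth_symm 0 h0).continuousAt.eventually
        (hd.eventually (by norm_num))] with b hb
      exact hb.differentiableAt (by norm_num)
    filter_upwards [hline.eventually h1] with t ht
    have h2 := ht.2.hasFDerivAt.comp (t • w) (hc.hasFDerivAt_symm ht.1)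
    have h3 : HasDerivAt (fun t : ℝ => t • w) w t := by
      simpa using (hasDerivAt_id t).smul_const w
    exact h2.comp_hasDerivAt t h3
  have hrmin : IsLocalMin r 0 := by
    have := ((hc.tendsto_symm h0).comp hlineT).eventually hmin
    filter_upwards [this] with t ht
    change d (c.symm ((0 : ℝ) • w)) ≤ d (c.symm (t • w))
    rw [zero_smul]
    exact ht
  have hdd := deriv_deriv_nonneg_of_isLocalMin hrmin hfirst.self_of_nhds.continuousAt
  have hderiv : deriv r =ᶠ[𝓝 0] fun t =>
      fderiv ℝ d (c.symm (t • w)) (fderiv ℝ c.symm (t • w) w) := by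
    filter_upwards [hfirst] with t ht using ht.deriv
  rwa [hderiv.deriv_eq, hsecond.deriv] at hdd

end SecondOrder

/-! ### Joint extensions and the prox point of a subgradient -/

section Prox

variable {V P : Type*}
  [NormedAddCommGroup V] [InnerProductSpace ℝ V] [FiniteDimensional ℝ V]
  [NormedAddCommGroup P] [InnerProductSpace ℝ P] [FiniteDimensional ℝ P]
  {g : V → P → EReal} {M : Set V} {Ω : Set P} {e : V → P → ℝ} {x : V} {u : P}

theorem contDiffAt_gradX (he : ContDiffAt ℝ 2 (fun z : V × P => e z.1 z.2) (x, u)) :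
    ContDiffAt ℝ 1 (fun z : V × P => gradX e z.1 z.2) (x, u) := by
  have h1 : ContDiffAt ℝ 1 (fun z : V × P => fderiv ℝ (fun y => e y z.2) z.1) (x, u) := by
    refine ContDiffAt.fderiv (n := 2) (f := fun (z : V × P) y => e y z.2) ?_ contDiffAt_fst
      (by norm_num)
    have h2 : ContDiffAt ℝ 2 (fun z : (V × P) × V => (z.2, z.1.2)) ((x, u), x) := by fun_prop
    exact he.comp ((x, u), x) h2
  exact (riesz V).contDiff.contDiffAt.comp _ h1

theorem hasFDerivAt_gradX (he : ContDiffAt ℝ 2 (fun z : V × P => e z.1 z.2) (x, u)) :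
    HasFDerivAt (fun z : V × P => gradX e z.1 z.2)
      (hessX e x u ∘L ContinuousLinearMap.fst ℝ V P
        + gradXU e x u ∘L ContinuousLinearMap.snd ℝ V P) (x, u) := by
  have h := ((contDiffAt_gradX he).differentiableAt (by norm_num)).hasFDerivAt
  set D := fderiv ℝ (fun z : V × P => gradX e z.1 z.2) (x, u)
  have h1 : HasFDerivAt (fun y => gradX e y u) (D ∘L ContinuousLinearMap.inl ℝ V P) x :=
    HasFDerivAt.comp (g := fun z : V × P => gradX e z.1 z.2) (f := fun y : V => (y, u)) x h
      (hasFDerivAt_prodMk_left x u)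
  have h2 : HasFDerivAt (fun u' => gradX e x u') (D ∘L ContinuousLinearMap.inr ℝ V P) u :=
    HasFDerivAt.comp (g := fun z : V × P => gradX e z.1 z.2) (f := fun u' : P => (x, u')) u h
      (hasFDerivAt_prodMk_right x u)
  have e1 : hessX e x u = D ∘L ContinuousLinearMap.inl ℝ V P := h1.fderiv
  have e2 : gradXU e x u = D ∘L ContinuousLinearMap.inr ℝ V P := h2.fderiv
  rw [e1, e2]
  refine h.congr_fderiv (ContinuousLinearMap.ext fun z => ?_)
  simp [← map_add]

theorem contDiffAt_slice (he : ContDiffAt ℝ 2 (fun z : V × P => e z.1 z.2) (x, u)) :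
    ContDiffAt ℝ 2 (fun y => e y u) x := by
  have h2 : ContDiffAt ℝ 2 (fun y : V => (y, u)) x := by fun_prop
  exact he.comp x h2

theorem inner_hessX_comm (he : ContDiffAt ℝ 2 (fun z : V × P => e z.1 z.2) (x, u)) (v w : V) :
    ⟪hessX e x u v, w⟫ = ⟪hessX e x u w, v⟫ :=
  inner_fderiv_gradient_comm (contDiffAt_slice he) v w

/-- `e` is a joint `C²` extension of `g` from `M × Ω` near `(x, u)`. -/
structure IsJointExtension (g : V → P → EReal) (M : Set V) (Ω : Set P) (e : V → P → ℝ) (x : V)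
    (u : P) : Prop where
  smooth : ContDiffAt ℝ 2 (fun z : V × P => e z.1 z.2) (x, u)
  eq : ∀ᶠ z in 𝓝[M ×ˢ Ω] (x, u), g z.1 z.2 = (e z.1 z.2 : EReal)

theorem IsJointExtension.eventually (h : IsJointExtension g M Ω e x u) :
    ∀ᶠ z in 𝓝[M ×ˢ Ω] (x, u), IsJointExtension g M Ω e z.1 z.2 := by
  filter_upwards [eventually_eventually_nhdsWithin.2 h.eq,
    mem_nhdsWithin_of_mem_nhds (h.smooth.eventually (by norm_num))] with z h1 h2
  exact ⟨h2, h1⟩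

theorem tendsto_prodMk_left (x : V) (hu : u ∈ Ω) :
    Tendsto (fun y : V => (y, u)) (𝓝[M] x) (𝓝[M ×ˢ Ω] (x, u)) := by
  refine tendsto_nhdsWithin_iff.2 ⟨?_, ?_⟩
  · exact ((Continuous.prodMk_left u).tendsto x).mono_left nhdsWithin_le_nhds
  · filter_upwards [self_mem_nhdsWithin] with y hy using ⟨hy, hu⟩

theorem IsJointExtension.isSmoothExtension (h : IsJointExtension g M Ω e x u) (hu : u ∈ Ω) :
    IsSmoothExtension M (fun y => g y u) x (fun y => e y u) :=
  ⟨contDiffAt_slice h.smooth, (tendsto_prodMk_left x hu).eventually h.eq⟩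

theorem exists_isJointExtension (hg : PartlySmooth (joint g) (prodSet M Ω)) (hx : x ∈ M)
    (hu : u ∈ Ω) : ∃ e, IsJointExtension g M Ω e x u := by
  obtain ⟨e, he1, he2⟩ := (hg.at_point (WithLp.toLp 2 (x, u)) ⟨hx, hu⟩).smooth
  refine ⟨fun y u' => e (WithLp.toLp 2 (y, u')), ?_, ?_⟩
  · let L := (WithLp.prodContinuousLinearEquiv 2 ℝ V P).symm
    have h1 : ContDiffAt ℝ 2 (fun z : V × P => L z) (x, u) := L.contDiff.contDiffAt
    exact ContDiffAt.comp (g := e) (x, u) he1 h1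
  · have h2 : Tendsto (fun z : V × P => WithLp.toLp 2 z) (𝓝[M ×ˢ Ω] (x, u))
        (𝓝[prodSet M Ω] (WithLp.toLp 2 (x, u))) := by
      refine tendsto_nhdsWithin_iff.2 ⟨?_, ?_⟩
      · exact ((WithLp.prod_continuous_toLp 2 V P).tendsto (x, u)).mono_left nhdsWithin_le_nhds
      · filter_upwards [self_mem_nhdsWithin] with z hz using hz
    exact h2.eventually he2

/-- The subgradient inequality makes the prox objective at `y` exceed its value at `p` by at least
`‖y - p‖²/2`. So `p` is the only minimizer, and the choice in `prox` must return it. -/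
theorem prox_eq {α : ℝ} (hα : 0 < α) {p v : V} {t : ℝ} (ht : g p u = t)
    (hv : v ∈ convexSubdiff (fun y => g y u) p) : prox α g (p + α • v) u = p := by
  have key : ∀ y : V, ∀ b : ℝ, g y u = b →
      α * t + ‖p - (p + α • v)‖ ^ 2 / 2 + ‖y - p‖ ^ 2 / 2 ≤ α * b + ‖y - (p + α • v)‖ ^ 2 / 2 := by
    intro y b hb
    have h1 := hv.2 y
    simp only [ht, hb] at h1
    rw [← EReal.coe_add, EReal.coe_le_coe_iff] at h1
    have h2 : y - (p + α • v) = (y - p) - α • v := by abel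
    have h3 : p - (p + α • v) = -(α • v) := by abel
    rw [h2, h3, norm_neg, norm_sub_sq_real (y - p), inner_smul_right, real_inner_comm]
    nlinarith
  have hnb : ∀ y, g y u ≠ ⊥ := fun y hy => by
    have h1 := hv.2 y
    simp only [ht, hy] at h1
    rw [← EReal.coe_add, le_bot_iff] at h1
    exact EReal.coe_ne_bot _ h1
  have hp : IsProxPoint α g (p + α • v) u p := fun y => by
    by_cases htop : g y u = ⊤
    · rw [htop, EReal.coe_mul_top_of_pos hα, EReal.top_add_coe]
      exact le_top
    · have hb := (EReal.coe_toReal htop (hnb y)).symm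
      have := key y _ hb
      rw [hb, ht]
      norm_cast
      nlinarith [sq_nonneg ‖y - p‖]
  have H : ∃ q, IsProxPoint α g (p + α • v) u q := ⟨p, hp⟩
  rw [prox, dif_pos H]
  have hq := H.choose_spec p
  set q := H.choose
  have htop : g q u ≠ ⊤ := fun htop => by
    rw [htop, EReal.coe_mul_top_of_pos hα, EReal.top_add_coe, ht, ← EReal.coe_mul,
      ← EReal.coe_add, top_le_iff] at hq
    exact EReal.coe_ne_top _ hq
  have hb := (EReal.coe_toReal htop (hnb q)).symm
  have h1 := key q _ hb
  rw [hb, ht] at hq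
  norm_cast at hq
  have h2 : ‖q - p‖ = 0 := by nlinarith [norm_nonneg (q - p)]
  exact sub_eq_zero.1 (norm_eq_zero.1 h2)

end Prox

/-! ### Differentiability of the proximal map -/

section Prox

variable {V P : Type*}
  [NormedAddCommGroup V] [InnerProductSpace ℝ V] [FiniteDimensional ℝ V]
  [NormedAddCommGroup P] [InnerProductSpace ℝ P] [FiniteDimensional ℝ P]
  {g : V → P → EReal} {M : Set V} {Ω : Set P} {e : V → P → ℝ} {x : V} {u : P}

/-- The proximal map is differentiable at `(x + α ν, u)` for a nondegenerate partial subgradient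
`ν` at `x ∈ M`, and its derivative solves the linearized optimality condition on `M`. -/
theorem exists_hasFDerivAt_prox (hM : IsC2Submanifold M) (hΩ : IsOpen Ω)
    (hx : x ∈ M) (hu : u ∈ Ω)
    (he : IsJointExtension g M Ω e x u) {ν : V} (hν : ν ∈ convexSubdiff (fun y => g y u) x)
    (hnd : ∃ ε > 0, ∀ᶠ z in 𝓝[M ×ˢ Ω] (x, u), ∀ v, ‖v - ν‖ < ε →
      v - gradX e z.1 z.2 ∈ normalSpace M z.1 → v ∈ convexSubdiff (fun y => g y z.2) z.1)
    {α : ℝ} (hα : 0 < α) :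
    ∃ D : V × P →L[ℝ] V, HasFDerivAt (fun q : V × P => prox α g q.1 q.2) D (x + α • ν, u) ∧
      ∀ q : V × P, D q ∈ tangentSpace M x ∧ ∀ w ∈ tangentSpace M x,
        ⟪D q, w⟫ + α * (⟪hessX e x u (D q), w⟫
          + ⟪weingarten M x (gradX e x u - ν) (D q), w⟫) + α * ⟪gradXU e x u q.2, w⟫
        = ⟪q.1, w⟫ := by
  have hext := he.isSmoothExtension hu
  have hn : gradX e x u - ν ∈ normalSpace M x := by
    rw [← neg_sub]
    exact Submodule.neg_mem _ (sub_gradient_mem_normalSpace hx hext hν)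
  have hpsd : ∀ w ∈ tangentSpace M x,
      0 ≤ ⟪hessX e x u w, w⟫ + ⟪weingarten M x (gradX e x u - ν) w, w⟫ :=
    fun w hw => hess_add_weingarten_nonneg hM hx hext hν hw
  obtain ⟨c, T, hc, h0, hcx, hT, hid⟩ := exists_flatChart_at hM hx
  have hcT : ∀ v ∈ T, ∀ w ∈ T, ⟪weingarten M x (gradX e x u - ν) v, w⟫ =
      ⟪gradX e x u - ν, fderiv ℝ (fderiv ℝ c.symm) 0 v w⟫ := fun v hv w hw => by
    have h1 := hc.inner_weingarten h0 T.zero_mem (n := gradX e x u - ν) (by rwa [hcx]) hv hw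
    rwa [hcx, hid] at h1
  rw [hT] at hpsd ⊢
  set q₀ : V × P := (x + α • ν, u) with hq₀
  -- the optimality condition in coordinates
  let l : (V × P) × T → V := fun p =>
    α • gradX e (c.symm p.2) p.1.2 + c.symm p.2 - p.1.1
  let m : (V × P) × T → T →L[ℝ] V := fun p => fderiv ℝ c.symm p.2 ∘L T.subtypeL
  let Φ : (V × P) × T → T := fun p => riesz T (innerSL ℝ (l p) ∘L m p)
  have hΦ : ∀ p w, ⟪Φ p, w⟫ = ⟪l p, fderiv ℝ c.symm p.2 w⟫ := fun p w => inner_riesz _ _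
  let b := fderiv ℝ (fderiv ℝ c.symm) 0
  have hψ : HasFDerivAt c.symm (ContinuousLinearMap.id ℝ V) 0 := hid ▸ hc.hasFDerivAt_symm h0
  let sn := ContinuousLinearMap.snd ℝ (V × P) T
  let fs := ContinuousLinearMap.fst ℝ (V × P) T
  have hsnd : HasFDerivAt (fun p : (V × P) × T => (p.2 : V)) (T.subtypeL ∘L sn) (q₀, 0) :=
    (T.subtypeL ∘L sn).hasFDerivAt
  have hψ' : HasFDerivAt (fun p : (V × P) × T => c.symm p.2) (T.subtypeL ∘L sn) (q₀, 0) :=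
    HasFDerivAt.comp (g := c.symm) (f := fun p : (V × P) × T => (p.2 : V)) (q₀, 0) hψ hsnd
  have hgr : HasFDerivAt (fun p : (V × P) × T => gradX e (c.symm p.2) p.1.2)
      (hessX e x u ∘L T.subtypeL ∘L sn
        + gradXU e x u ∘L ContinuousLinearMap.snd ℝ V P ∘L fs) (q₀, 0) := by
    have h1 : HasFDerivAt (fun p : (V × P) × T => (c.symm p.2, p.1.2))
        ((T.subtypeL ∘L sn).prod (ContinuousLinearMap.snd ℝ V P ∘L fs)) (q₀, 0) :=
      hψ'.prodMk (ContinuousLinearMap.snd ℝ V P ∘L fs).hasFDerivAt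
    have h2 := hasFDerivAt_gradX he.smooth
    have h3 : (x, u) = (fun p : (V × P) × T => (c.symm p.2, p.1.2)) (q₀, 0) := by simp [hcx, hq₀]
    rw [h3] at h2
    exact HasFDerivAt.comp (g := fun z : V × P => gradX e z.1 z.2) (q₀, 0) h2 h1
  have hl : HasFDerivAt l (α • (hessX e x u ∘L T.subtypeL ∘L sn
        + gradXU e x u ∘L ContinuousLinearMap.snd ℝ V P ∘L fs) + T.subtypeL ∘L sn
        - ContinuousLinearMap.fst ℝ V P ∘L fs) (q₀, 0) :=
    ((hgr.const_smul α).add hψ').sub (ContinuousLinearMap.fst ℝ V P ∘L fs).hasFDerivAt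
  have hl0 : l (q₀, 0) = α • (gradX e x u - ν) := by
    simp only [l, hq₀, Submodule.coe_zero, hcx, smul_sub]
    abel
  have hm (w : T) : HasFDerivAt (fun p : (V × P) × T => fderiv ℝ c.symm p.2 (w : V))
      (b.flip w ∘L T.subtypeL ∘L sn) (q₀, 0) := by
    have h1 : HasFDerivAt (fun a => fderiv ℝ c.symm a (w : V)) (b.flip w) 0 := by
      have := (hc.hasFDerivAt_fderiv_symm h0).clm_apply (hasFDerivAt_const (w : V) 0)
      convert this using 1
      ext; simp [b]
    exact HasFDerivAt.comp (g := fun a => fderiv ℝ c.symm a (w : V))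
      (f := fun p : (V × P) × T => (p.2 : V)) (q₀, 0) h1 hsnd
  have hΦc : ContDiffAt ℝ 1 Φ (q₀, 0) := by
    have hs : ContDiffAt ℝ 1 (fun p : (V × P) × T => (p.2 : V)) (q₀, 0) :=
      (T.subtypeL ∘L sn).contDiff.contDiffAt
    have h1 : ContDiffAt ℝ 1 (fun p : (V × P) × T => c.symm p.2) (q₀, 0) :=
      ContDiffAt.comp (g := c.symm) (q₀, 0) ((hc.smooth_symm 0 h0).of_le (by norm_num)) hs
    have h2 : ContDiffAt ℝ 1 m (q₀, 0) :=
      (ContDiffAt.comp (g := fderiv ℝ c.symm) (q₀, 0) (hc.contDiffAt_fderiv_symm h0) hs).clm_comp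
        contDiffAt_const
    have h3 : ContDiffAt ℝ 1 (fun p : (V × P) × T => p.1.2) (q₀, 0) := by fun_prop
    have h4 : ContDiffAt ℝ 1 (fun p : (V × P) × T => p.1.1) (q₀, 0) := by fun_prop
    have h5 : ContDiffAt ℝ 1 (fun p : (V × P) × T => gradX e (c.symm p.2) p.1.2) (q₀, 0) := by
      refine ContDiffAt.comp (g := fun z : V × P => gradX e z.1 z.2)
        (f := fun p : (V × P) × T => (c.symm p.2, p.1.2)) (q₀, 0) ?_ (h1.prodMk h3)
      simp only [Submodule.coe_zero, hcx, hq₀]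
      exact contDiffAt_gradX he.smooth
    have h6 : ContDiffAt ℝ 1 l (q₀, 0) := ((h5.const_smul α).add h1).sub h4
    exact (riesz T).contDiff.contDiffAt.comp _
      (((innerSL ℝ : V →L[ℝ] V →L[ℝ] ℝ).contDiff.contDiffAt.comp _ h6).clm_comp h2)
  have hstrict := hΦc.hasStrictFDerivAt (by norm_num)
  set D₀ := fderiv ℝ Φ (q₀, 0)
  -- By the product rule, the derivative of the chart frame is paired with `l (q₀, 0) = α(∇e - ν)`.
  -- This vector is normal, so the pairing is the Weingarten form.
  have hD₀ : ∀ p w, ⟪D₀ p, w⟫ = ⟪α • (hessX e x u p.2 + gradXU e x u p.1.2) + (p.2 : V) - p.1.1,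
      (w : V)⟫ + α * ⟪weingarten M x (gradX e x u - ν) p.2, (w : V)⟫ := by
    intro p w
    have h1 : HasFDerivAt (fun p => ⟪Φ p, w⟫) _ (q₀, 0) :=
      hstrict.hasFDerivAt.inner ℝ (hasFDerivAt_const w (q₀, 0))
    have h2 : HasFDerivAt (fun p : (V × P) × T => ⟪l p, fderiv ℝ c.symm p.2 w⟫) _ (q₀, 0) :=
      hl.inner ℝ (hm w)
    simp_rw [hΦ] at h1
    have h3 := DFunLike.congr_fun (h1.unique h2) p
    have h4 := hcT _ p.2.2 _ w.2
    simp only [fderivInnerCLM_apply, ContinuousLinearMap.comp_apply,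
      ContinuousLinearMap.prod_apply, zero_apply, inner_zero_right, zero_add,
      hl0, ContinuousLinearMap.flip_apply, Submodule.coe_zero, hid,
      ContinuousLinearMap.id_apply] at h3
    rw [h3, h4, inner_smul_left, conj_trivial, add_comm]
    rfl
  -- The partial derivative in `T` has quadratic form `‖a‖²` plus `α` times the nonnegative form
  -- `hpsd`, so it is coercive.
  have hker : Function.Injective (D₀ ∘L ContinuousLinearMap.inr ℝ (V × P) T) := by
    refine (injective_iff_map_eq_zero _).2 fun a ha => ?_
    have h1 := hD₀ (0, a) a
    have h2 : D₀ (0, a) = 0 := ha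
    rw [h2, inner_zero_left] at h1
    simp only [Prod.snd_zero, map_zero, add_zero, Prod.fst_zero, sub_zero, inner_add_left,
      inner_smul_left, conj_trivial] at h1
    have h3 := mul_nonneg hα.le (hpsd a a.2)
    have h4 : ⟪(a : V), (a : V)⟫ ≤ 0 := by linarith
    exact Subtype.ext (inner_self_eq_zero.1 (le_antisymm h4 real_inner_self_nonneg))
  have hinv : (D₀ ∘L ContinuousLinearMap.inr ℝ (V × P) T).IsInvertible :=
    ⟨(LinearEquiv.ofInjectiveEndo (D₀ ∘L ContinuousLinearMap.inr ℝ (V × P) T).toLinearMap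
      hker).toContinuousLinearEquiv, by ext; rfl⟩
  have hΦ0 : Φ (q₀, 0) = 0 := by
    refine ext_inner_right ℝ fun w => ?_
    rw [hΦ, hl0, inner_zero_left, Submodule.coe_zero, hid, inner_smul_left]
    rw [inner_eq_zero_of_mem_normalSpace hn (hT ▸ w.2), mul_zero]
  let ζ := hstrict.implicitFunctionOfProdDomain hinv
  have hζ0 : ζ q₀ = 0 :=
    (hstrict.eventually_apply_eq_iff_implicitFunctionOfProdDomain hinv).self_of_nhds.1 rfl
  have hζeq : ∀ᶠ q in 𝓝 q₀, Φ (q, ζ q) = 0 := by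
    have := hstrict.eventually_apply_implicitFunctionOfProdDomain hinv
    rwa [hΦ0] at this
  have hζ' := (hstrict.hasStrictFDerivAt_implicitFunctionOfProdDomain hinv).hasFDerivAt
  set Z := -(D₀ ∘L ContinuousLinearMap.inr ℝ (V × P) T).inverse ∘L
    (D₀ ∘L ContinuousLinearMap.inl ℝ (V × P) T)
  have hZ : ∀ q, D₀ (q, Z q) = 0 := by
    intro q
    have h1 : HasFDerivAt (fun q => (q, ζ q)) ((ContinuousLinearMap.id ℝ (V × P)).prod Z) q₀ :=
      (hasFDerivAt_id q₀).prodMk hζ'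
    have h2 : HasFDerivAt Φ D₀ (q₀, ζ q₀) := by
      rw [hζ0]
      exact hstrict.hasFDerivAt
    have h3 := HasFDerivAt.comp (g := Φ) (f := fun q => (q, ζ q)) q₀ h2 h1
    have h4 := h3.unique ((hasFDerivAt_const (0 : T) q₀).congr_of_eventuallyEq hζeq)
    exact DFunLike.congr_fun h4 q
  have hp' : HasFDerivAt (fun q => c.symm (ζ q : V)) (T.subtypeL ∘L Z) q₀ := by
    have h1 : HasFDerivAt (fun q => (ζ q : V)) (T.subtypeL ∘L Z) q₀ :=
      T.subtypeL.hasFDerivAt.comp q₀ hζ'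
    have h2 : HasFDerivAt c.symm (ContinuousLinearMap.id ℝ V) (ζ q₀ : V) := by
      rw [hζ0]
      exact hψ
    exact HasFDerivAt.comp (g := c.symm) (f := fun q => (ζ q : V)) q₀ h2 h1
  have hp0 : c.symm (ζ q₀ : V) = x := by rw [hζ0, Submodule.coe_zero, hcx]
  -- Stationarity of `p` on `M` says that `(q.1 - p)/α` has the tangential part of `∇e`. It is close
  -- to `ν`, so `hnd` makes it a genuine subgradient at `p`, and `p` is the prox point of `q.1`.
  have hprox : (fun q : V × P => prox α g q.1 q.2) =ᶠ[𝓝 q₀] fun q => c.symm (ζ q : V) := by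
    obtain ⟨ε, hε, hnd⟩ := hnd
    have htar : ∀ᶠ q in 𝓝 q₀, (ζ q : V) ∈ c.target := by
      have : ContinuousAt (fun q => (ζ q : V)) q₀ :=
        continuous_subtype_val.continuousAt.comp hζ'.continuousAt
      refine this.eventually ?_
      simp only [hζ0]
      exact c.open_target.mem_nhds h0
    have hΩev : ∀ᶠ q : V × P in 𝓝 q₀, q.2 ∈ Ω :=
      continuous_snd.continuousAt.eventually (hΩ.mem_nhds hu)
    have hpt : Tendsto (fun q => (c.symm (ζ q : V), q.2)) (𝓝 q₀) (𝓝[M ×ˢ Ω] (x, u)) := by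
      refine tendsto_nhdsWithin_iff.2 ⟨?_, ?_⟩
      · have h1 := hp'.continuousAt.tendsto
        rw [hp0] at h1
        exact h1.prodMk_nhds (continuous_snd.tendsto q₀)
      · filter_upwards [htar, hΩev] with q hq1 hq2
        exact ⟨hc.symm_mem hq1 (ζ q).2, hq2⟩
    have hvt : ∀ᶠ q : V × P in 𝓝 q₀, ‖α⁻¹ • (q.1 - c.symm (ζ q : V)) - ν‖ < ε := by
      have h1 := (((continuous_fst.tendsto q₀).sub hp'.continuousAt.tendsto).const_smul
        α⁻¹).sub_const ν |>.norm
      refine h1.eventually_lt_const ?_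
      rw [hp0, hq₀]
      simpa [smul_smul, inv_mul_cancel₀ hα.ne'] using hε
    filter_upwards [htar, hpt.eventually hnd, hpt.eventually he.eq, hvt, hζeq]
      with q hq1 hq2 hq3 hq4 hq5
    set p := c.symm (ζ q : V)
    have hnor : α • gradX e p q.2 + p - q.1 ∈ normalSpace M p := by
      refine mem_normalSpace_iff.2 fun w hw => ?_
      obtain ⟨t, ht, rfl⟩ := hc.exists_of_mem_tangentSpace hq1 (ζ q).2 hw
      have := hΦ (q, ζ q) ⟨t, ht⟩
      rw [hq5, inner_zero_left] at this
      exact this.symm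
    have hsub := hq2 (α⁻¹ • (q.1 - p)) hq4 (by
      have h1 := Submodule.smul_mem _ (-α⁻¹) hnor
      have h2 : -α⁻¹ • (α • gradX e p q.2 + p - q.1) =
          α⁻¹ • (q.1 - p) - α⁻¹ • α • gradX e p q.2 := by module
      rwa [h2, inv_smul_smul₀ hα.ne'] at h1)
    have h2 := prox_eq hα hq3 hsub
    rw [smul_smul, mul_inv_cancel₀ hα.ne', one_smul, add_sub_cancel] at h2
    exact h2
  refine ⟨T.subtypeL ∘L Z, hp'.congr_of_eventuallyEq hprox, fun q => ⟨(Z q).2, fun w hw => ?_⟩⟩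
  have h1 := hD₀ (q, Z q) ⟨w, hw⟩
  rw [hZ, inner_zero_left] at h1
  simp only [inner_add_left, inner_sub_left, inner_smul_left, conj_trivial] at h1
  change ⟪(Z q : V), w⟫ + α * (⟪hessX e x u (Z q), w⟫
    + ⟪weingarten M x (gradX e x u - ν) (Z q), w⟫) + α * ⟪gradXU e x u q.2, w⟫ = ⟪q.1, w⟫
  linarith

end Prox

/-! ### Scalar two-term recursions -/

section Recursion

/-- The Schur–Cohn criterion for quadratic polynomials. -/
theorem norm_lt_one_of_root {p q : ℝ} (hq : q < 1) (h1 : 0 < 1 - p + q)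
    (h2 : 0 < 1 + p + q) {r : ℂ} (hr : r ^ 2 - p * r + q = 0) : ‖r‖ < 1 := by
  have him := congrArg Complex.im hr
  have hre := congrArg Complex.re hr
  simp [sq] at him hre
  rw [← sq_lt_one_iff₀ (norm_nonneg r), ← Complex.normSq_eq_norm_sq, Complex.normSq_apply]
  set a := r.re
  set b := r.im
  by_cases hb : b = 0
  · rw [hb] at hre ⊢
    have hroot : a * a - p * a + q = 0 := by linarith
    have hl : a < 1 := by
      by_contra! hle
      nlinarith
    have hg : -1 < a := by
      by_contra! hle
      nlinarith
    nlinarith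
  -- A nonreal root has real part `p / 2` and squared modulus `q`.
  · have : b * (2 * a - p) = 0 := by linarith
    have hp : p = 2 * a := by
      rcases mul_eq_zero.1 this with h | h
      · exact absurd h hb
      · linarith
    rw [hp] at hre
    nlinarith

/-- The differences `a (k + 1) - r₁ a k` are geometric with ratio `r₂`, so `a` is bounded by
multiples of `ρ ^ k` and `k ρ ^ k`. The factor `k` covers a double root without a case distinction.
-/
theorem tendsto_zero_of_linear_recursion {r₁ r₂ : ℂ} (h1 : ‖r₁‖ < 1) (h2 : ‖r₂‖ < 1) {a : ℕ → ℂ}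
    (ha : ∀ k, a (k + 2) = (r₁ + r₂) * a (k + 1) - r₁ * r₂ * a k) : Tendsto a atTop (𝓝 0) := by
  obtain ⟨ρ, hρ, hρ1⟩ := exists_between (max_lt (max_lt h1 h2) (zero_lt_one (α := ℝ)))
  have hρ0 : 0 < ρ := (le_max_right _ _).trans_lt hρ
  have hr1 : ‖r₁‖ ≤ ρ := ((le_max_left _ _).trans ((le_max_left _ _).trans hρ.le))
  have hr2 : ‖r₂‖ ≤ ρ := ((le_max_right _ _).trans ((le_max_left _ _).trans hρ.le))
  set d : ℂ := a 1 - r₁ * a 0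
  have hd : ∀ k, a (k + 1) = r₁ * a k + r₂ ^ k * d := fun k => by
    induction k with
    | zero => simp [d]
    | succ k ih =>
      rw [ha, ih]
      ring
  have hbound : ∀ k : ℕ, ‖a k‖ ≤ ρ ^ k * ‖a 0‖ + (k * ρ ^ k) * (‖d‖ / ρ) := fun k => by
    induction k with
    | zero => simp
    | succ k ih =>
      rw [hd]
      calc ‖r₁ * a k + r₂ ^ k * d‖ ≤ ‖r₁‖ * ‖a k‖ + ‖r₂‖ ^ k * ‖d‖ := by
            refine (norm_add_le _ _).trans ?_
            rw [norm_mul, norm_mul, norm_pow]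
        _ ≤ ρ * (ρ ^ k * ‖a 0‖ + (k * ρ ^ k) * (‖d‖ / ρ)) + ρ ^ k * ‖d‖ := by gcongr
        _ = _ := by
            push_cast
            field_simp
            ring
  refine squeeze_zero_norm hbound ?_
  have e1 : Tendsto (fun k => ρ ^ k * ‖a 0‖) atTop (𝓝 0) := by
    simpa using (tendsto_pow_atTop_nhds_zero_of_lt_one hρ0.le hρ1).mul_const ‖a 0‖
  have e2 : Tendsto (fun k : ℕ => (k * ρ ^ k) * (‖d‖ / ρ)) atTop (𝓝 0) := by
    simpa using (tendsto_self_mul_const_pow_of_lt_one hρ0.le hρ1).mul_const (‖d‖ / ρ)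
  simpa using e1.add e2

/-- The characteristic polynomial has `p = μ(1 + β)` and `q = μβ`. The Schur–Cohn quantities are `1
- p + q = 1 - μ` and `1 + p + q = 1 + μ(1 + 2β)`, whence the bound `-1/(1 + 2β)`. -/
theorem tendsto_zero_of_inertial_recursion {β μ : ℝ} (hβ0 : 0 ≤ β) (hβ1 : β ≤ 1)
    (hμ : -1 / (1 + 2 * β) < μ) (hμ1 : μ < 1) {a : ℕ → ℝ}
    (ha : ∀ k, a (k + 2) = μ * ((1 + β) * a (k + 1) - β * a k)) : Tendsto a atTop (𝓝 0) := by
  rw [div_lt_iff₀ (by positivity)] at hμ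
  set p : ℝ := μ * (1 + β)
  set q : ℝ := μ * β
  obtain ⟨s, hs⟩ := IsAlgClosed.exists_pow_nat_eq ((p : ℂ) ^ 2 - 4 * q) (n := 2) (by norm_num)
  have hμ2 : -1 < μ := by nlinarith
  have hroot : ∀ r : ℂ, r ^ 2 - p * r + q = 0 → ‖r‖ < 1 := fun r hr =>
    norm_lt_one_of_root (p := p) (q := q) (by simp only [q]; nlinarith)
      (by simp only [p, q]; linarith)
      (by simp only [p, q]; linarith) hr
  have h1 := hroot ((p + s) / 2) (by linear_combination hs / 4)
  have h2 := hroot ((p - s) / 2) (by linear_combination hs / 4)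
  have h3 := tendsto_zero_of_linear_recursion (a := fun k => (a k : ℂ)) h1 h2 (fun k => by
    have e1 : ((p : ℂ) + s) / 2 + (p - s) / 2 = p := by ring
    have e2 : ((p : ℂ) + s) / 2 * ((p - s) / 2) = q := by linear_combination -hs / 4
    rw [e1, e2]
    simp only [p, q]
    rw [ha]
    push_cast
    ring)
  have h4 := (Complex.continuous_re.tendsto 0).comp h3
  simpa [Function.comp_def] using h4

end Recursion

/-! ### Operators self-adjoint for a positive definite form -/

section Diagonalization

/-- Diagonalization of an operator that is symmetric with respect to a positive definite form. -/
theorem exists_basis_diagonalizing {E : Type*} [AddCommGroup E] [Module ℝ E] [FiniteDimensional ℝ E]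
    (q : E →ₗ[ℝ] E →ₗ[ℝ] ℝ) (hsymm : ∀ v w, q v w = q w v) (hpos : ∀ v, v ≠ 0 → 0 < q v v)
    (B : E →ₗ[ℝ] E) (hB : ∀ v w, q (B v) w = q v (B w)) :
    ∃ (b : Module.Basis (Fin (Module.finrank ℝ E)) ℝ E) (μ : Fin (Module.finrank ℝ E) → ℝ),
      (∀ i, B (b i) = μ i • b i) ∧ (∀ v i, b.repr (B v) i = μ i * b.repr v i) ∧
      ∀ v w, q v w = ∑ i, b.repr v i * b.repr w i := by
  -- The form `q` serves as a new inner product, so the spectral theorem gives a `q`-orthonormal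
  -- eigenbasis.
  let core : InnerProductSpace.Core ℝ E :=
    { inner := fun v w => q v w
      conj_inner_symm := fun v w => hsymm w v
      re_inner_nonneg := fun v => by
        by_cases hv : v = 0
        · simp [hv]
        · exact (hpos v hv).le
      add_left := fun u v w => by simp
      smul_left := fun u v r => by simp
      definite := fun v hv => by
        by_contra hne
        exact (hpos v hne).ne' hv }
  let _ : NormedAddCommGroup E := core.toNormedAddCommGroup
  let _ : InnerProductSpace ℝ E := InnerProductSpace.ofCore core.toCore
  have hS : B.IsSymmetric := fun v w => hB v w
  let ob := hS.eigenvectorBasis rfl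
  have hrepr : ∀ v i, ob.toBasis.repr v i = ob.repr v i := fun v i => rfl
  refine ⟨ob.toBasis, hS.eigenvalues rfl, fun i => ?_, fun v i => ?_, fun v w => ?_⟩
  · rw [OrthonormalBasis.coe_toBasis]
    exact hS.apply_eigenvectorBasis rfl i
  · exact hS.eigenvectorBasis_apply_self_apply rfl v i
  · have h1 : q v w = inner ℝ v w := rfl
    rw [h1, ← ob.repr.inner_map_map v w, PiLp.inner_apply]
    refine Finset.sum_congr rfl fun i _ => ?_
    rw [hrepr, hrepr]
    simp [mul_comm]

variable {E : Type*} [NormedAddCommGroup E] [NormedSpace ℝ E] [FiniteDimensional ℝ E]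

/-- In an eigenbasis the recursion decouples. The two form inequalities, tested on eigenvectors,
place the eigenvalues in `(-1/(1 + 2β), 1)`. -/
theorem tendsto_zero_of_symmetric_recursion
    (q : E →ₗ[ℝ] E →ₗ[ℝ] ℝ) (hsymm : ∀ v w, q v w = q w v) (hpos : ∀ v, v ≠ 0 → 0 < q v v)
    (B : E →ₗ[ℝ] E) (hB : ∀ v w, q (B v) w = q v (B w))
    {β : ℝ} (hβ0 : 0 ≤ β) (hβ1 : β ≤ 1)
    (hlt : ∀ v, v ≠ 0 → q (B v) v < q v v)
    (hgt : ∀ v, v ≠ 0 → 0 < q (B v) v + 1 / (1 + 2 * β) * q v v) {a : ℕ → E}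
    (ha : ∀ k, a (k + 2) = B ((1 + β) • a (k + 1) - β • a k)) : Tendsto a atTop (𝓝 0) := by
  obtain ⟨b, μ, hb, hrepr, -⟩ := exists_basis_diagonalizing q hsymm hpos B hB
  have hcoord : ∀ i, Tendsto (fun k => b.repr (a k) i) atTop (𝓝 0) := fun i => by
    have hqi := hpos (b i) (b.ne_zero i)
    have h1 := hlt (b i) (b.ne_zero i)
    have h2 := hgt (b i) (b.ne_zero i)
    rw [hb, map_smul, LinearMap.smul_apply, smul_eq_mul] at h1 h2
    refine tendsto_zero_of_inertial_recursion hβ0 hβ1 (μ := μ i) ?_ ?_ fun k => ?_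
    · rw [← add_mul] at h2
      have := pos_of_mul_pos_left h2 hqi.le
      rw [neg_div]
      linarith
    · by_contra! hle
      nlinarith
    · rw [ha, hrepr]
      simp
  have h1 : Tendsto (fun k => ∑ i, b.repr (a k) i • b i) atTop (𝓝 (∑ i, (0 : ℝ) • b i)) :=
    tendsto_finsetSum _ fun i _ => (hcoord i).smul_const (b i)
  simpa [b.sum_repr] using h1

/-- In `q`-orthonormal eigencoordinates the form is `∑ (μ i + κ) c_i²`. Passing from eigenvalues to
a form is what allows the bound to be carried to nearby points. -/
theorem pos_of_eigenvalues_gt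
    (q : E →ₗ[ℝ] E →ₗ[ℝ] ℝ) (hsymm : ∀ v w, q v w = q w v) (hpos : ∀ v, v ≠ 0 → 0 < q v v)
    (B : E →ₗ[ℝ] E) (hB : ∀ v w, q (B v) w = q v (B w))
    {κ : ℝ}
    (hev : ∀ (μ : ℝ) (v : E), v ≠ 0 → B v = μ • v → -κ < μ) (v : E) (hv : v ≠ 0) :
    0 < q (B v) v + κ * q v v := by
  obtain ⟨b, μ, hb, hrepr, hq⟩ := exists_basis_diagonalizing q hsymm hpos B hB
  have hμ : ∀ i, 0 < μ i + κ := fun i => by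
    have := hev (μ i) (b i) (b.ne_zero i) (hb i)
    linarith
  rw [hq, hq, Finset.mul_sum, ← Finset.sum_add_distrib]
  have hterm : ∀ i, b.repr (B v) i * b.repr v i + κ * (b.repr v i * b.repr v i) =
      (μ i + κ) * (b.repr v i) ^ 2 := fun i => by
    rw [hrepr]
    ring
  simp_rw [hterm]
  obtain ⟨i, hi⟩ : ∃ i, b.repr v i ≠ 0 := by
    by_contra! h0
    exact hv (b.repr.map_eq_zero_iff.1 (Finsupp.ext h0))
  refine Finset.sum_pos' (fun i _ => mul_nonneg (hμ i).le (sq_nonneg _)) ⟨i, Finset.mem_univ _, ?_⟩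
  have := hμ i
  positivity

end Diagonalization

/-! ### The Moore–Penrose pseudoinverse -/

section Pinv

variable {V : Type*} [NormedAddCommGroup V] [InnerProductSpace ℝ V] [FiniteDimensional ℝ V]

/-- `A` plus the projection onto `Kᗮ` is injective, hence invertible; its inverse after the
projection onto `K` satisfies the Penrose equations. -/
theorem exists_isPseudoinverse {A : V →L[ℝ] V} {K : Submodule ℝ V} (hAK : ∀ v, A v ∈ K)
    (hA : ∀ v, A (K.starProjection v) = A v) (hpos : PosDefOn A K) :
    ∃ B, IsPseudoinverse A B ∧ (∀ v, A (B v) = K.starProjection v) ∧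
      ∀ v, B (A v) = K.starProjection v := by
  have hinjK : ∀ v ∈ K, A v = 0 → v = 0 := fun v hv h => by
    by_contra hne
    have := hpos v hv hne
    rw [h, inner_zero_left] at this
    exact lt_irrefl _ this
  let A' : V →L[ℝ] V := A + Kᗮ.starProjection
  have hsplit : ∀ v, ∀ k ∈ K, A' v = k → v ∈ K ∧ A v = k := fun v k hk h => by
    have h1 : Kᗮ.starProjection v = k - A v := by
      rw [← h]
      simp [A']
    have h2 : Kᗮ.starProjection v = 0 := by
      have h3 : Kᗮ.starProjection v ∈ K := h1 ▸ K.sub_mem hk (hAK v)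
      exact inner_self_eq_zero.1 (Submodule.inner_right_of_mem_orthogonal (𝕜 := ℝ) h3
        (Submodule.starProjection_apply_mem Kᗮ v))
    refine ⟨?_, by rw [h2] at h1; exact (sub_eq_zero.1 h1.symm).symm⟩
    rw [Submodule.starProjection_orthogonal'] at h2
    have h4 : v - K.starProjection v = 0 := h2
    rw [sub_eq_zero.1 h4]
    exact Submodule.starProjection_apply_mem _ _
  have hinj : Function.Injective A' := by
    refine (injective_iff_map_eq_zero _).2 fun v hv => ?_
    obtain ⟨h1, h2⟩ := hsplit v 0 K.zero_mem hv
    exact hinjK v h1 h2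
  let S := (LinearEquiv.ofInjectiveEndo A'.toLinearMap hinj).toContinuousLinearEquiv
  have hS : ∀ v, A' (S.symm v) = v := fun v => S.apply_symm_apply v
  let B : V →L[ℝ] V := (S.symm : V →L[ℝ] V) ∘L K.starProjection
  have hB : ∀ v, B v ∈ K ∧ A (B v) = K.starProjection v := fun v =>
    hsplit _ _ (Submodule.starProjection_apply_mem K v) (hS _)
  have hBA : ∀ v, B (A v) = K.starProjection v := fun v => by
    obtain ⟨h1, h2⟩ := hB (A v)
    rw [Submodule.starProjection_eq_self_iff.2 (hAK v)] at h2
    rw [← sub_eq_zero]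
    refine hinjK _ (K.sub_mem h1 (Submodule.starProjection_apply_mem K v)) ?_
    rw [map_sub, h2, hA, sub_self]
  have hAB' : A ∘L B = K.starProjection := ContinuousLinearMap.ext fun v => (hB v).2
  have hBA' : B ∘L A = K.starProjection := ContinuousLinearMap.ext hBA
  refine ⟨B, ⟨?_, ?_, ?_, ?_⟩, fun v => (hB v).2, hBA⟩
  · rw [hBA']
    exact ContinuousLinearMap.ext hA
  · rw [hAB']
    ext v
    simp only [B, ContinuousLinearMap.comp_apply]
    rw [Submodule.starProjection_eq_self_iff.2 (Submodule.starProjection_apply_mem K v)]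
  · rw [hAB']
    exact fun v w => Submodule.inner_starProjection_left_eq_right _ _ _
  · rw [hBA']
    exact fun v w => Submodule.inner_starProjection_left_eq_right _ _ _

/-- `AB` and `AC` are both the orthogonal projection onto the range of `A`, and `BA` and `CA` both
the one onto the orthogonal complement of its kernel. Then `B = BAB = CAC = C`. -/
theorem eq_of_isPseudoinverse {A B C : V →L[ℝ] V} (hB : IsPseudoinverse A B)
    (hC : IsPseudoinverse A C) : B = C := by
  obtain ⟨hB1, hB2, hB3, hB4⟩ := hB
  obtain ⟨hC1, hC2, hC3, hC4⟩ := hC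
  have hB1' : ∀ v, A (B (A v)) = A v := fun v => DFunLike.congr_fun hB1 v
  have hC1' : ∀ v, A (C (A v)) = A v := fun v => DFunLike.congr_fun hC1 v
  have hB3' : ∀ v w, ⟪A (B v), w⟫ = ⟪v, A (B w)⟫ := hB3
  have hC3' : ∀ v w, ⟪A (C v), w⟫ = ⟪v, A (C w)⟫ := hC3
  have hB4' : ∀ v w, ⟪B (A v), w⟫ = ⟪v, B (A w)⟫ := hB4
  have hC4' : ∀ v w, ⟪C (A v), w⟫ = ⟪v, C (A w)⟫ := hC4
  have hAC : ∀ v, A (C v) = A (B v) := fun v => by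
    refine ext_inner_right ℝ fun w => ?_
    rw [← hB1' (C v), hB3', hC3', hC1', hB3']
  have hCA : ∀ v, C (A v) = B (A v) := fun v => by
    refine ext_inner_right ℝ fun w => ?_
    rw [← hB1' v, hC4', hB4', hC1', ← hB4', hB1']
  ext v
  have e1 : B (A (B v)) = B v := DFunLike.congr_fun hB2 v
  have e2 : C (A (C v)) = C v := DFunLike.congr_fun hC2 v
  rw [← e1, ← e2, hAC, hCA]

theorem pinv_spec {A : V →L[ℝ] V} {K : Submodule ℝ V} (hAK : ∀ v, A v ∈ K)
    (hA : ∀ v, A (K.starProjection v) = A v) (hpos : PosDefOn A K) (d : V) :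
    pinv A d ∈ K ∧ A (pinv A d) = K.starProjection d := by
  obtain ⟨B, hB, hAB, hBA⟩ := exists_isPseudoinverse hAK hA hpos
  have H : ∃ B, IsPseudoinverse A B := ⟨B, hB⟩
  have h1 : pinv A = B := by
    rw [pinv, dif_pos H]
    exact eq_of_isPseudoinverse H.choose_spec hB
  rw [h1]
  refine ⟨?_, hAB d⟩
  have h2 : B (A (B d)) = B d := DFunLike.congr_fun hB.2.1 d
  rw [← h2, hBA]
  exact Submodule.starProjection_apply_mem _ _

end Pinv

/-! ### Convex subdifferential of a sum -/

section SumRule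

variable {V : Type*} [NormedAddCommGroup V] [InnerProductSpace ℝ V] [FiniteDimensional ℝ V]

theorem le_of_hasDerivAt_of_le {φ : ℝ → ℝ} {m c : ℝ} (hφ : HasDerivAt φ m 0)
    (hc : ∀ τ ∈ Ioo (0 : ℝ) 1, φ 0 + τ * c ≤ φ τ) : c ≤ m := by
  have h1 := hφ.tendsto_slope_zero_right
  refine ge_of_tendsto h1 ?_
  filter_upwards [Ioo_mem_nhdsGT (show (0 : ℝ) < 1 by norm_num)] with τ hτ
  have h2 := hc τ hτ
  rw [zero_add, smul_eq_mul, inv_mul_eq_div, le_div_iff₀ hτ.1]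
  linarith

theorem hasDerivAt_comp_line {f : V → ℝ} {x : V} (hf : DifferentiableAt ℝ f x) (d : V) :
    HasDerivAt (fun τ : ℝ => f (x + τ • d)) ⟪gradient f x, d⟫ 0 := by
  rw [inner_gradient]
  have hl : HasDerivAt (fun t : ℝ => x + t • d) d 0 := by
    simpa using ((hasDerivAt_id (0 : ℝ)).smul_const d).const_add x
  have h1 : HasFDerivAt f (fderiv ℝ f x) (x + (0 : ℝ) • d) := by simpa using hf.hasFDerivAt
  exact h1.comp_hasDerivAt 0 hl

theorem convexOn_add_inner_gradient_le {f : V → ℝ} (hf : ConvexOn ℝ univ f) {x : V}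
    (hd : DifferentiableAt ℝ f x) (y : V) : f x + ⟪gradient f x, y - x⟫ ≤ f y := by
  have h1 := (hasDerivAt_comp_line hd (y - x)).neg
  have h2 := le_of_hasDerivAt_of_le (c := f x - f y) h1 fun τ hτ => by
    have h3 := hf.2 (mem_univ x) (mem_univ y) (show (0 : ℝ) ≤ 1 - τ by linarith [hτ.2]) hτ.1.le
      (by ring)
    have h4 : (1 - τ) • x + τ • y = x + τ • (y - x) := by module
    rw [h4] at h3
    simp only [smul_eq_mul, Pi.neg_apply, zero_smul, add_zero] at h3 ⊢
    linarith
  linarith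

/-- Sum rule for the convex subdifferential with a smooth convex summand. -/
theorem mem_convexSubdiff_add_iff {f : V → ℝ} {h : V → EReal} {x : V} {t : ℝ} (ht : h x = t)
    (hbot : ∀ y, h y ≠ ⊥) (hf : ConvexOn ℝ univ f) (hh : IsConvexFun h)
    (hd : DifferentiableAt ℝ f x) {v : V} :
    v ∈ convexSubdiff (fun y => (f y : EReal) + h y) x ↔ v - gradient f x ∈ convexSubdiff h x := by
  constructor
  · intro hv
    refine ⟨by simp [ht], fun y => ?_⟩
    by_cases htop : h y = ⊤
    · simp [htop]
    obtain ⟨b, hb⟩ : ∃ b : ℝ, h y = b := ⟨_, (EReal.coe_toReal htop (hbot y)).symm⟩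
    rw [ht, hb, ← EReal.coe_add, EReal.coe_le_coe_iff]
    -- Along the segment to `y` the convex `h` is replaced by its chord, so only `f` has to be
    -- differentiated at `x`.
    have h2 := le_of_hasDerivAt_of_le (c := ⟪v, y - x⟫ - (b - t)) (hasDerivAt_comp_line hd (y - x))
      fun τ hτ => by
        have h3 := hh (show (x, t) ∈ {p : V × ℝ | h p.1 ≤ (p.2 : EReal)} from ht.le)
          (show (y, b) ∈ {p : V × ℝ | h p.1 ≤ (p.2 : EReal)} from hb.le)
          (show (0 : ℝ) ≤ 1 - τ by linarith [hτ.2]) hτ.1.le (by ring)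
        have h3' : h ((1 - τ) • x + τ • y) ≤ (((1 - τ) * t + τ * b : ℝ) : EReal) := h3
        have h4 : (1 - τ) • x + τ • y = x + τ • (y - x) := by module
        rw [h4] at h3'
        have h5 := (hv.2 (x + τ • (y - x))).trans (add_le_add_right h3' _)
        simp only [ht] at h5
        rw [← EReal.coe_add, ← EReal.coe_add, ← EReal.coe_add, EReal.coe_le_coe_iff,
          add_sub_cancel_left, inner_smul_right] at h5
        rw [zero_smul, add_zero]
        linarith
    rw [inner_sub_left]
    linarith
  · intro hv
    refine ⟨by simp only [ht]; rw [← EReal.coe_add]; exact EReal.coe_ne_top _, fun y => ?_⟩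
    have h1 := convexOn_add_inner_gradient_le hf hd y
    have h2 := hv.2 y
    rw [ht, ← EReal.coe_add] at h2
    simp only [ht]
    refine le_trans ?_ (add_le_add (EReal.coe_le_coe_iff.2 h1) h2)
    rw [← EReal.coe_add, ← EReal.coe_add, ← EReal.coe_add, EReal.coe_le_coe_iff, inner_sub_left]
    linarith

end SumRule

/-! ### Regular points and the differentiated fixed-point equation -/

section Objective

variable {V P : Type*}
  [NormedAddCommGroup V] [InnerProductSpace ℝ V] [FiniteDimensional ℝ V]
  [NormedAddCommGroup P] [InnerProductSpace ℝ P] [FiniteDimensional ℝ P]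
  {f : V → P → ℝ} {g : V → P → EReal} {M : Set V} {Ω : Set P} {e : V → P → ℝ} {x : V} {u : P}

theorem gradient_add_slice (hf : ContDiffAt ℝ 2 (fun z : V × P => f z.1 z.2) (x, u))
    (he : ContDiffAt ℝ 2 (fun z : V × P => e z.1 z.2) (x, u)) :
    gradient (fun y => f y u + e y u) x = gradX f x u + gradX e x u := by
  have h1 := (contDiffAt_slice hf).differentiableAt (by norm_num)
  have h2 := (contDiffAt_slice he).differentiableAt (by norm_num)
  rw [gradX, gradX, gradient_eq_riesz, gradient_eq_riesz, gradient_eq_riesz, fderiv_fun_add h1 h2,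
    map_add]

theorem differentiableAt_gradX_slice (he : ContDiffAt ℝ 2 (fun z : V × P => e z.1 z.2) (x, u)) :
    DifferentiableAt ℝ (fun y => gradX e y u) x :=
  DifferentiableAt.comp (g := fun z : V × P => gradX e z.1 z.2) (f := fun y : V => (y, u)) x
    (hasFDerivAt_gradX he).differentiableAt (hasFDerivAt_prodMk_left x u).differentiableAt

theorem fderiv_gradient_add_slice (hf : ContDiffAt ℝ 2 (fun z : V × P => f z.1 z.2) (x, u))
    (he : ContDiffAt ℝ 2 (fun z : V × P => e z.1 z.2) (x, u)) :
    fderiv ℝ (gradient fun y => f y u + e y u) x = hessX f x u + hessX e x u := by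
  have h1 : (gradient fun y => f y u + e y u) =ᶠ[𝓝 x] fun y => gradX f y u + gradX e y u := by
    have hl : Tendsto (fun y : V => (y, u)) (𝓝 x) (𝓝 (x, u)) :=
      (Continuous.prodMk_left u).tendsto x
    filter_upwards [hl.eventually (hf.eventually (by norm_num)),
      hl.eventually (he.eventually (by norm_num))] with y h1 h2 using gradient_add_slice h1 h2
  rw [h1.fderiv_eq, fderiv_fun_add (differentiableAt_gradX_slice hf)
    (differentiableAt_gradX_slice he)]
  rfl

theorem IsJointExtension.isSmoothExtension_objective (he : IsJointExtension g M Ω e x u)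
    (hf : ContDiffAt ℝ 2 (fun z : V × P => f z.1 z.2) (x, u)) (hu : u ∈ Ω) :
    IsSmoothExtension M (objective f g u) x (fun y => f y u + e y u) := by
  refine ⟨(contDiffAt_slice hf).add (contDiffAt_slice he.smooth), ?_⟩
  filter_upwards [(he.isSmoothExtension hu).2] with y hy
  rw [objective, hy, EReal.coe_add]

theorem inner_riemHess_objective (hM : IsC2Submanifold M) (hx : x ∈ M) (hu : u ∈ Ω)
    (hf : ContDiffAt ℝ 2 (fun z : V × P => f z.1 z.2) (x, u)) (he : IsJointExtension g M Ω e x u)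
    {v w : V} (hv : v ∈ tangentSpace M x) (hw : w ∈ tangentSpace M x) :
    ⟪riemHess M (objective f g u) x v, w⟫ = ⟪hessX f x u v, w⟫ + ⟪hessX e x u v, w⟫
      + ⟪weingarten M x (norProj M x (gradX f x u + gradX e x u)) v, w⟫ := by
  rw [inner_riemHess hM hx (he.isSmoothExtension_objective hf hu) hv hw,
    fderiv_gradient_add_slice hf he.smooth, gradient_add_slice hf he.smooth,
    _root_.add_apply, inner_add_left]

theorem tendsto_prodMk_right (hΩ : IsOpen Ω) (hx : x ∈ M) (hu : u ∈ Ω) :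
    Tendsto (fun u' : P => (x, u')) (𝓝 u) (𝓝[M ×ˢ Ω] (x, u)) := by
  refine tendsto_nhdsWithin_iff.2 ⟨(Continuous.prodMk_right x).tendsto u, ?_⟩
  filter_upwards [hΩ.mem_nhds hu] with u' hu' using ⟨hx, hu'⟩

/-- The joint extension `e` serves all parameters near `u` at once, and the tangent projection at
`x` does not depend on the parameter. -/
theorem hasFDerivAt_riemGrad_objective (hΩ : IsOpen Ω) (hx : x ∈ M) (hu : u ∈ Ω)
    (hf : ContDiff ℝ 2 (fun z : V × P => f z.1 z.2)) (he : IsJointExtension g M Ω e x u) :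
    HasFDerivAt (fun u' => riemGrad M (objective f g u') x)
      (tanProj M x ∘L (gradXU f x u + gradXU e x u)) u := by
  have h1 : (fun u' => riemGrad M (objective f g u') x) =ᶠ[𝓝 u]
      fun u' => tanProj M x (gradX f x u' + gradX e x u') := by
    filter_upwards [(tendsto_prodMk_right hΩ hx hu).eventually he.eventually, hΩ.mem_nhds hu]
      with u' h1 h2
    rw [riemGrad_eq hx (h1.isSmoothExtension_objective hf.contDiffAt h2),
      gradient_add_slice hf.contDiffAt h1.smooth]
  refine HasFDerivAt.congr_of_eventuallyEq ?_ h1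
  have h2 : ∀ {e : V → P → ℝ}, ContDiffAt ℝ 2 (fun z : V × P => e z.1 z.2) (x, u) →
      HasFDerivAt (fun u' => gradX e x u') (gradXU e x u) u := fun he =>
    (DifferentiableAt.comp (g := fun z : V × P => gradX _ z.1 z.2) (f := fun u' : P => (x, u')) u
      (hasFDerivAt_gradX he).differentiableAt
      (hasFDerivAt_prodMk_right x u).differentiableAt).hasFDerivAt
  exact (tanProj M x).hasFDerivAt.comp u ((h2 hf.contDiffAt).fun_add (h2 he.smooth))

/-- The projection of `-∇_x f` onto the affine hull of `∂_x g`, written in terms of a joint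
extension `e` of `g`. -/
noncomputable def multiplier (f e : V → P → ℝ) (M : Set V) (x : V) (u : P) : V :=
  tanProj M x (gradX e x u) - norProj M x (gradX f x u)

/-- The conditions on a point of `M` under which the fixed-point equation of the proximal gradient
method can be differentiated. -/
structure RegularPoint (f : V → P → ℝ) (g : V → P → EReal) (M : Set V) (Ω : Set P)
    (e : V → P → ℝ) (x : V) (u : P) : Prop where
  mem : x ∈ M
  ext : IsJointExtension g M Ω e x u
  subgrad : multiplier f e M x u ∈ convexSubdiff (fun y => g y u) x
  stable : ∃ ε > 0, ∀ᶠ z in 𝓝[M ×ˢ Ω] (x, u), ∀ v, ‖v - multiplier f e M x u‖ < ε →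
    v - gradX e z.1 z.2 ∈ normalSpace M z.1 → v ∈ convexSubdiff (fun y => g y z.2) z.1
  posDef : PosDefOn (riemHess M (objective f g u) x) (tangentSpace M x)

theorem gradX_sub_multiplier :
    gradX e x u - multiplier f e M x u = norProj M x (gradX f x u + gradX e x u) := by
  rw [multiplier, map_add, norProj_apply M x (gradX e x u)]
  abel

namespace RegularPoint

variable (hp : RegularPoint f g M Ω e x u)
include hp

/-- Pythagoras: subgradients differ from the multiplier by normal vectors, while `-∇_x f` minus the
multiplier is tangent. -/
theorem isNearestPoint_multiplier (hu : u ∈ Ω) :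
    IsNearestPoint (convexSubdiff (fun y => g y u) x) (-gradX f x u) (multiplier f e M x u) ∧
    ∀ q, IsNearestPoint (convexSubdiff (fun y => g y u) x) (-gradX f x u) q →
      q = multiplier f e M x u := by
  have key : ∀ c ∈ convexSubdiff (fun y => g y u) x,
      ‖-gradX f x u - c‖ ^ 2 = ‖-gradX f x u - multiplier f e M x u‖ ^ 2
        + ‖c - multiplier f e M x u‖ ^ 2 := fun c hc => by
    have h1 := sub_gradient_mem_normalSpace hp.mem (hp.ext.isSmoothExtension hu) hc
    have h2 := sub_gradient_mem_normalSpace hp.mem (hp.ext.isSmoothExtension hu) hp.subgrad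
    have h3 : c - multiplier f e M x u ∈ normalSpace M x := by
      have := Submodule.sub_mem _ h1 h2
      rwa [sub_sub_sub_cancel_right] at this
    have h4 : -gradX f x u - multiplier f e M x u = -tanProj M x (gradX f x u + gradX e x u) := by
      rw [multiplier, norProj_apply, map_add]
      abel
    have h5 : ⟪-gradX f x u - multiplier f e M x u, c - multiplier f e M x u⟫ = 0 := by
      rw [h4, inner_neg_left, real_inner_comm,
        inner_eq_zero_of_mem_normalSpace h3 (tanProj_mem _ _ _), neg_zero]
    have h6 : -gradX f x u - c
        = (-gradX f x u - multiplier f e M x u) - (c - multiplier f e M x u) := by abel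
    rw [h6, norm_sub_sq_real, h5]
    ring
  refine ⟨⟨hp.subgrad, fun c hc => ?_⟩, fun q hq => ?_⟩
  · have := key c hc
    exact le_of_sq_le_sq (by nlinarith [sq_nonneg ‖c - multiplier f e M x u‖]) (norm_nonneg _)
  · have h1 := key q hq.1
    have h2 := hq.2 _ hp.subgrad
    have h3 := pow_le_pow_left₀ (norm_nonneg _) h2 2
    have h4 : ‖q - multiplier f e M x u‖ ^ 2 = 0 :=
      le_antisymm (by linarith) (sq_nonneg _)
    exact sub_eq_zero.1 (norm_eq_zero.1 (pow_eq_zero_iff two_ne_zero |>.1 h4))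

theorem nu_eq (hu : u ∈ Ω) : nu f g x u = multiplier f e M x u := by
  obtain ⟨h1, h2⟩ := hp.isNearestPoint_multiplier hu
  have H : ∃ q, IsNearestPoint (convexSubdiff (fun y => g y u) x) (-gradX f x u) q := ⟨_, h1⟩
  rw [nu, projOnto, dif_pos H]
  exact h2 _ H.choose_spec

/-- The normal part of `∇_x F` is `∇_x e` minus the multiplier. Removing `∇²_x f` thus leaves the
second order form of `e - ⟨ν, ·⟩` on `M`, to which the necessary condition for a subgradient
applies. -/
theorem inner_hess_sub (hM : IsC2Submanifold M) (hu : u ∈ Ω)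
    (hf : ContDiff ℝ 2 (fun z : V × P => f z.1 z.2)) {v w : V}
    (hv : v ∈ tangentSpace M x) (hw : w ∈ tangentSpace M x) :
    ⟪(riemHess M (objective f g u) x - hessX f x u) v, w⟫ = ⟪hessX e x u v, w⟫
      + ⟪weingarten M x (gradX e x u - multiplier f e M x u) v, w⟫ := by
  rw [_root_.sub_apply, inner_sub_left,
    inner_riemHess_objective hM hp.mem hu hf.contDiffAt hp.ext hv hw, gradX_sub_multiplier]
  ring

theorem hess_sub_nonneg (hM : IsC2Submanifold M) (hu : u ∈ Ω)
    (hf : ContDiff ℝ 2 (fun z : V × P => f z.1 z.2)) {v : V} (hv : v ∈ tangentSpace M x) :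
    0 ≤ ⟪(riemHess M (objective f g u) x - hessX f x u) v, v⟫ := by
  rw [hp.inner_hess_sub hM hu hf hv hv]
  exact hess_add_weingarten_nonneg hM hp.mem (hp.ext.isSmoothExtension hu) hp.subgrad hv

theorem inner_hess_sub_comm (hM : IsC2Submanifold M) (hu : u ∈ Ω)
    (hf : ContDiff ℝ 2 (fun z : V × P => f z.1 z.2)) {v w : V}
    (hv : v ∈ tangentSpace M x) (hw : w ∈ tangentSpace M x) :
    ⟪(riemHess M (objective f g u) x - hessX f x u) v, w⟫ =
      ⟪(riemHess M (objective f g u) x - hessX f x u) w, v⟫ := by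
  rw [hp.inner_hess_sub hM hu hf hv hw, hp.inner_hess_sub hM hu hf hw hv,
    inner_hessX_comm hp.ext.smooth, gradX_sub_multiplier,
    inner_weingarten_comm hM hp.mem (norProj_mem _ _ _) hv hw]

theorem exists_hasFDerivAt (hM : IsC2Submanifold M) (hΩ : IsOpen Ω) (hu : u ∈ Ω)
    (hf : ContDiff ℝ 2 (fun z : V × P => f z.1 z.2)) {α : ℝ} (hα : 0 < α) :
    ∃ D : V × P →L[ℝ] V,
      HasFDerivAt (fun q : V × P => prox α g q.1 q.2) D (wPoint α f g x u, u) ∧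
      ∀ q : V × P, D q ∈ tangentSpace M x ∧ ∀ w ∈ tangentSpace M x,
        ⟪D q, w⟫ + α * ⟪(riemHess M (objective f g u) x - hessX f x u) (D q), w⟫
          + α * ⟪gradXU e x u q.2, w⟫ = ⟪q.1, w⟫ := by
  obtain ⟨D, hD, hq⟩ := exists_hasFDerivAt_prox hM hΩ hp.mem hu hp.ext hp.subgrad hp.stable hα
  rw [wPoint, hp.nu_eq hu]
  refine ⟨D, hD, fun q => ⟨(hq q).1, fun w hw => ?_⟩⟩
  rw [hp.inner_hess_sub hM hu hf (hq q).1 hw]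
  exact (hq q).2 w hw

/-- The normal part of `ν + ∇_x f` cancels, so the Weingarten correction disappears and the
pseudoinverse inverts `∇²_M F` on the tangent space. -/
theorem phi_spec (hM : IsC2Submanifold M) (hΩ : IsOpen Ω) (hu : u ∈ Ω)
    (hf : ContDiff ℝ 2 (fun z : V × P => f z.1 z.2)) (α : ℝ) (ud : P) :
    phi α f g M x u ud ∈ tangentSpace M x ∧
      ∀ w ∈ tangentSpace M x, ⟪riemHess M (objective f g u) x (phi α f g M x u ud), w⟫ =
        -⟪gradXU f x u ud + gradXU e x u ud, w⟫ := by
  have h1 : norProj M x (nu f g x u + gradX f x u) = 0 := by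
    rw [hp.nu_eq hu, multiplier, map_add, map_sub, norProj_apply M x (tanProj M x _),
      tanProj_tanProj, sub_self, norProj_eq_self (norProj_mem M x _), zero_sub, neg_add_cancel]
  obtain ⟨h2, h3⟩ := pinv_spec (K := tangentSpace M x) (riemHess_mem M (objective f g u) x)
    (riemHess_tanProj M (objective f g u) x) hp.posDef
    (tanProj M x (gradXU f x u ud + gradXU e x u ud))
  have h4 : phi α f g M x u ud = -pinv (riemHess M (objective f g u) x)
      (tanProj M x (gradXU f x u ud + gradXU e x u ud)) := by
    rw [phi, h1, smul_zero, weingarten_zero hM hp.mem, sub_zero,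
      (hasFDerivAt_riemGrad_objective hΩ hp.mem hu hf hp.ext).fderiv]
    rfl
  rw [h4]
  refine ⟨Submodule.neg_mem _ h2, fun w hw => ?_⟩
  rw [map_neg, h3, inner_neg_left]
  change -⟪tanProj M x (tanProj M x _), w⟫ = _
  rw [tanProj_tanProj, inner_tanProj_of_mem _ hw]

/-- Tested on tangent vectors, `⟨X, w⟩` and `α⟨∇²_x f X, w⟩` occur on both sides and cancel; what
remains is `α` times the system of `phi_spec`. Positivity of `∇²_M F` gives the forward direction.
For the converse, nonnegativity of `∇²_M F - ∇²_x f` shows that the equation defining `D` has only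
one tangent solution. -/
theorem eq_phi_iff (hM : IsC2Submanifold M) (hΩ : IsOpen Ω) (hu : u ∈ Ω)
    (hf : ContDiff ℝ 2 (fun z : V × P => f z.1 z.2)) {α : ℝ} (hα : 0 < α)
    {D : V × P →L[ℝ] V}
    (hD : ∀ q : V × P, D q ∈ tangentSpace M x ∧ ∀ w ∈ tangentSpace M x,
        ⟪D q, w⟫ + α * ⟪(riemHess M (objective f g u) x - hessX f x u) (D q), w⟫
          + α * ⟪gradXU e x u q.2, w⟫ = ⟪q.1, w⟫) (X : V) (ud : P) :
    X = D (X - α • hessX f x u X - α • gradXU f x u ud, ud) ↔ X = phi α f g M x u ud := by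
  obtain ⟨hφ1, hφ2⟩ := hp.phi_spec hM hΩ hu hf α ud
  constructor
  · intro hX
    obtain ⟨h1, h2⟩ := hD (X - α • hessX f x u X - α • gradXU f x u ud, ud)
    rw [← hX] at h1 h2
    have h3 : X - phi α f g M x u ud ∈ tangentSpace M x := Submodule.sub_mem _ h1 hφ1
    by_contra hne
    have h4 := hp.posDef _ h3 (sub_ne_zero.2 hne)
    have h5 := h2 _ h3
    have h6 := hφ2 _ h3
    simp only [_root_.sub_apply, map_sub, inner_sub_left, inner_smul_left,
      inner_add_left, RCLike.conj_to_real] at h4 h5 h6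
    nlinarith
  · rintro rfl
    set X := phi α f g M x u ud
    obtain ⟨h1, h2⟩ := hD (X - α • hessX f x u X - α • gradXU f x u ud, ud)
    set Y := D (X - α • hessX f x u X - α • gradXU f x u ud, ud)
    have h3 : Y - X ∈ tangentSpace M x := Submodule.sub_mem _ h1 hφ1
    have h4 := hp.hess_sub_nonneg hM hu hf h3
    have h5 := h2 _ h3
    have h6 := hφ2 _ h3
    have h7 : ⟪Y - X, Y - X⟫ ≤ 0 := by
      rw [inner_sub_left]
      rw [map_sub, inner_sub_left, _root_.sub_apply _ _ X, inner_sub_left] at h4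
      simp only [inner_sub_left, inner_smul_left, inner_add_left, RCLike.conj_to_real] at h5 h6
      nlinarith
    rw [real_inner_self_eq_norm_sq] at h7
    have h8 : ‖Y - X‖ = 0 := by nlinarith [norm_nonneg (Y - X)]
    exact (sub_eq_zero.1 (norm_eq_zero.1 h8)).symm

theorem solvesImplicitDiff_iff (hM : IsC2Submanifold M) (hΩ : IsOpen Ω) (hu : u ∈ Ω)
    (hf : ContDiff ℝ 2 (fun z : V × P => f z.1 z.2)) {α : ℝ} (hα : 0 < α) (X : P →L[ℝ] V) :
    SolvesImplicitDiff α f g x u X ↔ X = phi α f g M x u := by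
  obtain ⟨D, hD, hq⟩ := hp.exists_hasFDerivAt hM hΩ hu hf hα
  have h1 : proxDX α g (wPoint α f g x u) u = D ∘L ContinuousLinearMap.inl ℝ V P :=
    (HasFDerivAt.comp (g := fun q : V × P => prox α g q.1 q.2) (f := fun w' : V => (w', u)) _ hD
      (hasFDerivAt_prodMk_left _ u)).fderiv
  have h2 : proxDU α g (wPoint α f g x u) u = D ∘L ContinuousLinearMap.inr ℝ V P :=
    (HasFDerivAt.comp (g := fun q : V × P => prox α g q.1 q.2)
      (f := fun u' : P => (wPoint α f g x u, u')) _ hD (hasFDerivAt_prodMk_right _ u)).fderiv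
  rw [SolvesImplicitDiff, h1, h2, ContinuousLinearMap.ext_iff, ContinuousLinearMap.ext_iff]
  refine forall_congr' fun ud => ?_
  rw [← hp.eq_phi_iff hM hΩ hu hf hα hq]
  have h3 : (D ∘L ContinuousLinearMap.inl ℝ V P ∘L
      ((ContinuousLinearMap.id ℝ V - α • hessX f x u) ∘L X - α • gradXU f x u)
        + D ∘L ContinuousLinearMap.inr ℝ V P) ud
      = D (X ud - α • hessX f x u (X ud) - α • gradXU f x u ud, ud) := by
    change D (_, 0) + D (0, ud) = _
    rw [← map_add, Prod.mk_add_mk, add_zero, zero_add]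
    rfl
  rw [← h3]
  rfl

end RegularPoint

end Objective

/-! ### Persistence of regularity and convergence of automatic differentiation -/

section Main

variable {V P : Type*}
  [NormedAddCommGroup V] [InnerProductSpace ℝ V] [FiniteDimensional ℝ V]
  [NormedAddCommGroup P] [InnerProductSpace ℝ P] [FiniteDimensional ℝ P]
  {f : V → P → ℝ} {g : V → P → EReal} {M : Set V} {Ω : Set P} {e : V → P → ℝ} {x : V} {u : P}

theorem tendsto_gradX_slice (he : ContDiffAt ℝ 2 (fun z : V × P => e z.1 z.2) (x, u)) :
    Tendsto (fun y => gradX e y u) (𝓝[M] x) (𝓝 (gradX e x u)) :=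
  (differentiableAt_gradX_slice he).continuousAt.tendsto.mono_left nhdsWithin_le_nhds

theorem tendsto_hessX_slice (he : ContDiffAt ℝ 2 (fun z : V × P => e z.1 z.2) (x, u)) :
    Tendsto (fun y => hessX e y u) (𝓝[M] x) (𝓝 (hessX e x u)) := by
  have h1 : ContDiffAt ℝ 1 (fun y : V => (y, u)) x := by fun_prop
  have h2 : ContDiffAt ℝ 1 (fun y => gradX e y u) x :=
    ContDiffAt.comp (g := fun z : V × P => gradX e z.1 z.2) x (contDiffAt_gradX he) h1
  exact (h2.fderiv_right (m := 0) (by norm_num)).continuousAt.tendsto.mono_left nhdsWithin_le_nhds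

theorem tendsto_norProj_gradX (hM : IsC2Submanifold M) (hx : x ∈ M)
    (hf : ContDiffAt ℝ 2 (fun z : V × P => f z.1 z.2) (x, u))
    (he : ContDiffAt ℝ 2 (fun z : V × P => e z.1 z.2) (x, u)) :
    Tendsto (fun y => norProj M y (gradX f y u + gradX e y u)) (𝓝[M] x)
      (𝓝 (norProj M x (gradX f x u + gradX e x u))) :=
  tendsto_clm_apply (tendsto_norProj hM hx) ((tendsto_gradX_slice hf).add (tendsto_gradX_slice he))

open scoped Pointwise in
-- Nondegeneracy and the sum rule give a normal ball of subgradients of `g(·, u)` around `-∇_x f`,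
-- which is the multiplier at `x`. The multiplier is continuous along `M`, so stability of
-- subgradients keeps it a subgradient, and positivity of the Hessian persists.
theorem eventually_regularPoint {L : ℝ≥0} (hM : IsC2Submanifold M) (hΩ : IsOpen Ω)
    (hfg : ConvexPartlySmoothObjective f g M Ω L) (hx : x ∈ M) (hu : u ∈ Ω)
    (hpos : PosDefOn (riemHess M (objective f g u) x) (tangentSpace M x))
    (hND : NonDegenerate f g x u) :
    ∃ e, multiplier f e M x u = -gradX f x u ∧
      ∀ᶠ y in 𝓝[M] x, RegularPoint f g M Ω e y u := by
  have hf := hfg.f_smooth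
  have hg : PartlySmooth (joint g) (prodSet M Ω) := hfg.g_partlySmooth
  obtain ⟨e, he⟩ := exists_isJointExtension hg hx hu
  obtain ⟨t, ht, -⟩ := exists_real_of_partlySmooth hg hx hu
  have hadd : ∀ v, v ∈ convexSubdiff (objective f g u) x ↔
      v - gradX f x u ∈ convexSubdiff (fun y => g y u) x := fun v =>
    mem_convexSubdiff_add_iff (h := fun y => g y u) ht
      (fun y => hg.ne_bot (WithLp.toLp 2 (y, u))) (hfg.f_convex u hu) (hfg.g_convex u hu)
      ((contDiffAt_slice hf.contDiffAt).differentiableAt (by norm_num))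
  have hset : convexSubdiff (objective f g u) x =
      gradX f x u +ᵥ convexSubdiff (fun y => g y u) x := by
    ext v
    rw [hadd, Set.mem_vadd_set_iff_neg_vadd_mem, vadd_eq_add, neg_add_eq_sub]
  have hball : ∃ r > 0, ∀ n ∈ normalSpace M x, ‖n‖ < r →
      -gradX f x u + n ∈ convexSubdiff (fun y => g y u) x := by
    obtain ⟨r, hr, h⟩ := exists_ball_subset_of_mem_intrinsicInterior hND
    refine ⟨r, hr, fun n hn hnr => ?_⟩
    have h1 : n ∈ vectorSpan ℝ (convexSubdiff (objective f g u) x) := by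
      rw [hset, vectorSpan_vadd]
      exact normalSpace_le_vectorSpan hg hx hu (hfg.g_convex u hu) hn
    have h2 := (hadd _).1 (h n h1 hnr)
    rwa [zero_add, sub_eq_neg_add] at h2
  have hmult : multiplier f e M x u = -gradX f x u := by
    obtain ⟨r, hr, h⟩ := hball
    have h1 := h 0 (Submodule.zero_mem _) (by simpa using hr)
    rw [add_zero] at h1
    have h2 := mem_normalSpace_iff_tanProj.1
      (sub_gradient_mem_normalSpace hx (he.isSmoothExtension hu) h1)
    rw [map_sub, map_neg, sub_eq_zero] at h2
    change _ = tanProj M x (gradX e x u) at h2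
    rw [multiplier, ← h2, norProj_apply]
    abel
  have hG : ∀ᶠ z in 𝓝[M ×ˢ Ω] (x, u), ∀ v ∈ convexSubdiff (fun y => g y z.2) z.1,
      v - gradX e z.1 z.2 ∈ normalSpace M z.1 := by
    filter_upwards [he.eventually, self_mem_nhdsWithin] with z h1 h2 v hv
    exact sub_gradient_mem_normalSpace h2.1 (h1.isSmoothExtension h2.2) hv
  obtain ⟨ε, hε, hev⟩ := eventually_mem_convexSubdiff hM hΩ hg hfg.g_convex hx hu hball hG
  rw [← hmult] at hev
  have hcont : Tendsto (fun y => multiplier f e M y u) (𝓝[M] x) (𝓝 (multiplier f e M x u)) :=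
    (tendsto_clm_apply (tendsto_tanProj hM hx) (tendsto_gradX_slice he.smooth)).sub
      (tendsto_clm_apply (tendsto_norProj hM hx) (tendsto_gradX_slice hf.contDiffAt))
  have hleft := tendsto_prodMk_left (M := M) x hu
  have hPD := eventually_pos_of_pos hM hx
    (C := fun y => hessX f y u + hessX e y u)
    (ξ := fun y => norProj M y (gradX f y u + gradX e y u))
    ((tendsto_hessX_slice hf.contDiffAt).add (tendsto_hessX_slice he.smooth))
    (tendsto_norProj_gradX hM hx hf.contDiffAt he.smooth) (fun y _ => norProj_mem _ _ _)
    (fun v hv hne => by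
      have := hpos v hv hne
      rwa [inner_riemHess_objective hM hx hu hf.contDiffAt he hv hv, ← inner_add_left] at this)
  refine ⟨e, hmult, ?_⟩
  filter_upwards [self_mem_nhdsWithin, hleft.eventually he.eventually, hleft.eventually hev,
    hleft.eventually (eventually_eventually_nhdsWithin.2 hev),
    hcont.eventually (Metric.ball_mem_nhds _ (half_pos hε)), hPD] with y hy hey hSy hev' hclose hPDy
  rw [dist_eq_norm] at hclose
  -- The multiplier at `y` is within `ε / 2` of the one at `x`, so the stability radius `ε` at `x`
  -- leaves radius `ε / 2` at `y`.
  refine ⟨hy, hey, hSy _ (by linarith) ?_, ⟨ε / 2, half_pos hε, ?_⟩, fun v hv hne => ?_⟩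
  · rw [← neg_sub, gradX_sub_multiplier]
    exact Submodule.neg_mem _ (norProj_mem _ _ _)
  · filter_upwards [hev'] with z hz v hv hn
    refine hz v ?_ hn
    have := norm_sub_le_norm_sub_add_norm_sub v (multiplier f e M y u) (multiplier f e M x u)
    linarith
  · have := hPDy v hv hne
    rwa [_root_.add_apply, inner_add_left,
      ← inner_riemHess_objective hM hy hu hf.contDiffAt hey hv hv] at this

namespace RegularPoint

variable (hp : RegularPoint f g M Ω e x u)
include hp

/-- The linearized step on the tangent space is self-adjoint for a suitable inner product. -/
theorem exists_form_step (hM : IsC2Submanifold M) (hu : u ∈ Ω)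
    (hf : ContDiff ℝ 2 (fun z : V × P => f z.1 z.2)) {α : ℝ} (hα : 0 < α)
    {D : V × P →L[ℝ] V}
    (hD : ∀ q : V × P, D q ∈ tangentSpace M x ∧ ∀ w ∈ tangentSpace M x,
        ⟪D q, w⟫ + α * ⟪(riemHess M (objective f g u) x - hessX f x u) (D q), w⟫
          + α * ⟪gradXU e x u q.2, w⟫ = ⟪q.1, w⟫) :
    ∃ (q : tangentSpace M x →ₗ[ℝ] tangentSpace M x →ₗ[ℝ] ℝ)
      (B : tangentSpace M x →ₗ[ℝ] tangentSpace M x),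
      (∀ v w : tangentSpace M x, q v w = ⟪(v : V), w⟫
        + α * ⟪(riemHess M (objective f g u) x - hessX f x u) (v : V), w⟫) ∧
      (∀ v w, q v w = q w v) ∧ (∀ v, v ≠ 0 → 0 < q v v) ∧
      (∀ v : tangentSpace M x, (B v : V) = D ((v : V) - α • hessX f x u v, 0)) ∧
      (∀ v w : tangentSpace M x, q (B v) w = ⟪(v : V), w⟫ - α * ⟪hessX f x u v, w⟫) ∧
      ∀ v w, q (B v) w = q v (B w) := by
  let R := riemHess M (objective f g u) x - hessX f x u
  let q : tangentSpace M x →ₗ[ℝ] tangentSpace M x →ₗ[ℝ] ℝ :=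
    ((innerₗ V).comp (ContinuousLinearMap.id ℝ V + α • R : V →L[ℝ] V).toLinearMap).domRestrict₁₂
      (tangentSpace M x) (tangentSpace M x)
  have hq : ∀ v w : tangentSpace M x, q v w = ⟪(v : V), w⟫ + α * ⟪R (v : V), w⟫ := fun v w => by
    change ⟪(v : V) + α • R v, (w : V)⟫ = _
    rw [inner_add_left, inner_smul_left]
    rfl
  let B : tangentSpace M x →ₗ[ℝ] tangentSpace M x :=
    LinearMap.codRestrict (tangentSpace M x)
      ((D ∘L ContinuousLinearMap.inl ℝ V P ∘L
        (ContinuousLinearMap.id ℝ V - α • hessX f x u)).toLinearMap.domRestrict (tangentSpace M x))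
      (fun v => (hD _).1)
  have hB : ∀ v : tangentSpace M x, (B v : V) = D ((v : V) - α • hessX f x u v, 0) := fun v => rfl
  have hsymm : ∀ v w, q v w = q w v := fun v w => by
    rw [hq, hq, hp.inner_hess_sub_comm hM hu hf v.2 w.2, real_inner_comm]
  have hqB : ∀ v w : tangentSpace M x, q (B v) w = ⟪(v : V), w⟫ - α * ⟪hessX f x u v, w⟫ :=
    fun v w => by
      have h1 := (hD ((v : V) - α • hessX f x u v, 0)).2 w w.2
      simp only [map_zero, inner_zero_left, mul_zero, add_zero, inner_sub_left, inner_smul_left,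
        RCLike.conj_to_real] at h1
      rw [hq, hB, ← h1]
  refine ⟨q, B, hq, hsymm, fun v hv => ?_, hB, hqB, fun v w => ?_⟩
  · rw [hq]
    have h1 := hp.hess_sub_nonneg hM hu hf v.2
    have h2 : 0 < ⟪(v : V), v⟫ :=
      real_inner_self_pos.2 fun h => hv (Subtype.ext h)
    have := mul_nonneg hα.le h1
    linarith
  · rw [hsymm v, hqB, hqB, inner_hessX_comm hf.contDiffAt, real_inner_comm]

/-- As `φ` is a fixed point of the affine step, the error obeys the homogeneous recursion with the
self-adjoint operator `B`. The bound from above is `q(v, v) - q(Bv, v) = α⟨∇²_M F v, v⟩ > 0`, and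
`hgt` is the bound from below. -/
theorem tendsto_fpad (hM : IsC2Submanifold M) (hΩ : IsOpen Ω) (hu : u ∈ Ω)
    (hf : ContDiff ℝ 2 (fun z : V × P => f z.1 z.2)) {α β : ℝ} (hα : 0 < α)
    (hβ : β ∈ Icc (0 : ℝ) 1)
    (hgt : ∀ v ∈ tangentSpace M x, v ≠ 0 → 0 < ⟪v, v⟫ - α * ⟪hessX f x u v, v⟫
      + 1 / (1 + 2 * β) * (⟪v, v⟫
        + α * ⟪(riemHess M (objective f g u) x - hessX f x u) v, v⟫)) (ud : P) :
    Tendsto (fun k => (fpad α β f g x u ud k).1) atTop (𝓝 (phi α f g M x u ud)) := by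
  obtain ⟨D, hDd, hD⟩ := hp.exists_hasFDerivAt hM hΩ hu hf hα
  obtain ⟨q, B, hq, hsymm, hpos, hB, hqB, hBs⟩ := hp.exists_form_step hM hu hf hα hD
  have hφ := (hp.phi_spec hM hΩ hu hf α ud).1
  have hfix := (hp.eq_phi_iff hM hΩ hu hf hα hD (phi α f g M x u ud) ud).2 rfl
  set φ := phi α f g M x u ud
  let s : ℕ → V := fun k => (fpad α β f g x u ud k).1
  have hs : ∀ k, s (k + 2) = D ((1 + β) • s (k + 1) - β • s k
      - α • hessX f x u ((1 + β) • s (k + 1) - β • s k) - α • gradXU f x u ud, ud) := fun k => by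
    simp only [s, fpad, hDd.fderiv]
  -- The zero start and the range of `D` keep all iterates tangent, which is where `q` and `B` live.
  have hmem : ∀ k, s k ∈ tangentSpace M x := by
    rintro (_ | k)
    · exact Submodule.zero_mem _
    · simp only [s, fpad, hDd.fderiv]
      exact (hD _).1
  have hlim := tendsto_zero_of_symmetric_recursion q hsymm hpos B hBs hβ.1 hβ.2
    (fun v hv => by
      have h1 := hp.posDef v v.2 fun h => hv (Subtype.ext h)
      rw [hqB, hq, _root_.sub_apply, inner_sub_left]
      nlinarith [mul_pos hα h1])
    (fun v hv => by
      rw [hqB, hq]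
      exact hgt v v.2 fun h => hv (Subtype.ext h))
    (a := fun k => ⟨s k - φ, Submodule.sub_mem _ (hmem k) hφ⟩)
    (fun k => by
      refine Subtype.ext ?_
      rw [hB]
      change s (k + 2) - φ = D ((1 + β) • (s (k + 1) - φ) - β • (s k - φ)
        - α • hessX f x u ((1 + β) • (s (k + 1) - φ) - β • (s k - φ)), 0)
      rw [hs]
      nth_rw 1 [hfix]
      rw [← map_sub, Prod.mk_sub_mk, sub_self]
      congr 2
      simp only [map_sub, map_smul]
      module)
  have h1 := (continuous_subtype_val.tendsto _).comp hlim
  have h2 : Tendsto (fun k => s k - φ) atTop (𝓝 0) := h1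
  exact tendsto_sub_nhds_zero_iff.1 h2

/-- A lower bound for the eigenvalues of the differentiated step bounds its quadratic form. -/
theorem pos_of_hasEigenvalue (hM : IsC2Submanifold M) (hΩ : IsOpen Ω) (hu : u ∈ Ω)
    (hf : ContDiff ℝ 2 (fun z : V × P => f z.1 z.2)) {α κ : ℝ} (hα : 0 < α)
    (hmult : multiplier f e M x u = -gradX f x u)
    (hev : ∀ μ : ℝ, Module.End.HasEigenvalue
      (fderiv ℝ (fun y => pgdStep α f g y u) x).toLinearMap μ → -κ < μ)
    {v : V} (hv : v ∈ tangentSpace M x) (hne : v ≠ 0) :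
    0 < ⟪v, v⟫ - α * ⟪hessX f x u v, v⟫
      + κ * (⟪v, v⟫ + α * ⟪(riemHess M (objective f g u) x - hessX f x u) v, v⟫) := by
  obtain ⟨D, hDd, hD⟩ := hp.exists_hasFDerivAt hM hΩ hu hf hα
  obtain ⟨q, B, hq, hsymm, hpos, hB, hqB, hBs⟩ := hp.exists_form_step hM hu hf hα hD
  have hstep : HasFDerivAt (fun y => pgdStep α f g y u)
      (D ∘L ContinuousLinearMap.inl ℝ V P ∘L
        (ContinuousLinearMap.id ℝ V - α • hessX f x u)) x := by
    -- At this point the multiplier is `-∇_x f`, so `w` is the gradient step itself and the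
    -- derivative of the prox at `w` enters the chain rule for `A_α`.
    have hw : wPoint α f g x u = x - α • gradX f x u := by
      rw [wPoint, hp.nu_eq hu, hmult, smul_neg, sub_eq_add_neg]
    rw [hw] at hDd
    have h1 : HasFDerivAt (fun y => y - α • gradX f y u)
        (ContinuousLinearMap.id ℝ V - α • hessX f x u) x :=
      (hasFDerivAt_id x).fun_sub
        ((differentiableAt_gradX_slice hf.contDiffAt).hasFDerivAt.const_smul α)
    have h2 : HasFDerivAt (fun w : V => prox α g w u) (D ∘L ContinuousLinearMap.inl ℝ V P)
        (x - α • gradX f x u) :=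
      HasFDerivAt.comp (g := fun q : V × P => prox α g q.1 q.2) (f := fun w' : V => (w', u)) _ hDd
        (hasFDerivAt_prodMk_left _ u)
    exact HasFDerivAt.comp (g := fun w : V => prox α g w u) x h2 h1
  -- `B` is the restriction of `D_x A_α` to the tangent space, so its eigenvectors are eigenvectors
  -- of `D_x A_α`.
  have h1 := pos_of_eigenvalues_gt q hsymm hpos B hBs (κ := κ) (fun μ y hy hBy => by
    refine hev μ (Module.End.hasEigenvalue_of_hasEigenvector (x := (y : V))
      ⟨Module.End.mem_eigenspace_iff.2 ?_, fun h => hy (Subtype.ext h)⟩)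
    rw [hstep.fderiv]
    exact (hB y).symm.trans (congrArg Subtype.val hBy)) ⟨v, hv⟩
    (fun h => hne (congrArg Subtype.val h))
  rw [hqB, hq] at h1
  exact h1

end RegularPoint

/-- The spectral bound is known at `x` only. As positivity of a form on the tangent space it extends
to nearby points of `M`, without any perturbation theory for eigenvalues. -/
theorem eventually_tendsto_fpad {L : ℝ≥0} (hM : IsC2Submanifold M) (hΩ : IsOpen Ω)
    (hfg : ConvexPartlySmoothObjective f g M Ω L) (hx : x ∈ M) (hu : u ∈ Ω)
    (hmult : multiplier f e M x u = -gradX f x u)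
    (hreg : ∀ᶠ y in 𝓝[M] x, RegularPoint f g M Ω e y u) {α β : ℝ} (hα : 0 < α)
    (hβ : β ∈ Icc (0 : ℝ) 1)
    (hev : ∀ μ : ℝ, Module.End.HasEigenvalue
      (fderiv ℝ (fun y => pgdStep α f g y u) x).toLinearMap μ → -1 / (1 + 2 * β) < μ) :
    ∀ᶠ y in 𝓝[M] x, ∀ ud : P,
      Tendsto (fun k => (fpad α β f g y u ud k).1) atTop (𝓝 (phi α f g M y u ud)) := by
  have hf := hfg.f_smooth
  have hp := hreg.self_of_nhdsWithin hx
  set κ := 1 / (1 + 2 * β) with hκ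
  -- The form is split into a continuous operator and a Weingarten term along a continuous normal
  -- field, the shape that `eventually_pos_of_pos` needs.
  have key : ∀ y, RegularPoint f g M Ω e y u → ∀ v ∈ tangentSpace M y,
      ⟪(ContinuousLinearMap.id ℝ V - α • hessX f y u
          + κ • (ContinuousLinearMap.id ℝ V + α • hessX e y u)) v, v⟫
        + ⟪weingarten M y ((κ * α) • norProj M y (gradX f y u + gradX e y u)) v, v⟫ =
      ⟪v, v⟫ - α * ⟪hessX f y u v, v⟫
        + κ * (⟪v, v⟫ + α * ⟪(riemHess M (objective f g u) y - hessX f y u) v, v⟫) := by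
    intro y hy v hv
    rw [hy.inner_hess_sub hM hu hf hv hv, gradX_sub_multiplier,
      inner_weingarten_smul hM hy.mem (norProj_mem _ _ _) _ hv hv]
    change ⟪v - α • hessX f y u v + κ • (v + α • hessX e y u v), v⟫ + _ = _
    simp only [inner_add_left, inner_sub_left, inner_smul_left, RCLike.conj_to_real]
    ring
  have hPD := eventually_pos_of_pos hM hx
    (C := fun y => ContinuousLinearMap.id ℝ V - α • hessX f y u
      + κ • (ContinuousLinearMap.id ℝ V + α • hessX e y u))
    (ξ := fun y => (κ * α) • norProj M y (gradX f y u + gradX e y u))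
    ((tendsto_const_nhds.sub ((tendsto_hessX_slice hf.contDiffAt).const_smul α)).add
      ((tendsto_const_nhds.add ((tendsto_hessX_slice hp.ext.smooth).const_smul α)).const_smul κ))
    ((tendsto_norProj_gradX hM hx hf.contDiffAt hp.ext.smooth).const_smul (κ * α))
    (fun y _ => Submodule.smul_mem _ _ (norProj_mem _ _ _))
    (fun v hv hne => by
      rw [key x hp v hv]
      refine hp.pos_of_hasEigenvalue hM hΩ hu hf hα hmult (fun μ hμ => ?_) hv hne
      rw [hκ, ← neg_div]
      exact hev μ hμ)
  filter_upwards [hreg, hPD] with y hy hPDy ud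
  refine hy.tendsto_fpad hM hΩ hu hf hα hβ (fun v hv hne => ?_) ud
  rw [← key y hy v hv]
  exact hPDy v hv hne

end Main

end FixedPointAD

theorem mainTheorem5
    {V P : Type*}
    [NormedAddCommGroup V] [InnerProductSpace ℝ V] [FiniteDimensional ℝ V]
    [NormedAddCommGroup P] [InnerProductSpace ℝ P] [FiniteDimensional ℝ P]
    (f : V → P → ℝ) (g : V → P → EReal) (M : Set V) (Ω : Set P) (L : ℝ≥0)
    (hM : IsC2Submanifold M) (hΩ : IsOpen Ω)
    (hfg : ConvexPartlySmoothObjective f g M Ω L)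
    (xs : V) (hxs : xs ∈ M) (u : P) (hu : u ∈ Ω)
    (hRPD : RestrictivePosDef f g M xs u)
    (hND : NonDegenerate f g xs u)
    (αlo αhi : ℝ) (hlo : 0 < αlo) (hle : αlo ≤ αhi) (hhi : αhi * L < 2) :
    -- near `xs` on `M`, the differentiated fixed-point equation makes sense and `φ(x, u)` is its
    -- one and only solution
    (∀ᶠ x in 𝓝[M] xs, ∀ α ∈ Icc αlo αhi,
      IsNearestPoint (convexSubdiff (fun y => g y u) x) (-gradX f x u) (nu f g x u) ∧
      DifferentiableAt ℝ (fun q : V × P => prox α g q.1 q.2) (wPoint α f g x u, u) ∧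
      DifferentiableAt ℝ (fun u' => riemGrad M (objective f g u') x) u ∧
      ∀ X : P →L[ℝ] V, SolvesImplicitDiff α f g x u X ↔ X = phi α f g M x u) ∧
    -- fixed-point automatic differentiation computes the same `φ(x, u)`
    (∀ α ∈ Icc αlo αhi, ∀ β ∈ Icc (0 : ℝ) 1,
      (∀ lam : ℝ, Module.End.HasEigenvalue
          (fderiv ℝ (fun y => pgdStep α f g y u) xs).toLinearMap lam → -1 / (1 + 2 * β) < lam) →
      ∀ᶠ x in 𝓝[M] xs, ∀ ud : P,
        Tendsto (fun k => (fpad α β f g x u ud k).1) atTop (𝓝 (phi α f g M x u ud))) := by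
  have hf := hfg.f_smooth
  -- `RegularPoint` does not involve `α`, so one neighbourhood serves all step sizes in the first
  -- part.
  obtain ⟨e, hmult, hreg⟩ := eventually_regularPoint hM hΩ hfg hxs hu hRPD.hess_F hND
  refine ⟨?_, fun α hα β hβ hev => ?_⟩
  · filter_upwards [hreg] with x hp α hα
    have hα0 := hlo.trans_le hα.1
    obtain ⟨D, hD, -⟩ := hp.exists_hasFDerivAt hM hΩ hu hf hα0
    refine ⟨?_, hD.differentiableAt,
      (hasFDerivAt_riemGrad_objective hΩ hp.mem hu hf hp.ext).differentiableAt,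
      fun X => hp.solvesImplicitDiff_iff hM hΩ hu hf hα0 X⟩
    rw [hp.nu_eq hu]
    exact (hp.isNearestPoint_multiplier hu).1
  · exact eventually_tendsto_fpad hM hΩ hfg hxs hu hmult hreg (hlo.trans_le hα.1) hβ hev
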